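/- **Conventions.** Let $V=\mathbb R^{1,3}$ with linear coordinates $x^0,\dots,x^3$, metric of signature $(1,3)$ and $\square=\partial_0^2-\partial_1^2-\partial_2^2-\partial_3^2$. Let $H=\mathrm{Spin}(V)\simeq SL(2,\mathbb C)$ and let $G=V\rtimes H$ be the Poincaré group, with $(v,h)$ acting on spacetime by $x\mapsto hx+v$. Let $S_+^*=\mathbb C^2$ with $h$ acting by $h$, let $S_-^*=\mathbb C^2$ with $h$ acting by $\bar h$, and let $\Gamma_{\mathbb C}:S_+^*\otimes S_-^*\to V_{\mathbb C}$ be the equivariant map with $\Gamma_{\mathbb C}(s\otimes t)=v$, where $\sum_\mu v^\mu\sigma_\mu=s\,t^{T}$ ($\sigma_0=1$ and $\sigma_1,\sigma_2,\sigma_3$ the Pauli matrices). For $m>0$ let $\mathcal O_m=\{p\in V^*:\langle p,p\rangle=m^2,\ p_0>0\}$, let $\beta_m=d^3k/(2\sqrt{m^2+|k|^2})$ be the invariant measure on it, let $K\simeq SU(2)$ be the stabilizer of $me^0$ in $H$, and for $p\in\mathcal O_m$ let $h_p\in H$ be an element (chosen measurably in $p$) with $h_p\cdot me^0=p$. Let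 $F_\sigma=\mathrm{Sym}^{2\sigma}\mathbb C^2$ be the spin $\sigma$ representation of $K$, $\sigma\in\frac12\mathbb N$, and let $\mathcal H_{(m,\sigma)}$ be the unitary representation of $G$ on the $L^2$ sections of $H\times_KF_\sigma$ over $\mathcal O_m$ (with respect to $\beta_m$), where $h\in H$ acts by $(h\Psi)_p=h\Psi_{h^{-1}p}$ and $v\in V$ by $(v\Psi)_p=e^{ip(v)}\Psi_p$. Let $\alpha,\beta\in\{\frac12,1,\frac32,\dots\}$ and $W=\mathrm{Sym}^{2\alpha}S_+^*\otimes\mathrm{Sym}^{2\beta}S_-^*$. Its elements are realized as tensors with $2(\alpha+\beta)$ slots and carry the standard Hermitian product $\langle\cdot,\cdot\rangle_0$, which is $K$-invariant. Put $\langle w,w'\rangle_p=\langle h_p^{-1}w,h_p^{-1}w'\rangle_0$ for $p\in\mathcal O_m$, for every mass $m>0$. For a representation $E$ of $H$ and a $K$-equivariant linear map $u:W\to E$, the symbol of $u$ is $\zeta_u(p)=h_p\circ u\circ h_p^{-1}$, $p\in\mathcal O_m$. Let $L^2(\zeta_u)$ be the space of classes of measurable $\Psi:\mathcal O_m\to W$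 with $\int\langle\Psi(p),\Psi(p)\rangle_p\,d\beta_m(p)<\infty$ and $\zeta_u(p)(\Psi(p))=0$ for almost every $p$, with the inner product $\int\langle\Psi,\Psi'\rangle_p\,d\beta_m$ and the action $((v,h)\Psi)(p)=e^{ip(v)}\,h\,\Psi(h^{-1}p)$ of $G$. Fields are tempered distributions $\phi$ on spacetime with values in $W$, and $G$ acts on them by $(g\phi)(x)=h\,\phi(g^{-1}x)$ for $g=(v,h)$. A field is called *of positive energy* if there are a $\sigma$-finite measure $\rho$ on the masses $\mu>0$ and, with $\nu=\int\beta_\mu\,d\rho(\mu)$, a measurable $W$-valued $\psi$ with $\int\langle\psi(p),\psi(p)\rangle_p\,d\nu(p)<\infty$, such that $\phi(x)=\int e^{-ip(x)}\psi(p)\,d\nu(p)$ in the sense of distributions. Let $\iota:W\hookrightarrow S_+^*\otimes S_-^*\otimes\mathrm{Sym}^{2\alpha-1}S_+^*\otimes\mathrm{Sym}^{2\beta-1}S_-^*$ be the inclusion, and let $\delta_{\alpha,\beta}$ be the first-order operator from $W$-valued to $\mathrm{Sym}^{2\alpha-1}S_+^*\otimes\mathrm{Sym}^{2\beta-1}S_-^*$-valued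 fields given by $\delta_{\alpha,\beta}\phi=\sum_\mu\big((e^\mu\circ\Gamma_{\mathbb C})\otimes\mathrm{Id}\big)\iota(-i\,\partial_\mu\phi)$. **Theorem.** Let $m>0$ and $\alpha,\beta\in\{\frac12,1,\frac32,\dots\}$. (i) $F_\sigma$ occurs in the restriction of $W$ to $K$ if and only if $|\alpha-\beta|\le\sigma\le\alpha+\beta$ and $\alpha+\beta-\sigma\in\mathbb Z$. For every such $\sigma$ there is a $K$-equivariant linear map $u:W\to W$ whose kernel is isomorphic to $F_\sigma$ as a representation of $K$. (ii) (Momentum space.) Let $E$ be a representation of $H$ and $u:W\to E$ a $K$-equivariant linear map with $\ker u\simeq F_\sigma$ as representations of $K$. Then $\zeta_u(hp)=h\circ\zeta_u(p)\circ h^{-1}$ for all $h\in H$, $p\in\mathcal O_m$, and $\mathcal H_{(m,\sigma)}$ is unitarily and $G$-equivariantly isomorphic to $L^2(\zeta_u)$. (iii) (Minimal case $\sigma=\alpha+\beta$.) The map $u=((e^0\circ\Gamma_{\mathbb C})\otimes\mathrm{Id})\circ\iota:W\to\mathrm{Sym}^{2\alpha-1}S_+^*\otimes\mathrm{Sym}^{2\beta-1}S_-^*$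 is $K$-equivariant, its kernel is isomorphic to $F_{\alpha+\beta}$, and $m\,\zeta_u(p)=((p\circ\Gamma_{\mathbb C})\otimes\mathrm{Id})\circ\iota$ for all $p\in\mathcal O_m$. (iv) (Spacetime, $\sigma=\alpha+\beta$.) For the $u$ of (iii) there is a unitary $G$-equivariant isomorphism $\xi\mapsto\widehat\phi_\xi$ of $\mathcal H_{(m,\sigma)}$ onto $L^2(\zeta_u)$ such that $\xi\mapsto\phi_\xi$, $\phi_\xi(x)=\int_{\mathcal O_m}e^{-ip(x)}\,\widehat\phi_\xi(p)\,d\beta_m(p)$, is a well-defined injective linear $G$-equivariant map from $\mathcal H_{(m,\sigma)}$ to the $W$-valued fields. Its image consists precisely of the positive energy fields $\phi$ with $$(\square+m^2)\phi=0,\qquad \delta_{\alpha,\beta}\phi=0 .$$ A positive energy field given by a smooth function lies in the image if and only if that function satisfies these two equations pointwise, and the $\xi$ for which $\phi_\xi$ is given by a smooth function are dense in $\mathcal H_{(m,\sigma)}$. -/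

import Mathlib

open MeasureTheory
open scoped ComplexConjugate SchwartzMap LineDeriv ContDiff

namespace SpinField

noncomputable section

/-- Minkowski spacetime in inertial coordinates `x⁰, …, x³` (`c = 1`), identified with the vector
space `V` of translations. -/
abbrev Spacetime := EuclideanSpace ℝ (Fin 4)
/-- The dual space `V*` of momenta, in the dual coordinates `p₀, …, p₃`. -/
abbrev Momentum := EuclideanSpace ℝ (Fin 4)

/-- The duality pairing `p(x)`. -/
def pairing (p : Momentum) (x : Spacetime) : ℝ := ∑ μ, p μ * x μ

/-- The Minkowski square `⟨p, p⟩ = p₀² - p₁² - p₂² - p₃²`. -/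
def minkSq (p : Momentum) : ℝ := p 0 ^ 2 - p 1 ^ 2 - p 2 ^ 2 - p 3 ^ 2

/-- `SL(2, ℂ)`, the group `Spin(V)` in signature `(1, 3)`. -/
abbrev SL2C := Matrix.SpecialLinearGroup (Fin 2) ℂ

/-- The matrices `σ₀ = 1, σ₁, σ₂, σ₃`. -/
def pauli : Fin 4 → Matrix (Fin 2) (Fin 2) ℂ :=
  ![1, !![0, 1; 1, 0], !![0, -Complex.I; Complex.I, 0], !![1, 0; 0, -1]]

/-- The Hermitian matrix `∑ μ, x μ • σ_μ`. -/
def herm (x : EuclideanSpace ℝ (Fin 4)) : Matrix (Fin 2) (Fin 2) ℂ :=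
  ∑ μ, (x μ : ℂ) • pauli μ

/-- The inverse of `herm` on Hermitian matrices. -/
def coords (X : Matrix (Fin 2) (Fin 2) ℂ) : EuclideanSpace ℝ (Fin 4) :=
  WithLp.toLp 2 fun μ => (1 / 2 : ℝ) * (pauli μ * X).trace.re

lemma herm_eq (x : EuclideanSpace ℝ (Fin 4)) :
    herm x = !![(x 0 + x 3 : ℂ), x 1 - x 2 * Complex.I; x 1 + x 2 * Complex.I, x 0 - x 3] := by
  ext i j
  fin_cases i <;> fin_cases j <;>
    simp [herm, pauli, Fin.sum_univ_four, sub_eq_add_neg]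

lemma coords_herm (x : EuclideanSpace ℝ (Fin 4)) : coords (herm x) = x := by
  ext μ
  rw [herm_eq]
  fin_cases μ <;>
    simp [coords, pauli, Matrix.trace_fin_two, Matrix.mul_apply, Fin.sum_univ_two] <;> ring

lemma herm_coords {X : Matrix (Fin 2) (Fin 2) ℂ} (hX : X.IsHermitian) : herm (coords X) = X := by
  rw [herm_eq]
  have h := fun i j => congrFun (congrFun hX i) j
  simp only [Matrix.conjTranspose_apply] at h
  have h00 := h 0 0
  have h11 := h 1 1
  have h01 := h 0 1
  rw [Complex.ext_iff] at h00 h11 h01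
  simp at h00 h11 h01
  ext i j
  fin_cases i <;> fin_cases j <;>
    simp [coords, pauli, Matrix.trace_fin_two, Matrix.mul_apply, Fin.sum_univ_two,
      Complex.ext_iff] <;> constructor <;> linarith [h01.1, h01.2]

lemma isHermitian_herm (x : EuclideanSpace ℝ (Fin 4)) : (herm x).IsHermitian := by
  rw [herm_eq]
  ext i j
  fin_cases i <;> fin_cases j <;> simp [Matrix.conjTranspose_apply, sub_eq_add_neg]

lemma det_herm (x : EuclideanSpace ℝ (Fin 4)) : (herm x).det = (minkSq x : ℂ) := by
  rw [herm_eq, Matrix.det_fin_two_of, minkSq]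
  push_cast
  linear_combination ((x 2 : ℂ) ^ 2) * Complex.I_sq

/-- The action `X ↦ A X A†` in coordinates. -/
def hermAct (A : Matrix (Fin 2) (Fin 2) ℂ) :
    EuclideanSpace ℝ (Fin 4) →ₗ[ℝ] EuclideanSpace ℝ (Fin 4) where
  toFun x := coords (A * herm x * A.conjTranspose)
  map_add' x y := by
    ext μ
    have : herm (x + y) = herm x + herm y := by
      simp [herm, add_smul, Finset.sum_add_distrib]
    simp [coords, this, mul_add, add_mul]
  map_smul' c x := by
    ext μ
    have : herm (c • x) = (c : ℂ) • herm x := by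
      simp [herm, mul_smul, Finset.smul_sum]
    simp [coords, this]
    ring

lemma herm_hermAct (A : Matrix (Fin 2) (Fin 2) ℂ) (x : EuclideanSpace ℝ (Fin 4)) :
    herm (hermAct A x) = A * herm x * A.conjTranspose :=
  herm_coords (Matrix.isHermitian_mul_mul_conjTranspose A (isHermitian_herm x))

lemma hermAct_one : hermAct 1 = 1 := by
  ext1 x; simp [hermAct, coords_herm]

lemma hermAct_mul (A B : Matrix (Fin 2) (Fin 2) ℂ) : hermAct (A * B) = hermAct A * hermAct B := by
  ext1 x
  rw [Module.End.mul_apply]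
  conv_rhs => rw [← coords_herm (hermAct A _), herm_hermAct, herm_hermAct]
  rw [← coords_herm (hermAct (A * B) x), herm_hermAct, Matrix.conjTranspose_mul]
  simp only [mul_assoc]

/-- The vector representation of `SL(2, ℂ)` on `V`: `X ↦ h X h†`. -/
def lorentz : SL2C →* (Spacetime →ₗ[ℝ] Spacetime) where
  toFun h := hermAct h
  map_one' := by simp [hermAct_one]
  map_mul' g h := by simp [hermAct_mul]

/-- The dual representation of `SL(2, ℂ)` on `V*`: `P ↦ (h⁻¹)† P h⁻¹`. -/
def colorentz : SL2C →* (Momentum →ₗ[ℝ] Momentum) where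
  toFun h := hermAct ((h⁻¹ : SL2C) : Matrix (Fin 2) (Fin 2) ℂ).conjTranspose
  map_one' := by simp [hermAct_one]
  map_mul' g h := by
    simp only [mul_inv_rev, Matrix.SpecialLinearGroup.coe_mul, Matrix.conjTranspose_mul, hermAct_mul]

lemma pairing_eq (p : Momentum) (x : Spacetime) :
    (pairing p x : ℂ) = 1 / 2 * (herm p * herm x).trace := by
  rw [herm_eq, herm_eq]
  simp [pairing, Matrix.trace_fin_two, Fin.sum_univ_four]
  linear_combination ( (p 2 : ℂ) * x 2) * Complex.I_sq

lemma pairing_colorentz (h : SL2C) (p : Momentum) (x : Spacetime) :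
    pairing (colorentz h p) (lorentz h x) = pairing p x := by
  have key : (pairing (colorentz h p) (lorentz h x) : ℂ) = pairing p x := by
    rw [pairing_eq, pairing_eq]
    simp only [colorentz, lorentz, MonoidHom.coe_mk, OneHom.coe_mk, herm_hermAct,
      Matrix.conjTranspose_conjTranspose]
    have h1 : ((h⁻¹ : SL2C) : Matrix (Fin 2) (Fin 2) ℂ) * (h : Matrix (Fin 2) (Fin 2) ℂ) = 1 := by
      rw [← Matrix.SpecialLinearGroup.coe_mul]; simp
    have h2 : (h : Matrix (Fin 2) (Fin 2) ℂ).conjTranspose *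
        ((h⁻¹ : SL2C) : Matrix (Fin 2) (Fin 2) ℂ).conjTranspose = 1 := by
      rw [← Matrix.conjTranspose_mul, h1, Matrix.conjTranspose_one]
    congr 1
    set A := ((h⁻¹ : SL2C) : Matrix (Fin 2) (Fin 2) ℂ)
    set B := (h : Matrix (Fin 2) (Fin 2) ℂ)
    calc (A.conjTranspose * herm p * A * (B * herm x * B.conjTranspose)).trace
        = (A.conjTranspose * (herm p * (A * B) * herm x * B.conjTranspose)).trace := by
          simp only [mul_assoc]
      _ = (herm p * herm x * (B.conjTranspose * A.conjTranspose)).trace := by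
          rw [Matrix.trace_mul_comm, h1]; simp only [mul_assoc, mul_one]
      _ = _ := by rw [h2, mul_one]
  exact_mod_cast key

lemma minkSq_colorentz (h : SL2C) (p : Momentum) : minkSq (colorentz h p) = minkSq p := by
  have : (minkSq (colorentz h p) : ℂ) = minkSq p := by
    rw [← det_herm, ← det_herm]
    have h1 : ((h⁻¹ : SL2C) : Matrix (Fin 2) (Fin 2) ℂ).det = 1 := (h⁻¹).2
    simp only [colorentz, MonoidHom.coe_mk, OneHom.coe_mk, herm_hermAct, Matrix.det_mul,
      Matrix.det_conjTranspose, h1, Matrix.conjTranspose_conjTranspose]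
    simp
  exact_mod_cast this

/-- The (double cover of the) Poincaré group `V ⋊ Spin(V)`; `⟨v, h⟩` acts by `x ↦ h x + v`. -/
@[ext]
structure Poincare where
  trans : Spacetime
  lin : SL2C

namespace Poincare
instance : Mul Poincare := ⟨fun g g' => ⟨g.trans + lorentz g.lin g'.trans, g.lin * g'.lin⟩⟩
instance : One Poincare := ⟨⟨0, 1⟩⟩
instance : Inv Poincare := ⟨fun g => ⟨-lorentz g.lin⁻¹ g.trans, g.lin⁻¹⟩⟩

lemma mul_trans (g g' : Poincare) : (g * g').trans = g.trans + lorentz g.lin g'.trans := rfl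
lemma mul_lin (g g' : Poincare) : (g * g').lin = g.lin * g'.lin := rfl
lemma one_trans : (1 : Poincare).trans = 0 := rfl
lemma one_lin : (1 : Poincare).lin = 1 := rfl
lemma inv_trans (g : Poincare) : g⁻¹.trans = -lorentz g.lin⁻¹ g.trans := rfl
lemma inv_lin (g : Poincare) : g⁻¹.lin = g.lin⁻¹ := rfl

instance : Group Poincare :=
  Group.ofLeftAxioms
    (fun a b c => by
      ext1
      · simp [mul_trans, mul_lin, add_assoc]
      · simp [mul_lin, mul_assoc])
    (fun a => by ext1 <;> simp [mul_trans, mul_lin, one_trans, one_lin])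
    (fun a => by ext1 <;> simp [mul_trans, mul_lin, one_trans, one_lin, inv_trans, inv_lin])

end Poincare

/-- Indices of a tensor with `a` slots in `S_+^*` and `b` slots in `S_-^*`. -/
abbrev TensorIndex (a b : ℕ) := (Fin a → Fin 2) × (Fin b → Fin 2)

/-- `Sym^a S_+^* ⊗ Sym^b S_-^*`: the tensors in `a` slots in `S_+^* = ℂ²` and `b` slots in
`S_-^* = ℂ²` which are symmetric in the first and in the second kind of slots, with the standard
Hermitian product of `ℂ^(2^(a+b))`. -/
def SpinTensor (a b : ℕ) : Submodule ℂ (EuclideanSpace ℂ (TensorIndex a b)) where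
  carrier := {w | ∀ (π : Equiv.Perm (Fin a)) (τ : Equiv.Perm (Fin b)) (I : TensorIndex a b),
    w (I.1 ∘ π, I.2 ∘ τ) = w I}
  add_mem' hv hw π τ I := by simp [hv π τ I, hw π τ I]
  zero_mem' π τ I := by simp
  smul_mem' c w hw π τ I := by simp [hw π τ I]

instance (a b : ℕ) : NormedAddCommGroup (SpinTensor a b) := Submodule.normedAddCommGroup _

instance (a b : ℕ) : InnerProductSpace ℂ (SpinTensor a b) := Submodule.innerProductSpace _

instance (a b : ℕ) : Module ℂ (SpinTensor a b) := Submodule.module _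

instance (a b : ℕ) : MulAction ℂ (SpinTensor a b) := Module.toDistribMulAction.toMulAction

/-- The matrix of `A^{⊗ a} ⊗ (conj A)^{⊗ b}`. -/
def tensorMatrix (a b : ℕ) (A : Matrix (Fin 2) (Fin 2) ℂ) :
    Matrix (TensorIndex a b) (TensorIndex a b) ℂ :=
  fun I J => (∏ k, A (I.1 k) (J.1 k)) * ∏ l, conj (A (I.2 l) (J.2 l))

lemma tensorMatrix_one (a b : ℕ) : tensorMatrix a b 1 = 1 := by
  ext I J
  simp only [tensorMatrix, Matrix.one_apply, apply_ite (starRingEnd ℂ), map_one, map_zero,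
    Finset.prod_ite_zero, Finset.prod_const_one, Finset.mem_univ, forall_true_left]
  have h : I = J ↔ (∀ k, I.1 k = J.1 k) ∧ ∀ l, I.2 l = J.2 l := by
    rw [Prod.ext_iff, funext_iff, funext_iff]
  split_ifs <;> simp_all

lemma tensorMatrix_mul (a b : ℕ) (A B : Matrix (Fin 2) (Fin 2) ℂ) :
    tensorMatrix a b (A * B) = tensorMatrix a b A * tensorMatrix a b B := by
  ext I J
  simp only [tensorMatrix, Matrix.mul_apply, map_sum, map_mul, Fintype.sum_prod_type,
    Finset.prod_univ_sum, Fintype.piFinset_univ, Finset.prod_mul_distrib]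
  rw [Finset.sum_mul_sum]
  refine Finset.sum_congr rfl fun x _ => Finset.sum_congr rfl fun y _ => by ring

lemma tensorMatrix_conjTranspose (a b : ℕ) (A : Matrix (Fin 2) (Fin 2) ℂ) :
    tensorMatrix a b A.conjTranspose = (tensorMatrix a b A).conjTranspose := by
  ext I J
  simp [tensorMatrix, Matrix.conjTranspose_apply]

lemma tensorMatrix_perm {a b : ℕ} (A : Matrix (Fin 2) (Fin 2) ℂ) (π : Equiv.Perm (Fin a))
    (τ : Equiv.Perm (Fin b)) (I J : TensorIndex a b) :
    tensorMatrix a b A (I.1 ∘ π, I.2 ∘ τ) (J.1 ∘ π, J.2 ∘ τ) = tensorMatrix a b A I J := by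
  simp only [tensorMatrix, Function.comp_apply]
  rw [Equiv.prod_comp π (fun k => A (I.1 k) (J.1 k)),
    Equiv.prod_comp τ (fun k => conj (A (I.2 k) (J.2 k)))]

/-- The restriction of `A^{⊗ a} ⊗ (conj A)^{⊗ b}` to symmetric tensors. -/
def tensorLin (a b : ℕ) (A : Matrix (Fin 2) (Fin 2) ℂ) : SpinTensor a b →ₗ[ℂ] SpinTensor a b where
  toFun w := ⟨WithLp.toLp 2 fun I => ∑ J, tensorMatrix a b A I J * w.1 J, fun π τ I => by
    rw [PiLp.toLp_apply, PiLp.toLp_apply]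
    rw [← Equiv.sum_comp ((π.symm.arrowCongr (Equiv.refl (Fin 2))).prodCongr
      (τ.symm.arrowCongr (Equiv.refl (Fin 2))))]
    refine Finset.sum_congr rfl fun J _ => ?_
    have : ((π.symm.arrowCongr (Equiv.refl (Fin 2))).prodCongr
        (τ.symm.arrowCongr (Equiv.refl (Fin 2)))) J = (J.1 ∘ π, J.2 ∘ τ) := by
      ext <;> simp [Equiv.arrowCongr]
    rw [this, tensorMatrix_perm, w.2 π τ J]⟩
  map_add' v w := by ext I; simp [mul_add, Finset.sum_add_distrib]
  map_smul' c w := by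
    ext I
    simp only [SetLike.val_smul, PiLp.smul_apply, smul_eq_mul, RingHom.id_apply, Finset.mul_sum]
    exact Finset.sum_congr rfl fun J _ => by ring

lemma tensorLin_coe {a b : ℕ} (A : Matrix (Fin 2) (Fin 2) ℂ) (w : SpinTensor a b) :
    (tensorLin a b A w : EuclideanSpace ℂ (TensorIndex a b))
      = Matrix.toEuclideanLin (tensorMatrix a b A) w := rfl

lemma tensorLin_one (a b : ℕ) : tensorLin a b 1 = 1 := by
  ext1 w
  apply Subtype.ext
  rw [tensorLin_coe, tensorMatrix_one]
  simp [Matrix.toEuclideanLin]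

lemma tensorLin_mul (a b : ℕ) (A B : Matrix (Fin 2) (Fin 2) ℂ) :
    tensorLin a b (A * B) = tensorLin a b A * tensorLin a b B := by
  ext1 w
  apply Subtype.ext
  rw [Module.End.mul_apply, tensorLin_coe, tensorLin_coe, tensorLin_coe, tensorMatrix_mul]
  simp [Matrix.toLpLin_apply, Matrix.mulVec_mulVec]

/-- The representation of `SL(2, ℂ)` on `Sym^a S_+^* ⊗ Sym^b S_-^*`: `h` acts by `h` on
`S_+^* = ℂ²` and by its complex conjugate on `S_-^* = ℂ²`. -/
def spinRep (a b : ℕ) : Representation ℂ SL2C (SpinTensor a b) where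
  toFun h := tensorLin a b h
  map_one' := by simp [tensorLin_one]
  map_mul' g h := by simp [tensorLin_mul]

lemma inner_tensorLin {a b : ℕ} {A : Matrix (Fin 2) (Fin 2) ℂ} (hA : A.conjTranspose * A = 1)
    (v w : SpinTensor a b) : inner ℂ (tensorLin a b A v) (tensorLin a b A w) = inner ℂ v w := by
  rw [Submodule.coe_inner, Submodule.coe_inner, tensorLin_coe, tensorLin_coe,
    ← LinearMap.adjoint_inner_left, ← Matrix.toEuclideanLin_conjTranspose_eq_adjoint,
    ← tensorMatrix_conjTranspose]
  congr 1
  simp [Matrix.toLpLin_apply, Matrix.mulVec_mulVec, ← tensorMatrix_mul, hA,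
    tensorMatrix_one]

/-- The rest momentum `m e⁰`. -/
def restMomentum (m : ℝ) : Momentum := EuclideanSpace.single 0 m

/-- The positive energy mass shell `O_m`. -/
def massShell (m : ℝ) : Set Momentum := {p | minkSq p = m ^ 2 ∧ 0 < p 0}

/-- The little group `K`, the stabilizer of the rest momentum. -/
def littleGroup (m : ℝ) : Subgroup SL2C where
  carrier := {k | colorentz k (restMomentum m) = restMomentum m}
  mul_mem' {g h} hg hh := by
    simp only [Set.mem_ofPred_eq] at *
    rw [map_mul, Module.End.mul_apply, hh, hg]
  one_mem' := by simp
  inv_mem' {g} hg := by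
    simp only [Set.mem_ofPred_eq] at *
    conv_lhs => rw [← hg]
    rw [← Module.End.mul_apply, ← map_mul]
    simp

lemma herm_restMomentum (m : ℝ) : herm (restMomentum m) = (m : ℂ) • 1 := by
  rw [herm_eq]
  ext i j
  fin_cases i <;> fin_cases j <;> simp [restMomentum]

lemma herm_colorentz (h : SL2C) (p : Momentum) :
    herm (colorentz h p) = ((h⁻¹ : SL2C) : Matrix (Fin 2) (Fin 2) ℂ).conjTranspose * herm p *
      ((h⁻¹ : SL2C) : Matrix (Fin 2) (Fin 2) ℂ) := by
  simp only [colorentz, MonoidHom.coe_mk, OneHom.coe_mk, herm_hermAct,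
    Matrix.conjTranspose_conjTranspose]

lemma unitary_of_mem_littleGroup {m : ℝ} (hm : 0 < m) {k : SL2C} (hk : k ∈ littleGroup m) :
    (k : Matrix (Fin 2) (Fin 2) ℂ).conjTranspose * (k : Matrix (Fin 2) (Fin 2) ℂ) = 1 := by
  have h1 : colorentz k⁻¹ (restMomentum m) = restMomentum m := (littleGroup m).inv_mem hk
  have h2 := herm_colorentz k⁻¹ (restMomentum m)
  rw [h1, herm_restMomentum, inv_inv, Matrix.mul_smul, Matrix.smul_mul, mul_one] at h2
  have hm' : (m : ℂ) ≠ 0 := by exact_mod_cast hm.ne'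
  exact (smul_right_injective _ hm' h2).symm

/-- The matrix `√(P / m) = (P + m) / √(2 m (p₀ + m))` of the inverse of the pure boost to `p`. -/
def boostInvMatrix (m : ℝ) (p : Momentum) : Matrix (Fin 2) (Fin 2) ℂ :=
  (((√(2 * m * (p 0 + m)))⁻¹ : ℝ) : ℂ) • (herm p + (m : ℂ) • 1)

lemma herm_sq (p : Momentum) :
    herm p * herm p = ((2 * p 0 : ℝ) : ℂ) • herm p - ((minkSq p : ℝ) : ℂ) • 1 := by
  rw [herm_eq, minkSq]
  ext i j
  fin_cases i <;> fin_cases j <;> simp [Matrix.mul_apply, Fin.sum_univ_two] <;>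
    first
    | linear_combination (-(p 2 : ℂ) ^ 2) * Complex.I_sq
    | ring

lemma boostInvMatrix_mul_self {m : ℝ} (hm : 0 < m) {p : Momentum} (hp : p ∈ massShell m) :
    (m : ℂ) • (boostInvMatrix m p * boostInvMatrix m p) = herm p := by
  obtain ⟨h1, h2⟩ := hp
  have hpos : 0 < 2 * m * (p 0 + m) := by positivity
  have hs : (((√(2 * m * (p 0 + m)))⁻¹ : ℝ) : ℂ) * (((√(2 * m * (p 0 + m)))⁻¹ : ℝ) : ℂ)
      = (((2 * m * (p 0 + m))⁻¹ : ℝ) : ℂ) := by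
    rw [← Complex.ofReal_mul, ← mul_inv, Real.mul_self_sqrt hpos.le]
  have e : (herm p + (m : ℂ) • 1) * (herm p + (m : ℂ) • 1)
      = ((2 * (p 0 + m) : ℝ) : ℂ) • herm p := by
    rw [add_mul, mul_add, mul_add, herm_sq, h1]
    simp only [Matrix.mul_smul, Matrix.smul_mul, mul_one, one_mul]
    push_cast
    module
  rw [boostInvMatrix, Matrix.smul_mul, Matrix.mul_smul, e, smul_smul, smul_smul, smul_smul,
    mul_assoc (m : ℂ), hs, ← Complex.ofReal_mul, ← Complex.ofReal_mul]
  have : m * (2 * m * (p 0 + m))⁻¹ * (2 * (p 0 + m)) = 1 := by field_simp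
  rw [this, Complex.ofReal_one, one_smul]

lemma isHermitian_boostInvMatrix (m : ℝ) (p : Momentum) : (boostInvMatrix m p).IsHermitian := by
  unfold boostInvMatrix Matrix.IsHermitian
  rw [Matrix.conjTranspose_smul, Matrix.conjTranspose_add, isHermitian_herm p]
  simp

lemma det_boostInvMatrix {m : ℝ} (hm : 0 < m) {p : Momentum} (hp : p ∈ massShell m) :
    (boostInvMatrix m p).det = 1 := by
  obtain ⟨h1, h2⟩ := hp
  have hpos : 0 < 2 * m * (p 0 + m) := by positivity
  have hs : (((√(2 * m * (p 0 + m)))⁻¹ : ℝ) : ℂ) ^ 2 = (((2 * m * (p 0 + m))⁻¹ : ℝ) : ℂ) := by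
    rw [← Complex.ofReal_pow, inv_pow, Real.sq_sqrt hpos.le]
  have e : (herm p + (m : ℂ) • 1).det = ((2 * m * (p 0 + m) : ℝ) : ℂ) := by
    have h1' : ((minkSq p : ℝ) : ℂ) = (m : ℂ) ^ 2 := by rw [h1]; push_cast; rfl
    rw [← det_herm, herm_eq, Matrix.det_fin_two_of] at h1'
    rw [herm_eq, Matrix.det_fin_two]
    simp
    linear_combination h1'
  rw [boostInvMatrix, Matrix.det_smul, e, Fintype.card_fin, hs, ← Complex.ofReal_mul,
    inv_mul_cancel₀ hpos.ne', Complex.ofReal_one]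

/-- The inverse of `boost m p`. -/
def boostInv (m : ℝ) (p : Momentum) : SL2C :=
  if h : (boostInvMatrix m p).det = 1 then ⟨boostInvMatrix m p, h⟩ else 1

/-- A measurable choice `h_p` of an element taking the rest momentum to `p` in `O_m`, namely the
pure boost (`1` if `p` is not in `O_m`). -/
def boost (m : ℝ) (p : Momentum) : SL2C := (boostInv m p)⁻¹

lemma coe_boost_inv {m : ℝ} (hm : 0 < m) {p : Momentum} (hp : p ∈ massShell m) :
    (((boost m p)⁻¹ : SL2C) : Matrix (Fin 2) (Fin 2) ℂ) = boostInvMatrix m p := by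
  rw [boost, inv_inv]
  exact congrArg Subtype.val (dif_pos (det_boostInvMatrix hm hp) : boostInv m p = _)

lemma colorentz_boost {m : ℝ} (hm : 0 < m) {p : Momentum} (hp : p ∈ massShell m) :
    colorentz (boost m p) (restMomentum m) = p := by
  rw [← coords_herm (colorentz _ _), herm_colorentz, coe_boost_inv hm hp, herm_restMomentum,
    isHermitian_boostInvMatrix, Matrix.mul_smul, Matrix.smul_mul, mul_one,
    boostInvMatrix_mul_self hm hp, coords_herm]

lemma colorentz_mem_massShell {m : ℝ} (hm : 0 < m) (h : SL2C) {p : Momentum}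
    (hp : p ∈ massShell m) : colorentz h p ∈ massShell m := by
  refine ⟨by rw [minkSq_colorentz, hp.1], ?_⟩
  have h0 : ∀ q : Momentum, (q 0 : ℂ) = 1 / 2 * (herm q).trace := by
    intro q; rw [herm_eq, Matrix.trace_fin_two]; simp; ring
  set D : Matrix (Fin 2) (Fin 2) ℂ :=
    boostInvMatrix m p * ((h⁻¹ : SL2C) : Matrix (Fin 2) (Fin 2) ℂ) with hD
  have hdet : D.det = 1 := by
    rw [hD, Matrix.det_mul, det_boostInvMatrix hm hp, one_mul]; exact (h⁻¹).2
  have h1 : herm (colorentz h p) = (m : ℂ) • (D.conjTranspose * D) := by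
    rw [herm_colorentz, ← boostInvMatrix_mul_self hm hp, hD, Matrix.conjTranspose_mul,
      isHermitian_boostInvMatrix]
    simp only [Matrix.mul_smul, Matrix.smul_mul, mul_assoc]
  have h2 : (colorentz h p) 0 = m / 2 * ∑ i, ∑ j, Complex.normSq (D i j) := by
    have : (((colorentz h p) 0 : ℝ) : ℂ)
        = ((m / 2 * ∑ i, ∑ j, Complex.normSq (D i j) : ℝ) : ℂ) := by
      rw [h0, h1, Matrix.trace_smul, Matrix.trace_fin_two]
      simp only [Matrix.mul_apply, Matrix.conjTranspose_apply, Fin.sum_univ_two, smul_eq_mul]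
      push_cast
      simp only [Complex.normSq_eq_conj_mul_self, RCLike.star_def]
      ring
    exact_mod_cast this
  rw [h2]
  have h3 : 0 < ∑ i, ∑ j, Complex.normSq (D i j) := by
    rw [Fin.sum_univ_two, Fin.sum_univ_two, Fin.sum_univ_two]
    by_contra hcon
    have n := fun i j => Complex.normSq_nonneg (D i j)
    have a00 : Complex.normSq (D 0 0) = 0 := by linarith [n 0 0, n 0 1, n 1 0, n 1 1]
    have a01 : Complex.normSq (D 0 1) = 0 := by linarith [n 0 0, n 0 1, n 1 0, n 1 1]
    rw [Complex.normSq_eq_zero] at a00 a01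
    rw [Matrix.det_fin_two, a00, a01] at hdet
    simp at hdet
  positivity

lemma wigner_mem_littleGroup {m : ℝ} (hm : 0 < m) (h : SL2C) {p : Momentum}
    (hp : p ∈ massShell m) :
    (boost m (colorentz h p))⁻¹ * h * boost m p ∈ littleGroup m := by
  change colorentz _ _ = _
  rw [map_mul, map_mul, Module.End.mul_apply, Module.End.mul_apply, colorentz_boost hm hp]
  have h1 := colorentz_boost hm (colorentz_mem_massShell hm h hp)
  calc colorentz (boost m (colorentz h p))⁻¹ (colorentz h p)
      = colorentz (boost m (colorentz h p))⁻¹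
          (colorentz (boost m (colorentz h p)) (restMomentum m)) := by rw [h1]
    _ = restMomentum m := by
        rw [← Module.End.mul_apply, ← map_mul, inv_mul_cancel, map_one, Module.End.one_apply]

/-- The point of the mass shell `O_m` with spatial momentum `k`. -/
def shellPoint (m : ℝ) (k : EuclideanSpace ℝ (Fin 3)) : Momentum :=
  !₂[√(m ^ 2 + ‖k‖ ^ 2), k 0, k 1, k 2]

/-- The Lorentz invariant measure `β_m = d³k / (2 √(m² + |k|²))` on the mass shell `O_m`. -/
def shellMeasure (m : ℝ) : Measure Momentum :=
  (volume.withDensity fun k : EuclideanSpace ℝ (Fin 3) =>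
    ENNReal.ofReal (1 / (2 * √(m ^ 2 + ‖k‖ ^ 2)))).map (shellPoint m)

lemma continuous_shellPoint (m : ℝ) : Continuous (shellPoint m) := by
  unfold shellPoint
  refine (PiLp.continuous_toLp 2 _).comp (continuous_pi fun i => ?_)
  fin_cases i <;> simp <;> fun_prop

lemma lintegral_shellMeasure (m : ℝ) {f : Momentum → ENNReal} (hf : Measurable f) :
    ∫⁻ p, f p ∂shellMeasure m
      = ∫⁻ k : EuclideanSpace ℝ (Fin 3),
          ENNReal.ofReal (1 / (2 * √(m ^ 2 + ‖k‖ ^ 2))) * f (shellPoint m k) := by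
  rw [shellMeasure, lintegral_map hf (continuous_shellPoint m).measurable,
    lintegral_withDensity_eq_lintegral_mul _ (by fun_prop)
      (g := fun k => f (shellPoint m k)) (hf.comp (continuous_shellPoint m).measurable)]
  rfl

lemma shellPoint_mem {m : ℝ} (hm : 0 < m) (k : EuclideanSpace ℝ (Fin 3)) :
    shellPoint m k ∈ massShell m := by
  have h : 0 < m ^ 2 + ‖k‖ ^ 2 := by positivity
  refine ⟨?_, by simpa [shellPoint] using h⟩
  simp only [minkSq, shellPoint, PiLp.toLp_apply, Matrix.cons_val]
  rw [Real.sq_sqrt h.le, EuclideanSpace.norm_sq_eq, Fin.sum_univ_three]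
  simp
  ring

lemma measurableSet_massShell (m : ℝ) : MeasurableSet (massShell m) := by
  have h1 : Measurable minkSq := by unfold minkSq; fun_prop
  have h2 : Measurable fun p : Momentum => p 0 := by fun_prop
  exact (measurableSet_eq_fun h1 measurable_const).inter (measurableSet_lt measurable_const h2)

lemma ae_mem_massShell {m : ℝ} (hm : 0 < m) : ∀ᵐ p ∂shellMeasure m, p ∈ massShell m := by
  rw [shellMeasure, ae_map_iff (p := fun p => p ∈ massShell m)
    (continuous_shellPoint m).aemeasurable (measurableSet_massShell m)]
  exact Filter.Eventually.of_forall (shellPoint_mem hm)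

lemma det_colorentz_sq (h : SL2C) : LinearMap.det (colorentz h) ^ 2 = 1 := by
  let B : Momentum → Momentum → ℝ := fun p q => p 0 * q 0 - p 1 * q 1 - p 2 * q 2 - p 3 * q 3
  have hpol : ∀ p q, B p q = (minkSq (p + q) - minkSq (p - q)) / 4 := by
    intro p q; simp only [B, minkSq, PiLp.add_apply, PiLp.sub_apply]; ring
  have hB : ∀ p q, B (colorentz h p) (colorentz h q) = B p q := by
    intro p q
    rw [hpol, hpol, ← map_add, ← map_sub, minkSq_colorentz, minkSq_colorentz]
  let b := (EuclideanSpace.basisFun (Fin 4) ℝ).toBasis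
  let M := LinearMap.toMatrix b b (colorentz h)
  let η : Matrix (Fin 4) (Fin 4) ℝ := Matrix.diagonal ![1, -1, -1, -1]
  have hM : ∀ i j, M i j = colorentz h (EuclideanSpace.single j 1) i := by
    intro i j
    simp [M, b, LinearMap.toMatrix_apply]
  have key : M.transpose * η * M = η := by
    ext i j
    have e1 : (M.transpose * η * M) i j
        = B (colorentz h (EuclideanSpace.single i 1)) (colorentz h (EuclideanSpace.single j 1)) := by
      simp only [Matrix.mul_apply, Matrix.transpose_apply, Fin.sum_univ_four, hM, B, η,
        Matrix.diagonal_apply]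
      simp
      ring
    rw [e1, hB]
    fin_cases i <;> fin_cases j <;> simp [B, η]
  have hdet := congrArg Matrix.det key
  rw [Matrix.det_mul, Matrix.det_mul, Matrix.det_transpose] at hdet
  have hη : η.det ≠ 0 := by
    simp [η, Matrix.det_diagonal, Fin.prod_univ_four]
  rw [← LinearMap.det_toMatrix b]
  change M.det ^ 2 = 1
  apply mul_right_cancel₀ hη
  linear_combination hdet

lemma measurePreserving_volume_colorentz (h : SL2C) :
    MeasurePreserving (colorentz h) (volume : Measure Momentum) volume := by
  have h1 : |LinearMap.det (colorentz h)| = 1 := by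
    rw [← pow_left_inj₀ (abs_nonneg _) zero_le_one two_ne_zero, sq_abs, det_colorentz_sq, one_pow]
  refine ⟨(LinearMap.continuous_of_finiteDimensional _).measurable, ?_⟩
  rw [Measure.map_linearMap_addHaar_eq_smul_addHaar _ (by intro h0; simp [h0] at h1), abs_inv, h1]
  simp

/-- Foliation of Lebesgue measure on the open forward cone by the mass shells. -/
lemma lintegral_cone {F : Momentum → ENNReal} (hF : Measurable F)
    (hF0 : ∀ p, ¬ (0 < minkSq p ∧ 0 < p 0) → F p = 0) :
    ∫⁻ p, F p = ∫⁻ s in Set.Ioi (0 : ℝ), ∫⁻ p, F p ∂shellMeasure √s := by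
  let G : ℝ → EuclideanSpace ℝ (Fin 3) → Momentum := fun e k => !₂[e, k 0, k 1, k 2]
  have hG : MeasurePreserving (Function.uncurry G) (volume.prod volume) volume := by
    have h1 := (PiLp.volume_preserving_toLp (Fin 4)).comp
      ((volume_preserving_piFinSuccAbove (fun _ : Fin 4 => ℝ) 0).symm.comp
        ((MeasurePreserving.id (volume : Measure ℝ)).prod (PiLp.volume_preserving_ofLp (Fin 3))))
    have h2 : Function.uncurry G = WithLp.toLp 2 ∘
        (MeasurableEquiv.piFinSuccAbove (fun _ : Fin 4 => ℝ) 0).symm ∘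
          Prod.map id WithLp.ofLp := by
      funext x
      obtain ⟨e, k⟩ := x
      ext i
      refine Fin.cases ?_ (fun j => ?_) i
      · simp [G, MeasurableEquiv.piFinSuccAbove]
      · fin_cases j <;> simp [G, MeasurableEquiv.piFinSuccAbove] <;> rfl
    rw [h2]
    exact h1
  have hvol : ∫⁻ p, F p = ∫⁻ k, ∫⁻ e, F (G e k) := by
    rw [← hG.lintegral_comp hF, lintegral_prod_symm (fun z => F (Function.uncurry G z))
      (hF.comp hG.measurable).aemeasurable]
    rfl
  have hsub : ∀ k : EuclideanSpace ℝ (Fin 3), ∫⁻ e, F (G e k)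
      = ∫⁻ s in Set.Ioi (0 : ℝ), ENNReal.ofReal (1 / (2 * √(s + ‖k‖ ^ 2))) *
          F (G (√(s + ‖k‖ ^ 2)) k) := by
    intro k
    have himg : (fun s : ℝ => √(s + ‖k‖ ^ 2)) '' Set.Ioi 0 = Set.Ioi ‖k‖ := by
      ext e
      simp only [Set.mem_image, Set.mem_Ioi]
      constructor
      · rintro ⟨s, hs, rfl⟩
        exact Real.lt_sqrt_of_sq_lt (by linarith)
      · intro he
        have h0 := norm_nonneg k
        exact ⟨e ^ 2 - ‖k‖ ^ 2, by nlinarith, by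
          rw [sub_add_cancel, Real.sqrt_sq (by linarith)]⟩
    have hder : ∀ s ∈ Set.Ioi (0 : ℝ), HasDerivWithinAt (fun s : ℝ => √(s + ‖k‖ ^ 2))
        (1 / (2 * √(s + ‖k‖ ^ 2))) (Set.Ioi 0) s := by
      intro s hs
      have hs' : 0 < s := hs
      have := ((hasDerivAt_id s).add_const (‖k‖ ^ 2)).sqrt (by simp; positivity)
      simpa using this.hasDerivWithinAt
    have hinj : Set.InjOn (fun s : ℝ => √(s + ‖k‖ ^ 2)) (Set.Ioi 0) := by
      intro s hs t ht hst
      have hs' : 0 < s := hs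
      have ht' : 0 < t := ht
      have := (Real.sqrt_inj (by positivity) (by positivity)).1 hst
      linarith
    have hch := lintegral_image_eq_lintegral_abs_deriv_mul measurableSet_Ioi hder hinj
      (fun e => F (G e k))
    rw [himg] at hch
    have hsupp : ∫⁻ e, F (G e k) = ∫⁻ e in Set.Ioi ‖k‖, F (G e k) := by
      rw [← lintegral_indicator measurableSet_Ioi]
      refine lintegral_congr fun e => ?_
      by_cases he : e ∈ Set.Ioi ‖k‖
      · rw [Set.indicator_of_mem he]
      · rw [Set.indicator_of_notMem he]
        apply hF0
        rintro ⟨h1, h2⟩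
        apply he
        have e1 : minkSq (G e k) = e ^ 2 - ‖k‖ ^ 2 := by
          rw [EuclideanSpace.norm_sq_eq, Fin.sum_univ_three]
          simp [minkSq, G]
          ring
        have e2 : 0 < e := by simpa [G] using h2
        rw [e1] at h1
        exact lt_of_pow_lt_pow_left₀ 2 e2.le (by linarith)
    rw [hsupp, hch]
    refine setLIntegral_congr_fun measurableSet_Ioi fun s hs => ?_
    rw [abs_of_nonneg (by positivity)]
  have hGc : Measurable (fun x : EuclideanSpace ℝ (Fin 3) × ℝ =>
      ENNReal.ofReal (1 / (2 * √(x.2 + ‖x.1‖ ^ 2))) * F (G (√(x.2 + ‖x.1‖ ^ 2)) x.1)) := by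
    refine Measurable.mul (by fun_prop) (hF.comp (hG.measurable.comp
      (g := Function.uncurry G) (f := fun x : EuclideanSpace ℝ (Fin 3) × ℝ =>
        (√(x.2 + ‖x.1‖ ^ 2), x.1)) (by fun_prop)))
  rw [hvol, lintegral_congr hsub, lintegral_lintegral_swap hGc.aemeasurable]
  refine setLIntegral_congr_fun measurableSet_Ioi fun s hs => ?_
  have hs' : (0 : ℝ) < s := hs
  rw [lintegral_shellMeasure _ hF]
  refine lintegral_congr fun k => ?_
  rw [Real.sq_sqrt hs'.le]
  simp only [G, shellPoint, Real.sq_sqrt hs'.le]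

lemma lintegral_shellMeasure_scale {m : ℝ} (hm : 0 < m) {s : ℝ} (hs : 0 < s)
    {f : Momentum → ENNReal} (hf : Measurable f) :
    ∫⁻ p, f ((m / √s) • p) ∂shellMeasure √s
      = ENNReal.ofReal (s / m ^ 2) * ∫⁻ p, f p ∂shellMeasure m := by
  have hr : 0 < √s := Real.sqrt_pos.2 hs
  set r := √s with hrdef
  have hs2 : s = r ^ 2 := (Real.sq_sqrt hs.le).symm
  have hc : 0 < m / r := by positivity
  have hf' : Measurable fun p : Momentum => f ((m / r) • p) := hf.comp (by fun_prop)
  rw [lintegral_shellMeasure _ hf', lintegral_shellMeasure _ hf]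
  have hmap := Measure.map_addHaar_smul (volume : Measure (EuclideanSpace ℝ (Fin 3))) hc.ne'
  have hg : Measurable fun k : EuclideanSpace ℝ (Fin 3) =>
      ENNReal.ofReal (1 / (2 * √(m ^ 2 + ‖k‖ ^ 2))) * f (shellPoint m k) :=
    Measurable.mul (by fun_prop) (hf.comp (continuous_shellPoint m).measurable)
  have h1 := lintegral_map (μ := (volume : Measure (EuclideanSpace ℝ (Fin 3)))) hg
    (measurable_const_smul (m / r))
  rw [hmap, lintegral_smul_measure] at h1
  have hkey : ∀ k : EuclideanSpace ℝ (Fin 3),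
      √(m ^ 2 + ‖(m / r) • k‖ ^ 2) = (m / r) * √(r ^ 2 + ‖k‖ ^ 2) := by
    intro k
    rw [norm_smul, Real.norm_of_nonneg hc.le, ← Real.sqrt_sq hc.le,
      ← Real.sqrt_mul (by positivity), Real.sqrt_sq hc.le]
    congr 1
    field_simp
  have hpt : ∀ k : EuclideanSpace ℝ (Fin 3), shellPoint m ((m / r) • k) = (m / r) • shellPoint r k := by
    intro k
    ext i
    fin_cases i
    · simpa [shellPoint] using hkey k
    all_goals simp [shellPoint]
  simp only [hkey, hpt] at h1
  have h2 : ∀ k : EuclideanSpace ℝ (Fin 3),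
      ENNReal.ofReal (1 / (2 * √(r ^ 2 + ‖k‖ ^ 2))) * f ((m / r) • shellPoint r k)
      = ENNReal.ofReal (m / r) * (ENNReal.ofReal (1 / (2 * (m / r * √(r ^ 2 + ‖k‖ ^ 2)))) *
        f ((m / r) • shellPoint r k)) := by
    intro k
    rw [← mul_assoc, ← ENNReal.ofReal_mul hc.le]
    congr 2
    have : 0 < √(r ^ 2 + ‖k‖ ^ 2) := Real.sqrt_pos.2 (by positivity)
    field_simp
  rw [lintegral_congr h2, lintegral_const_mul' _ _ ENNReal.ofReal_ne_top, ← h1, smul_eq_mul,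
    ← mul_assoc, ← ENNReal.ofReal_mul hc.le]
  congr 2
  rw [finrank_euclideanSpace_fin, abs_of_pos (by positivity), hs2]
  field_simp

lemma forward_cone (h : SL2C) {p : Momentum} (hp : 0 < minkSq p ∧ 0 < p 0) :
    0 < minkSq (colorentz h p) ∧ 0 < (colorentz h p) 0 :=
  ⟨by rw [minkSq_colorentz]; exact hp.1,
    (colorentz_mem_massShell (Real.sqrt_pos.2 hp.1) h (p := p)
      ⟨(Real.sq_sqrt hp.1.le).symm, hp.2⟩).2⟩

lemma lintegral_shellMeasure_colorentz {m : ℝ} (hm : 0 < m) (h : SL2C)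
    {f : Momentum → ENNReal} (hf : Measurable f) :
    ∫⁻ p, f (colorentz h p) ∂shellMeasure m = ∫⁻ p, f p ∂shellMeasure m := by
  have hmeas : Measurable (colorentz h) := (measurePreserving_volume_colorentz h).measurable
  have hmink : Measurable minkSq := by unfold minkSq; fun_prop
  -- the degree-zero homogeneous extension of a function on the shell, cut off
  let E : (Momentum → ENNReal) → Momentum → ENNReal := fun g =>
    {p : Momentum | (0 < minkSq p ∧ 0 < p 0) ∧ minkSq p < 1}.indicator
      fun p => g ((m / √(minkSq p)) • p)
  have hset : MeasurableSet {p : Momentum | (0 < minkSq p ∧ 0 < p 0) ∧ minkSq p < 1} :=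
    ((measurableSet_lt measurable_const hmink).inter
      (measurableSet_lt measurable_const (g := fun p : Momentum => p 0) (by fun_prop))).inter
      (measurableSet_lt hmink measurable_const)
  have hEm : ∀ g, Measurable g → Measurable (E g) := fun g hg =>
    (hg.comp (by fun_prop)).indicator hset
  let c : ENNReal := ∫⁻ s in Set.Ioi (0 : ℝ), (Set.Iio (1 : ℝ)).indicator
    (fun s => ENNReal.ofReal (s / m ^ 2)) s
  have hE : ∀ g, Measurable g → ∫⁻ p, E g p = c * ∫⁻ p, g p ∂shellMeasure m := by
    intro g hg
    rw [lintegral_cone (hEm g hg) (fun p hp => Set.indicator_of_notMem (fun h => hp h.1) _)]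
    rw [← lintegral_mul_const _ (Measurable.indicator (by fun_prop) measurableSet_Iio)]
    refine setLIntegral_congr_fun measurableSet_Ioi fun s hs => ?_
    have hs' : (0 : ℝ) < s := hs
    have hsq : 0 < √s := Real.sqrt_pos.2 hs'
    have hae : ∀ᵐ p ∂shellMeasure √s, E g p
        = (Set.Iio (1 : ℝ)).indicator (fun _ => g ((m / √s) • p)) s := by
      filter_upwards [ae_mem_massShell hsq] with p hp
      have h1 : minkSq p = s := by rw [hp.1, Real.sq_sqrt hs'.le]
      by_cases h2 : s < 1
      · rw [Set.indicator_of_mem (show s ∈ Set.Iio (1 : ℝ) from h2)]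
        simp only [E]
        rw [Set.indicator_of_mem (show p ∈ {p : Momentum | (0 < minkSq p ∧ 0 < p 0) ∧ minkSq p < 1}
          from ⟨⟨h1 ▸ hs', hp.2⟩, h1 ▸ h2⟩), h1]
      · rw [Set.indicator_of_notMem (show s ∉ Set.Iio (1 : ℝ) from h2)]
        exact Set.indicator_of_notMem (fun h => h2 (h1 ▸ h.2)) _
    rw [lintegral_congr_ae hae]
    by_cases h2 : s < 1
    · simp only [Set.indicator_of_mem (show s ∈ Set.Iio (1 : ℝ) from h2)]
      exact lintegral_shellMeasure_scale hm hs' hg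
    · simp only [Set.indicator_of_notMem (show s ∉ Set.Iio (1 : ℝ) from h2)]
      simp
  have hc0 : c ≠ 0 := by
    intro h0
    have hmeas0 : Measurable ((Set.Iio (1 : ℝ)).indicator
        (fun s => ENNReal.ofReal (s / m ^ 2))) :=
      Measurable.indicator (by fun_prop) measurableSet_Iio
    rw [lintegral_eq_zero_iff hmeas0] at h0
    have h1 : ∀ᵐ s : ℝ, s ∉ Set.Ioo (0 : ℝ) 1 := by
      rw [Filter.EventuallyEq, ae_restrict_iff' measurableSet_Ioi] at h0
      filter_upwards [h0] with s hs hmem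
      have := hs hmem.1
      rw [Set.indicator_of_mem (show s ∈ Set.Iio (1 : ℝ) from hmem.2)] at this
      simp only [Pi.zero_apply, ENNReal.ofReal_eq_zero] at this
      have h3 : 0 < s / m ^ 2 := div_pos hmem.1 (by positivity)
      linarith
    have h2 : (volume : Measure ℝ) (Set.Ioo 0 1) = 0 := by
      rw [ae_iff] at h1
      simpa only [not_not, Set.ofPred_mem_eq] using h1
    simp at h2
  have hctop : c ≠ ⊤ := by
    have : c ≤ ∫⁻ s in Set.Ioo (0 : ℝ) 1, ENNReal.ofReal (1 / m ^ 2) := by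
      simp only [c]
      rw [← lintegral_indicator measurableSet_Ioi, ← lintegral_indicator measurableSet_Ioo]
      refine lintegral_mono fun s => ?_
      by_cases h1 : s ∈ Set.Ioi (0 : ℝ)
      · by_cases h2 : s ∈ Set.Iio (1 : ℝ)
        · rw [Set.indicator_of_mem h1, Set.indicator_of_mem h2,
            Set.indicator_of_mem (show s ∈ Set.Ioo (0 : ℝ) 1 from ⟨h1, h2⟩)]
          exact ENNReal.ofReal_le_ofReal (by
            have : s < 1 := h2
            gcongr)
        · rw [Set.indicator_of_mem h1, Set.indicator_of_notMem h2]; simp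
      · rw [Set.indicator_of_notMem h1]; simp
    refine ne_top_of_le_ne_top ?_ this
    simp
  have h1 := hE _ (hf.comp hmeas)
  have h2 := hE _ hf
  have h3 : ∀ p, E (f ∘ colorentz h) p = E f (colorentz h p) := by
    intro p
    have hiff : (0 < minkSq (colorentz h p) ∧ 0 < (colorentz h p) 0) ↔ (0 < minkSq p ∧ 0 < p 0) := by
      refine ⟨fun hp => ?_, forward_cone h⟩
      have := forward_cone h⁻¹ hp
      rwa [← Module.End.mul_apply, ← map_mul, inv_mul_cancel, map_one, Module.End.one_apply] at this
    rw [minkSq_colorentz] at hiff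
    simp only [E, Set.indicator_apply, Set.mem_ofPred_eq, hiff, minkSq_colorentz, map_smul,
      Function.comp_apply]
  rw [lintegral_congr h3, (measurePreserving_volume_colorentz h).lintegral_comp (hEm f hf), h2] at h1
  exact ((ENNReal.mul_right_inj hc0 hctop).1 h1).symm

lemma measurePreserving_colorentz {m : ℝ} (hm : 0 < m) (h : SL2C) :
    MeasurePreserving (colorentz h) (shellMeasure m) (shellMeasure m) := by
  have hmeas : Measurable (colorentz h) := (measurePreserving_volume_colorentz h).measurable
  refine ⟨hmeas, Measure.ext_of_lintegral _ fun f hf => ?_⟩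
  rw [lintegral_map hf hmeas, lintegral_shellMeasure_colorentz hm h hf]

/-- The `L²` sections over `O_m = H / K` of the homogeneous bundle `H ×_K F_σ`, where
`F_σ = Sym^n ℂ²`, `σ = n / 2`, as functions `f : H → F_σ` with `f (h k) = k⁻¹ (f h)`. The norm of
such a function at `h` depends only on the point `h • (m e⁰)`, so that it may be computed at
`h = h_p`. -/
def inducedSections (m : ℝ) (n : ℕ) : Submodule ℂ (SL2C → SpinTensor n 0) where
  carrier := {f | (∀ h : SL2C, ∀ k ∈ littleGroup m, f (h * k) = spinRep n 0 k⁻¹ (f h)) ∧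
    MemLp (fun p => f (boost m p)) 2 (shellMeasure m)}
  add_mem' {f g} hf hg :=
    ⟨fun h k hk => by simp [hf.1 h k hk, hg.1 h k hk], hf.2.add hg.2⟩
  zero_mem' := ⟨fun h k hk => by simp, MemLp.zero⟩
  smul_mem' c f hf := ⟨fun h k hk => by simp [hf.1 h k hk], hf.2.const_smul c⟩

/-- The space `inducedSections m n` with its `L²` semi-inner product. -/
def InducedSection (m : ℝ) (n : ℕ) : Type := inducedSections m n

instance (m : ℝ) (n : ℕ) : AddCommGroup (InducedSection m n) :=
  inferInstanceAs (AddCommGroup (inducedSections m n))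

instance (m : ℝ) (n : ℕ) : Module ℂ (InducedSection m n) :=
  inferInstanceAs (Module ℂ (inducedSections m n))

/-- The trivialization of sections by `p ↦ h_p`. -/
def sectionToL2 (m : ℝ) (n : ℕ) :
    InducedSection m n →ₗ[ℂ] Lp (SpinTensor n 0) 2 (shellMeasure m) where
  toFun f := MemLp.toLp (fun p => f.1 (boost m p)) f.2.2
  map_add' _ _ := rfl
  map_smul' _ _ := rfl

instance (m : ℝ) (n : ℕ) : SeminormedAddCommGroup (InducedSection m n) :=
  SeminormedAddCommGroup.induced _ _ (sectionToL2 m n)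

instance (m : ℝ) (n : ℕ) : InnerProductSpace ℂ (InducedSection m n) :=
  InnerProductSpace.induced (sectionToL2 m n)

/-- The Hilbert space `H_(m,σ)`, `σ = n / 2`: `L²` sections modulo null sections. -/
abbrev ParticleSpace (m : ℝ) (n : ℕ) : Type := SeparationQuotient (InducedSection m n)

/-- The character `exp (i p(v))` of translations. -/
def translationPhase (v : Spacetime) (p : Momentum) : ℂ := Complex.exp (Complex.I * pairing p v)

/-- The action of `g = (v, h₀)` on sections: `(g • f) h = exp (i p(v)) • f (h₀⁻¹ h)` over
`p = h • (m e⁰)`. -/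
def sectionActFun (m : ℝ) {n : ℕ} (g : Poincare) (f : SL2C → SpinTensor n 0) :
    SL2C → SpinTensor n 0 :=
  fun h => translationPhase g.trans (colorentz h (restMomentum m)) • f (g.lin⁻¹ * h)

lemma norm_translationPhase (v : Spacetime) (p : Momentum) : ‖translationPhase v p‖ = 1 := by
  rw [translationPhase, mul_comm, Complex.norm_exp_ofReal_mul_I]

lemma measurable_boostInvMatrix (m : ℝ) (i j : Fin 2) :
    Measurable fun p => boostInvMatrix m p i j := by
  unfold boostInvMatrix
  simp only [herm_eq, Matrix.smul_apply, Matrix.add_apply]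
  fin_cases i <;> fin_cases j <;> simp <;> fun_prop

lemma continuous_tensorLin (a b : ℕ) :
    Continuous fun x : (Fin 2 → Fin 2 → ℂ) × SpinTensor a b =>
      tensorLin a b (Matrix.of x.1) x.2 := by
  refine Continuous.subtype_mk (PiLp.continuous_toLp 2 _ |>.comp (continuous_pi fun I => ?_)) _
  refine continuous_finsetSum _ fun J _ => ?_
  unfold tensorMatrix
  simp only [Matrix.of_apply]
  fun_prop

lemma sectionAct_boost {m : ℝ} (hm : 0 < m) {n : ℕ} (g : Poincare) (f : InducedSection m n)
    {p : Momentum} (hp : p ∈ massShell m) :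
    sectionActFun m g f.1 (boost m p) = translationPhase g.trans p •
      tensorLin n 0 (boostInvMatrix m p * (g.lin : Matrix (Fin 2) (Fin 2) ℂ) *
          (boostInvMatrix m (colorentz g.lin⁻¹ p)).adjugate)
        (f.1 (boost m (colorentz g.lin⁻¹ p))) ∧
    ‖sectionActFun m g f.1 (boost m p)‖ = ‖f.1 (boost m (colorentz g.lin⁻¹ p))‖ := by
  have hq := colorentz_mem_massShell hm g.lin⁻¹ hp
  have hk := wigner_mem_littleGroup hm g.lin⁻¹ hp
  set q := colorentz g.lin⁻¹ p
  set k := (boost m q)⁻¹ * g.lin⁻¹ * boost m p with hkdef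
  have h1 : g.lin⁻¹ * boost m p = boost m q * k := by rw [hkdef]; group
  have h2 : f.1 (g.lin⁻¹ * boost m p) = spinRep n 0 k⁻¹ (f.1 (boost m q)) := by
    rw [h1, f.2.1 _ k hk]
  have h3 : k⁻¹ = (boost m p)⁻¹ * g.lin * boost m q := by rw [hkdef]; group
  have h4 : ((boost m q : SL2C) : Matrix (Fin 2) (Fin 2) ℂ)
      = (boostInvMatrix m q).adjugate := by
    rw [← coe_boost_inv hm hq, ← Matrix.SpecialLinearGroup.coe_inv, inv_inv]
  constructor
  · rw [sectionActFun, h2, colorentz_boost hm hp, h3]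
    simp only [spinRep, MonoidHom.coe_mk, OneHom.coe_mk, Matrix.SpecialLinearGroup.coe_mul, h4]
    rw [coe_boost_inv hm hp]
  · rw [sectionActFun, h2, norm_smul, norm_translationPhase, one_mul]
    have hu := unitary_of_mem_littleGroup hm ((littleGroup m).inv_mem hk)
    have := inner_tensorLin hu (f.1 (boost m q)) (f.1 (boost m q))
    have h5 := congrArg Complex.re this
    exact (by
      rw [← pow_left_inj₀ (norm_nonneg _) (norm_nonneg _) two_ne_zero]
      exact ((InnerProductSpace.norm_sq_eq_re_inner (𝕜 := ℂ) _).trans h5).trans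
        (InnerProductSpace.norm_sq_eq_re_inner (𝕜 := ℂ) _).symm)

lemma memLp_sectionAct {m : ℝ} (hm : 0 < m) {n : ℕ} (g : Poincare) (f : InducedSection m n) :
    MemLp (fun p => sectionActFun m g f.1 (boost m p)) 2 (shellMeasure m) := by
  have hmp := measurePreserving_colorentz hm g.lin⁻¹
  have hf := f.2.2.comp_measurePreserving hmp
  refine hf.congr_norm ?_ ?_
  · have hM : Measurable fun p : Momentum => fun i j =>
        (boostInvMatrix m p * (g.lin : Matrix (Fin 2) (Fin 2) ℂ) *
          (boostInvMatrix m (colorentz g.lin⁻¹ p)).adjugate) i j := by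
      refine measurable_pi_iff.2 fun i => measurable_pi_iff.2 fun j => ?_
      have hb := fun i j => measurable_boostInvMatrix m i j
      have hb' := fun i j => (measurable_boostInvMatrix m i j).comp hmp.measurable
      simp only [Function.comp_def] at hb'
      simp only [Matrix.mul_apply, Fin.sum_univ_two, Matrix.adjugate_fin_two]
      fin_cases j <;> simp <;> fun_prop
    have hph : Measurable fun p : Momentum => translationPhase g.trans p := by
      unfold translationPhase pairing; fun_prop
    have h := hph.aestronglyMeasurable.smul
      ((continuous_tensorLin n 0).comp_aestronglyMeasurable
        (hM.aestronglyMeasurable.prodMk hf.1))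
    refine h.congr ?_
    filter_upwards [ae_mem_massShell hm] with p hp
    exact (sectionAct_boost hm g f hp).1.symm
  · filter_upwards [ae_mem_massShell hm] with p hp
    exact (sectionAct_boost hm g f hp).2.symm

/-- The isometric action of a Poincaré transformation on `L²` sections. -/
def sectionAct {m : ℝ} (hm : 0 < m) (n : ℕ) (g : Poincare) :
    InducedSection m n →ₗᵢ[ℂ] InducedSection m n where
  toFun f := ⟨sectionActFun m g f.1, fun h k hk => by
    have hk' : colorentz k (restMomentum m) = restMomentum m := hk
    simp only [sectionActFun]
    rw [← mul_assoc, f.2.1 _ k hk, map_mul, Module.End.mul_apply, hk', map_smul],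
    memLp_sectionAct hm g f⟩
  map_add' f f' := Subtype.ext (funext fun h => smul_add _ _ _)
  map_smul' c f := Subtype.ext (funext fun h =>
    smul_comm (translationPhase g.trans (colorentz h (restMomentum m))) c (f.1 (g.lin⁻¹ * h)))
  norm_map' f := by
    change ‖MemLp.toLp (fun p => sectionActFun m g f.1 (boost m p)) (memLp_sectionAct hm g f)‖
      = ‖MemLp.toLp (fun p => f.1 (boost m p)) f.2.2‖
    rw [Lp.norm_toLp, Lp.norm_toLp]
    congr 1
    rw [← eLpNorm_comp_measurePreserving f.2.2.1 (measurePreserving_colorentz hm g.lin⁻¹)]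
    refine eLpNorm_congr_norm_ae ?_
    filter_upwards [ae_mem_massShell hm] with p hp
    exact (sectionAct_boost hm g f hp).2

lemma sectionAct_one {m : ℝ} (hm : 0 < m) (n : ℕ) (f : InducedSection m n) :
    sectionAct hm n 1 f = f := by
  refine Subtype.ext (funext fun h => ?_)
  change sectionActFun m 1 f.1 h = f.1 h
  simp [sectionActFun, Poincare.one_trans, Poincare.one_lin, translationPhase, pairing]

lemma sectionAct_mul {m : ℝ} (hm : 0 < m) (n : ℕ) (g g' : Poincare) (f : InducedSection m n) :
    sectionAct hm n (g * g') f = sectionAct hm n g (sectionAct hm n g' f) := by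
  refine Subtype.ext (funext fun h => ?_)
  change sectionActFun m (g * g') f.1 h = sectionActFun m g (sectionActFun m g' f.1) h
  simp only [sectionActFun, Poincare.mul_trans, Poincare.mul_lin, mul_inv_rev, smul_smul,
    mul_assoc]
  congr 1
  rw [translationPhase, translationPhase, translationPhase, ← Complex.exp_add, ← mul_add]
  congr 2
  have h1 := pairing_colorentz g.lin (colorentz (g.lin⁻¹ * h) (restMomentum m)) g'.trans
  rw [← Module.End.mul_apply, ← map_mul, mul_inv_cancel_left] at h1
  rw [← h1, ← Complex.ofReal_add]
  congr 1
  simp [pairing, mul_add, Finset.sum_add_distrib]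

/-- The unitary representation `H_(m,σ)`, `σ = n / 2`, of the Poincaré group, induced from the spin
`σ` representation `F_σ` of the little group. -/
def particleRep {m : ℝ} (hm : 0 < m) (n : ℕ) :
    Poincare →* (ParticleSpace m n →ₗᵢ[ℂ] ParticleSpace m n) where
  toFun g :=
    { toLinearMap := (SeparationQuotient.liftCLM
        ((SeparationQuotient.mkCLM ℂ (InducedSection m n)).comp
          (sectionAct hm n g).toContinuousLinearMap)
        (fun x y h => SeparationQuotient.mk_eq_mk.2
          (h.map (sectionAct hm n g).continuous))).toLinearMap
      norm_map' := by
        rintro ⟨f⟩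
        exact (sectionAct hm n g).norm_map f }
  map_one' := by
    ext ⟨f⟩
    exact congrArg SeparationQuotient.mk (sectionAct_one hm n f)
  map_mul' g g' := by
    ext ⟨f⟩
    exact congrArg SeparationQuotient.mk (sectionAct_mul hm n g g' f)

lemma sectionToL2_surjective {m : ℝ} (hm : 0 < m) (n : ℕ) :
    Function.Surjective (sectionToL2 m n) := by
  intro ψ
  have hp : ∀ p ∈ massShell m, spinRep n 0 ((boost m p)⁻¹ *
      boost m (colorentz (boost m p) (restMomentum m)))
        (ψ (colorentz (boost m p) (restMomentum m))) = ψ p := by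
    intro p hp
    rw [colorentz_boost hm hp, inv_mul_cancel, map_one, Module.End.one_apply]
  have hae : (fun p => spinRep n 0 ((boost m p)⁻¹ *
      boost m (colorentz (boost m p) (restMomentum m)))
        (ψ (colorentz (boost m p) (restMomentum m)))) =ᵐ[shellMeasure m] ψ := by
    filter_upwards [ae_mem_massShell hm] with p h using hp p h
  refine ⟨⟨fun h => spinRep n 0 (h⁻¹ * boost m (colorentz h (restMomentum m)))
    (ψ (colorentz h (restMomentum m))), fun h k hk => ?_, (memLp_congr_ae hae).2 (Lp.memLp ψ)⟩, ?_⟩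
  · change spinRep n 0 ((h * k)⁻¹ * boost m (colorentz (h * k) (restMomentum m)))
        (ψ (colorentz (h * k) (restMomentum m))) = spinRep n 0 k⁻¹ (spinRep n 0
          (h⁻¹ * boost m (colorentz h (restMomentum m))) (ψ (colorentz h (restMomentum m))))
    have hk' : colorentz k (restMomentum m) = restMomentum m := hk
    rw [map_mul colorentz, Module.End.mul_apply, hk', mul_inv_rev, mul_assoc, map_mul,
      Module.End.mul_apply]
  · exact Lp.ext ((MemLp.coeFn_toLp ((memLp_congr_ae hae).2 (Lp.memLp ψ))).trans hae)

lemma completeSpace_particleSpace {m : ℝ} (hm : 0 < m) (n : ℕ) :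
    CompleteSpace (ParticleSpace m n) := by
  have h : IsUniformInducing (sectionToL2 m n) := ⟨rfl⟩
  have : CompleteSpace (InducedSection m n) :=
    (h.completeSpace_congr (sectionToL2_surjective hm n)).2 inferInstance
  infer_instance

/-- The equivariant map `Γ_ℂ : S_+^* ⊗ S_-^* → V_ℂ`, `s ⊗ t ↦ v` where `∑ μ, v μ • σ_μ = s tᵀ`. -/
def gammaC (s t : Fin 2 → ℂ) : Fin 4 → ℂ :=
  fun μ => 1 / 2 * (pauli μ * Matrix.vecMulVec s t).trace

lemma gammaC_spec (s t : Fin 2 → ℂ) : ∑ μ, gammaC s t μ • pauli μ = Matrix.vecMulVec s t := by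
  ext i j
  fin_cases i <;> fin_cases j <;>
    simp [gammaC, pauli, Fin.sum_univ_four, Matrix.trace_fin_two, Matrix.mul_apply,
      Fin.sum_univ_two, Matrix.vecMulVec_apply] <;>
    first
    | ring1
    | linear_combination (1 / 2 * (s 1 * t 0 - s 0 * t 1)) * Complex.I_sq
    | linear_combination (-1 / 2 * (s 1 * t 0 - s 0 * t 1)) * Complex.I_sq

/-- The bilinear form `p ∘ Γ_ℂ` on `S_+^* × S_-^*`, for a covector `p`, as a matrix. -/
def covectorGamma (p : Momentum) : Matrix (Fin 2) (Fin 2) ℂ :=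
  fun i j => ∑ μ, (p μ : ℂ) * gammaC (Pi.single i 1) (Pi.single j 1) μ

/-- `(M ⊗ Id) ∘ ι`: the first `S_+^*` slot and the first `S_-^*` slot are contracted with the
bilinear form `M`. -/
def contract {a b : ℕ} (M : Matrix (Fin 2) (Fin 2) ℂ) :
    SpinTensor (a + 1) (b + 1) →ₗ[ℂ] SpinTensor a b where
  toFun w := ⟨WithLp.toLp 2 fun I => ∑ i, ∑ j, M i j *
      w.1 ((Fin.cons i I.1 : Fin (a + 1) → Fin 2), (Fin.cons j I.2 : Fin (b + 1) → Fin 2)),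
    fun π τ I => by
      rw [PiLp.toLp_apply, PiLp.toLp_apply]
      refine Finset.sum_congr rfl fun i _ => Finset.sum_congr rfl fun j _ => ?_
      congr 1
      have key : ∀ {c : ℕ} (π : Equiv.Perm (Fin c)) (i : Fin 2) (K : Fin c → Fin 2),
          (Fin.cons i (K ∘ π) : Fin (c + 1) → Fin 2)
            = (Fin.cons i K : Fin (c + 1) → Fin 2) ∘ Equiv.Perm.decomposeFin.symm (0, π) := by
        intro c π i K
        funext k
        refine Fin.cases ?_ (fun k => ?_) k <;> simp
      rw [key, key]
      exact w.2 (Equiv.Perm.decomposeFin.symm (0, π)) (Equiv.Perm.decomposeFin.symm (0, τ))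
        ((Fin.cons i I.1 : Fin (a + 1) → Fin 2), (Fin.cons j I.2 : Fin (b + 1) → Fin 2))⟩
  map_add' v w := by ext I; simp [mul_add, Finset.sum_add_distrib]
  map_smul' c w := by
    ext I
    simp only [SetLike.val_smul, PiLp.smul_apply, smul_eq_mul, RingHom.id_apply, Finset.mul_sum]
    exact Finset.sum_congr rfl fun i _ => Finset.sum_congr rfl fun j _ => by ring

/-- `u = ((e⁰ ∘ Γ_ℂ) ⊗ Id) ∘ ι`, where `e⁰` is the unit time covector. -/
def restContraction (a b : ℕ) : SpinTensor (a + 1) (b + 1) →ₗ[ℂ] SpinTensor a b :=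
  contract (covectorGamma (EuclideanSpace.single 0 1))

/-- `F_σ`, `σ = n / 2`, occurs in the restriction of `SpinTensor a b` to the little group. -/
def OccursIn (m : ℝ) (n a b : ℕ) : Prop :=
  ∃ J : SpinTensor n 0 →ₗ[ℂ] SpinTensor a b, Function.Injective J ∧
    ∀ k ∈ littleGroup m, J ∘ₗ spinRep n 0 k = spinRep a b k ∘ₗ J

/-- `u : W → E` is equivariant under the little group. -/
def IsLittleGroupEquivariant (m : ℝ) {a b : ℕ} {E : Type*} [AddCommGroup E] [Module ℂ E]
    (ρE : Representation ℂ SL2C E) (u : SpinTensor a b →ₗ[ℂ] E) : Prop :=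
  ∀ k ∈ littleGroup m, u ∘ₗ spinRep a b k = ρE k ∘ₗ u

/-- As a representation of the little group, `ker u` is isomorphic to `F_σ`, `σ = n / 2`. -/
def KernelIsSpin (m : ℝ) (n : ℕ) {a b : ℕ} {E : Type*} [AddCommGroup E] [Module ℂ E]
    (u : SpinTensor a b →ₗ[ℂ] E) : Prop :=
  ∃ J : SpinTensor n 0 →ₗ[ℂ] SpinTensor a b, Function.Injective J ∧
    (∀ k ∈ littleGroup m, J ∘ₗ spinRep n 0 k = spinRep a b k ∘ₗ J) ∧
    LinearMap.range J = LinearMap.ker u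

/-- The symbol `ζ_u(p) = ρ_E(h_p) ∘ u ∘ ρ_W(h_p)⁻¹`, where `h_p` takes the rest momentum
to `p`. -/
def symbol (m : ℝ) {a b : ℕ} {E : Type*} [AddCommGroup E] [Module ℂ E]
    (ρE : Representation ℂ SL2C E) (u : SpinTensor a b →ₗ[ℂ] E) (p : Momentum) :
    SpinTensor a b →ₗ[ℂ] E :=
  ρE (boost m p) ∘ₗ u ∘ₗ spinRep a b (boost m p)⁻¹

/-- `T` identifies the unitary Poincaré representation `H_(m,σ)`, `σ = n / 2`, with the space of
all square integrable `Ψ` on the mass shell with values in `SpinTensor a b` such that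
`Z p (Ψ p) = 0` for almost every `p`. The fibre over `p` carries the Hermitian product
`⟨w, w'⟩_p = ⟨h_p⁻¹ w, h_p⁻¹ w'⟩`, and `(v, h)` acts by
`Ψ ↦ (p ↦ exp (i p(v)) • h (Ψ (h⁻¹ p)))`. -/
structure IsMomentumRealization {m : ℝ} (hm : 0 < m) (n : ℕ) {a b : ℕ} {E : Type*}
    [AddCommGroup E] [Module ℂ E] (Z : Momentum → SpinTensor a b →ₗ[ℂ] E)
    (T : ParticleSpace m n →ₗ[ℂ] (Momentum →ₘ[shellMeasure m] SpinTensor a b)) : Prop where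
  inner_eq : ∀ ξ η : ParticleSpace m n, inner ℂ ξ η =
    ∫ p, (inner ℂ (spinRep a b (boost m p)⁻¹ (T ξ p)) (spinRep a b (boost m p)⁻¹ (T η p)) : ℂ)
      ∂shellMeasure m
  mem_range_iff : ∀ Ψ : Momentum →ₘ[shellMeasure m] SpinTensor a b,
    (∃ ξ, T ξ = Ψ) ↔
      ∫⁻ p, ‖spinRep a b (boost m p)⁻¹ (Ψ p)‖ₑ ^ 2 ∂shellMeasure m < ⊤ ∧
      ∀ᵐ p ∂shellMeasure m, Z p (Ψ p) = 0
  equivariant : ∀ (g : Poincare) (ξ : ParticleSpace m n), ∀ᵐ p ∂shellMeasure m,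
    T (particleRep hm n g ξ) p =
      translationPhase g.trans p • spinRep a b g.lin (T ξ (colorentz g.lin⁻¹ p))

/-- `f ↦ ∫ x, exp (-i p(x)) f x`. -/
def fieldFourier (f : 𝓢(Spacetime, ℂ)) (p : Momentum) : ℂ :=
  ∫ x, Complex.exp (-(Complex.I * pairing p x)) * f x

/-- Spacetime fields with values in `SpinTensor a b`, as tempered distributions. -/
abbrev TensorField (a b : ℕ) := 𝓢'(Spacetime, SpinTensor a b)

/-- `φ x = ∫ exp (-i p(x)) ψ p ν(dp)`, in the sense of distributions. -/
def IsPlaneWaveIntegral {a b : ℕ} (ν : Measure Momentum) (ψ : Momentum → SpinTensor a b)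
    (φ : TensorField a b) : Prop :=
  ∀ f : 𝓢(Spacetime, ℂ), Integrable (fun p => fieldFourier f p • ψ p) ν ∧
    φ f = ∫ p, fieldFourier f p • ψ p ∂ν

/-- The measure `∫ ρ(dμ) β_μ` on momentum space, a superposition over positive masses `μ` of the
invariant measures `β_μ = shellMeasure μ` on the mass shells. -/
def spectralMeasure (ρ : Measure ℝ) : Measure Momentum :=
  (((ρ.restrict (Set.Ioi 0)).prod (volume : Measure (EuclideanSpace ℝ (Fin 3)))).withDensity
    fun x => ENNReal.ofReal (1 / (2 * √(x.1 ^ 2 + ‖x.2‖ ^ 2)))).map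
      fun x => shellPoint x.1 x.2

/-- The fields `φ x = ∫ ψ p exp (-i p(x)) ν(dp)` composed of positive energy plane waves of
arbitrary masses, with `ν = ∫ ρ(dμ) β_μ` and amplitude `ψ` square integrable with respect to `ν`
and the Hermitian products `⟨w, w'⟩_p = ⟨h_p⁻¹ w, h_p⁻¹ w'⟩`. -/
def IsPositiveEnergyField {a b : ℕ} (φ : TensorField a b) : Prop :=
  ∃ ρ : Measure ℝ, SigmaFinite ρ ∧ ∃ ψ : Momentum → SpinTensor a b,
    AEStronglyMeasurable ψ (spectralMeasure ρ) ∧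
    ∫⁻ p, ‖spinRep a b (boost √(minkSq p) p)⁻¹ (ψ p)‖ₑ ^ 2 ∂spectralMeasure ρ < ⊤ ∧
    IsPlaneWaveIntegral (spectralMeasure ρ) ψ φ

/-- `lorentz h` as a continuous linear equivalence. -/
def lorentzEquiv (h : SL2C) : Spacetime ≃L[ℝ] Spacetime :=
  (LinearEquiv.ofLinearMap (lorentz h) (lorentz h⁻¹)
    (by rw [← Module.End.mul_eq_comp, ← map_mul, mul_inv_cancel, map_one]; rfl)
    (by rw [← Module.End.mul_eq_comp, ← map_mul, inv_mul_cancel, map_one]; rfl)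
    ).toContinuousLinearEquiv

/-- `f ↦ f ∘ g`, where `g` acts on spacetime by `x ↦ h x + v`. -/
def pullback (g : Poincare) : 𝓢(Spacetime, ℂ) →L[ℂ] 𝓢(Spacetime, ℂ) :=
  (SchwartzMap.compCLMOfContinuousLinearEquiv ℂ (lorentzEquiv g.lin)).comp
    (SchwartzMap.compSubConstCLM ℂ (-g.trans))

lemma pullback_apply (g : Poincare) (f : 𝓢(Spacetime, ℂ)) (x : Spacetime) :
    pullback g f x = f (lorentz g.lin x + g.trans) := by
  simp [pullback, lorentzEquiv]

/-- Apply a linear map to the values of a distribution. -/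
def mapValues {V W : Type*} [NormedAddCommGroup V] [NormedSpace ℂ V] [FiniteDimensional ℂ V]
    [NormedAddCommGroup W] [NormedSpace ℂ W] (L : V →ₗ[ℂ] W) :
    𝓢'(Spacetime, V) →L[ℂ] 𝓢'(Spacetime, W) :=
  PointwiseConvergenceCLM.postcomp _ L.toContinuousLinearMap

lemma mapValues_apply {V W : Type*} [NormedAddCommGroup V] [NormedSpace ℂ V]
    [FiniteDimensional ℂ V] [NormedAddCommGroup W] [NormedSpace ℂ W] (L : V →ₗ[ℂ] W)
    (φ : 𝓢'(Spacetime, V)) (f : 𝓢(Spacetime, ℂ)) : mapValues L φ f = L (φ f) := rfl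

/-- The action `(g • φ) x = h (φ (g⁻¹ x))` of `g = (v, h)` on fields. -/
def fieldAct {a b : ℕ} (g : Poincare) (φ : TensorField a b) : TensorField a b :=
  mapValues (spinRep a b g.lin) (PointwiseConvergenceCLM.precomp _ (pullback g) φ)

lemma fieldAct_apply {a b : ℕ} (g : Poincare) (φ : TensorField a b) (f : 𝓢(Spacetime, ℂ)) :
    fieldAct g φ f = spinRep a b g.lin (φ (pullback g f)) := rfl

/-- The coordinate vector `e_μ` of spacetime (as a vector) or `e^μ` (as a covector). -/
def unitVec (μ : Fin 4) : EuclideanSpace ℝ (Fin 4) := EuclideanSpace.single μ 1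

/-- The wave operator `□ = ∂₀² - ∂₁² - ∂₂² - ∂₃²` on fields. -/
def box {a b : ℕ} (φ : TensorField a b) : TensorField a b :=
  ∂_{unitVec 0} (∂_{unitVec 0} φ) - ∂_{unitVec 1} (∂_{unitVec 1} φ)
    - ∂_{unitVec 2} (∂_{unitVec 2} φ) - ∂_{unitVec 3} (∂_{unitVec 3} φ)

/-- The Klein–Gordon operator `□ + m²` on fields. -/
def kleinGordon (m : ℝ) {a b : ℕ} (φ : TensorField a b) : TensorField a b := box φ + ((m : ℂ) ^ 2) • φ

/-- The divergence-type operator `δ φ = Ξ (-i dφ)`, where `dφ = ∑ μ, e^μ ⊗ ∂_μ φ` and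
`Ξ (p ⊗ w) = ((p ∘ Γ_ℂ) ⊗ Id) (ι w)`. -/
def divergence {a b : ℕ} (φ : TensorField (a + 1) (b + 1)) : TensorField a b :=
  ∑ μ, mapValues (contract (covectorGamma (unitVec μ))) ((-Complex.I) • ∂_{unitVec μ} φ)

/-- The partial derivative `∂_μ Φ` of a smooth field. -/
def partialDeriv {a b : ℕ} (μ : Fin 4) (Φ : Spacetime → SpinTensor a b) :
    Spacetime → SpinTensor a b :=
  fun x => fderiv ℝ Φ x (unitVec μ)

/-- The wave operator on smooth fields. -/
def smoothBox {a b : ℕ} (Φ : Spacetime → SpinTensor a b) : Spacetime → SpinTensor a b :=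
  fun x => partialDeriv 0 (partialDeriv 0 Φ) x - partialDeriv 1 (partialDeriv 1 Φ) x
    - partialDeriv 2 (partialDeriv 2 Φ) x - partialDeriv 3 (partialDeriv 3 Φ) x

/-- The Klein–Gordon operator on smooth fields. -/
def smoothKleinGordon (m : ℝ) {a b : ℕ} (Φ : Spacetime → SpinTensor a b) :
    Spacetime → SpinTensor a b :=
  fun x => smoothBox Φ x + ((m : ℂ) ^ 2) • Φ x

/-- The divergence-type operator on smooth fields. -/
def smoothDivergence {a b : ℕ} (Φ : Spacetime → SpinTensor (a + 1) (b + 1)) :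
    Spacetime → SpinTensor a b :=
  fun x => ∑ μ, contract (covectorGamma (unitVec μ)) ((-Complex.I) • partialDeriv μ Φ x)

/-- The distribution `φ` is given by the function `Φ`. -/
def Represents {a b : ℕ} (Φ : Spacetime → SpinTensor a b) (φ : TensorField a b) : Prop :=
  ∀ f : 𝓢(Spacetime, ℂ), Integrable (fun x => f x • Φ x) ∧ φ f = ∫ x, f x • Φ x

end

end SpinField

open SpinField

/-! Everything reduces to the little group `K`, which is `SU(2)`. Since `ζ_u(p)` is `u` transported
by `h_p`, its kernel is `h_p (ker u)`. If `J : F_σ → W` is a `K`-equivariant isometry onto `ker u`,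
then `f ↦ (p ↦ h_p (J (f p)))`, applied to sections trivialized by `p ↦ h_p`, is a unitary map onto
`L²(ζ_u)`: the product `⟨·,·⟩_p` is itself transported by `h_p`, and equivariance holds because the
Wigner element `h_{hp}⁻¹ h h_p` lies in `K`, where `J` intertwines
(`isMomentumRealization_momentumMap`). Such an isometry exists because `F_σ` is irreducible
(`eq_top_of_invariant`), so that by Schur's lemma every equivariant embedding is isometric up to a
constant (`exists_isometric_equivariant`).

For the list of spins, the tensor `ε` identifies `S_-^*` with `S_+^*` over `K`. The contraction
`restContraction` of one slot of each kind is equivariant and surjective, and its kernel consists of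
the tensors that become totally symmetric under this identification, a copy of the top spin
(`range_crossing`). Peeling off one such kernel at a time gives the Clebsch–Gordan rule
(`OccursIn.bounds`, `occursIn_of_bounds`). At a boosted momentum the same contraction becomes `(p ∘
Γ) ⊗ Id`, up to the factor `m`.

In spacetime, the Fourier transform is onto Schwartz space, so a plane wave integral determines its
amplitude almost everywhere (`IsPlaneWaveIntegral.eq_zero_iff`). The Klein–Gordon operator
multiplies the amplitude by `m² - ⟨p,p⟩`, and `δ` applies `-((p ∘ Γ) ⊗ Id) ι`, which is `-m ζ_u(p)`
on `O_m`. For a positive energy field the first equation concentrates the amplitude on `O_m`, where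
the measure is `ρ({m}) β_m`, and the second is the kernel condition
(`mem_range_iff_of_isMomentumRealization`). Boosts grow only polynomially, so all amplitudes define
tempered distributions; those of bounded support are dense and give smooth fields. For smooth
fields, integration by parts against compactly supported test functions identifies the
distributional with the pointwise equations. -/

namespace SpinField

/-! ### Symmetric tensors as functions of the numbers of ones. -/

/-- The number of entries `1` of a word in `{0, 1}`. -/
def ones {a : ℕ} (I : Fin a → Fin 2) : ℕ := ∑ k, (I k : ℕ)

lemma ones_cons {a : ℕ} (i : Fin 2) (I : Fin a → Fin 2) :
    ones (Fin.cons i I : Fin (a + 1) → Fin 2) = i + ones I := by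
  simp [ones, Fin.sum_univ_succ]

lemma ones_le {a : ℕ} (I : Fin a → Fin 2) : ones I ≤ a := by
  calc ones I ≤ ∑ _k : Fin a, 1 := Finset.sum_le_sum fun k _ => by omega
    _ = a := by simp

lemma ones_comp_perm {a : ℕ} (I : Fin a → Fin 2) (π : Equiv.Perm (Fin a)) :
    ones (I ∘ π) = ones I :=
  Equiv.sum_comp π fun k => (I k : ℕ)

lemma ones_rev_add {a : ℕ} (I : Fin a → Fin 2) : ones (fun k => (I k).rev) + ones I = a := by
  rw [ones, ones, ← Finset.sum_add_distrib]
  calc ∑ k, (((I k).rev : ℕ) + (I k : ℕ)) = ∑ _k : Fin a, 1 :=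
        Finset.sum_congr rfl fun k _ => by rw [Fin.val_rev]; omega
    _ = a := by simp

lemma ones_append {a b : ℕ} (I : Fin a → Fin 2) (J : Fin b → Fin 2) :
    ones (Fin.append I J) = ones I + ones J := by
  simp [ones, Fin.sum_univ_add]

lemma ones_eq_card {a : ℕ} (I : Fin a → Fin 2) :
    ones I = (Finset.univ.filter fun k => I k = 1).card := by
  rw [ones, Finset.card_filter]
  refine Finset.sum_congr rfl fun k _ => ?_
  generalize I k = i
  fin_cases i <;> simp

/-- The two words have fibres of equal size over each letter, and bijections between the fibres glue
to a permutation. -/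
lemma exists_perm_of_ones_eq {a : ℕ} {I I' : Fin a → Fin 2} (h : ones I = ones I') :
    ∃ π : Equiv.Perm (Fin a), I ∘ π = I' := by
  rw [ones_eq_card, ones_eq_card] at h
  have hc : ∀ i, Fintype.card {k // I k = i} = Fintype.card {k // I' k = i} := by
    have h1 : Fintype.card {k // I k = 1} = Fintype.card {k // I' k = 1} := by
      rw [Fintype.card_subtype, Fintype.card_subtype, h]
    have h0 : ∀ K : Fin a → Fin 2, Fintype.card {k // K k = 0} + Fintype.card {k // K k = 1} = a := by
      intro K
      rw [Fintype.card_subtype, Fintype.card_subtype]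
      have := Finset.card_filter_add_card_filter_not (s := Finset.univ) (fun k => K k = 0)
      have e : (Finset.univ.filter fun k => ¬ K k = 0) = Finset.univ.filter fun k => K k = 1 := by
        ext k; simp; omega
      rw [e] at this
      simpa using this
    intro i
    fin_cases i
    · have := h0 I; have := h0 I'; simp only [Fin.zero_eta]; omega
    · exact h1
  refine ⟨Equiv.ofFiberEquiv (f := I') (g := I) fun i => Fintype.equivOfCardEq (hc i).symm, ?_⟩
  funext k
  exact Equiv.ofFiberEquiv_map _ k

/-- Slot permutations act transitively on words with a given number of ones. A symmetric tensor is
thus a function of two counts, and the equations below become recursions in these counts. -/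
lemma apply_eq_of_ones_eq {a b : ℕ} (w : SpinTensor a b) {I I' : TensorIndex a b}
    (h1 : ones I.1 = ones I'.1) (h2 : ones I.2 = ones I'.2) : w.1 I = w.1 I' := by
  obtain ⟨π, hπ⟩ := exists_perm_of_ones_eq h1
  obtain ⟨τ, hτ⟩ := exists_perm_of_ones_eq h2
  rw [← w.2 π τ I, hπ, hτ]

/-- The symmetric tensor with prescribed values in terms of the numbers of ones. -/
def ofCounts {a b : ℕ} (c : ℕ → ℕ → ℂ) : SpinTensor a b :=
  ⟨WithLp.toLp 2 fun I => c (ones I.1) (ones I.2), fun π τ I => by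
    simp only [ones_comp_perm]⟩

lemma ofCounts_apply {a b : ℕ} (c : ℕ → ℕ → ℂ) (I : TensorIndex a b) :
    (ofCounts c : SpinTensor a b).1 I = c (ones I.1) (ones I.2) := rfl

/-- A word of length `a` with `i` ones (if `i ≤ a`). -/
def onesWord (a i : ℕ) : Fin a → Fin 2 := fun k => if (k : ℕ) < i then 1 else 0

lemma ones_onesWord {a i : ℕ} (h : i ≤ a) : ones (onesWord a i) = i := by
  rw [ones_eq_card]
  have : (Finset.univ.filter fun k : Fin a => onesWord a i k = 1)
      = Finset.univ.filter fun k : Fin a => (k : ℕ) < i := by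
    ext k; simp [onesWord]
  rw [this, Fin.card_filter_val_lt, min_eq_right h]

lemma spinTensor_ext {a b : ℕ} {v w : SpinTensor a b} (h : ∀ I, v.1 I = w.1 I) : v = w :=
  Subtype.ext (PiLp.ext h)

lemma tensorLin_apply {a b : ℕ} (A : Matrix (Fin 2) (Fin 2) ℂ) (w : SpinTensor a b)
    (I : TensorIndex a b) : (tensorLin a b A w).1 I = ∑ J, tensorMatrix a b A I J * w.1 J := rfl

lemma spinRep_apply {a b : ℕ} (h : SL2C) (w : SpinTensor a b) :
    spinRep a b h w = tensorLin a b h w := rfl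

/-! ### The contraction, its covariance and its symbol. -/

lemma contract_apply {a b : ℕ} (M : Matrix (Fin 2) (Fin 2) ℂ) (w : SpinTensor (a + 1) (b + 1))
    (I : TensorIndex a b) : (contract M w).1 I = ∑ i, ∑ j, M i j *
      w.1 ((Fin.cons i I.1 : Fin (a + 1) → Fin 2), (Fin.cons j I.2 : Fin (b + 1) → Fin 2)) := rfl

lemma sum_fin_cons {a : ℕ} {M : Type*} [AddCommMonoid M] (F : (Fin (a + 1) → Fin 2) → M) :
    ∑ K, F K = ∑ i, ∑ K : Fin a → Fin 2, F (Fin.cons i K) := by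
  rw [← (Fin.consEquiv fun _ : Fin (a + 1) => Fin 2).sum_comp, Fintype.sum_prod_type]
  rfl

/-- The factor `1/2` is the one in `gammaC`, and the transpose comes from `tr (X E_ij) = X j i` for
matrix units `E_ij`. -/
lemma covectorGamma_eq (p : Momentum) :
    covectorGamma p = (1 / 2 : ℂ) • (herm p).transpose := by
  ext i j
  fin_cases i <;> fin_cases j <;>
    simp [covectorGamma, gammaC, herm_eq, Fin.sum_univ_four, pauli, Matrix.trace_fin_two,
      Matrix.mul_apply, Matrix.vecMulVec_apply] <;> ring

/-- The action of `A` on the two contracted slots is absorbed into the bilinear form, as `Aᵀ M Ā`;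
the other slots keep their action. This one formula yields both the invariance under `K` and the
value of the symbol at `p`. -/
lemma contract_tensorLin {a b : ℕ} (A M : Matrix (Fin 2) (Fin 2) ℂ)
    (w : SpinTensor (a + 1) (b + 1)) :
    contract M (tensorLin (a + 1) (b + 1) A w)
      = tensorLin a b A (contract (A.transpose * M * A.map conj) w) := by
  refine spinTensor_ext fun I => ?_
  have hL : (contract M (tensorLin (a + 1) (b + 1) A w)).1 I = ∑ J : TensorIndex a b,
      ∑ i, ∑ j, ∑ i', ∑ j', tensorMatrix a b A I J * (M i j * (A i i' * conj (A j j')) *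
        w.1 ((Fin.cons i' J.1 : Fin (a + 1) → Fin 2), (Fin.cons j' J.2 : Fin (b + 1) → Fin 2))) := by
    simp only [contract_apply, tensorLin_apply, Fintype.sum_prod_type, sum_fin_cons,
      tensorMatrix, Fin.prod_univ_succ, Fin.cons_zero, Fin.cons_succ, Fin.sum_univ_two,
      Finset.mul_sum, ← Finset.sum_add_distrib]
    refine Finset.sum_congr rfl fun x _ => Finset.sum_congr rfl fun y _ => by ring
  rw [hL, tensorLin_apply]
  refine Finset.sum_congr rfl fun J _ => ?_
  rw [contract_apply]
  simp only [Matrix.mul_apply, Matrix.transpose_apply, Matrix.map_apply, Fin.sum_univ_two]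
  ring


lemma covectorGamma_unitVec_zero : covectorGamma (EuclideanSpace.single 0 1) = (1 / 2 : ℂ) • 1 := by
  rw [covectorGamma_eq]
  congr 1
  have := herm_restMomentum 1
  rw [restMomentum] at this
  rw [this]
  simp

lemma restContraction_apply {a b : ℕ} (w : SpinTensor (a + 1) (b + 1)) (I : TensorIndex a b) :
    (restContraction a b w).1 I = 1 / 2 * (w.1 (Fin.cons 0 I.1, Fin.cons 0 I.2)
      + w.1 (Fin.cons 1 I.1, Fin.cons 1 I.2)) := by
  rw [restContraction, contract_apply, covectorGamma_unitVec_zero]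
  simp [Fin.sum_univ_two]
  ring

lemma mem_littleGroup_of_unitary (m : ℝ) {k : SL2C}
    (hk : (k : Matrix (Fin 2) (Fin 2) ℂ).conjTranspose * (k : Matrix (Fin 2) (Fin 2) ℂ) = 1) :
    k ∈ littleGroup m := by
  rw [← inv_mem_iff]
  change colorentz k⁻¹ (restMomentum m) = restMomentum m
  rw [← coords_herm (colorentz _ _), herm_colorentz, inv_inv, herm_restMomentum, Matrix.mul_smul,
    Matrix.smul_mul, mul_one, hk, ← herm_restMomentum, coords_herm]

/-- The form `e⁰ ∘ Γ` is half the identity matrix, and `kᵀ k̄ = 1` is the transpose of the unitarity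
of `k`. -/
lemma restContraction_equivariant {m : ℝ} (hm : 0 < m) (a b : ℕ) :
    IsLittleGroupEquivariant m (spinRep a b) (restContraction a b) := by
  intro k hk
  ext1 w
  simp only [LinearMap.comp_apply, spinRep_apply, restContraction]
  rw [contract_tensorLin, covectorGamma_unitVec_zero]
  congr 2
  have h := congrArg Matrix.transpose (unitary_of_mem_littleGroup hm hk)
  rw [Matrix.transpose_mul, Matrix.transpose_one] at h
  have e : (k : Matrix (Fin 2) (Fin 2) ℂ).conjTranspose.transpose
      = (k : Matrix (Fin 2) (Fin 2) ℂ).map conj := by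
    ext i j; simp [Matrix.conjTranspose_apply]
  rw [e] at h
  rw [Matrix.mul_smul, Matrix.smul_mul, mul_one, h]

/-- The inverse boost `B` is Hermitian, so `Bᵀ B̄ = (B²)ᵀ`, and `m B²` is the Hermitian matrix of
`p`. -/
lemma smul_symbol_restContraction {m : ℝ} (hm : 0 < m) (a b : ℕ) {p : Momentum}
    (hp : p ∈ massShell m) :
    (m : ℂ) • symbol m (spinRep a b) (restContraction a b) p = contract (covectorGamma p) := by
  ext1 w
  simp only [symbol, LinearMap.smul_apply, LinearMap.comp_apply, restContraction]
  rw [spinRep_apply (boost m p)⁻¹, contract_tensorLin, ← spinRep_apply (boost m p)⁻¹, ← Module.End.mul_apply,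
    ← map_mul, mul_inv_cancel, map_one, Module.End.one_apply, coe_boost_inv hm hp,
    covectorGamma_unitVec_zero, covectorGamma_eq, ← boostInvMatrix_mul_self hm hp]
  have e : (boostInvMatrix m p).map conj = (boostInvMatrix m p).transpose := by
    rw [← congrArg Matrix.transpose (isHermitian_boostInvMatrix m p)]
    ext i j; simp [Matrix.conjTranspose_apply]
  rw [e, Matrix.mul_smul, Matrix.smul_mul, mul_one, ← Matrix.transpose_mul]
  refine spinTensor_ext fun I => ?_
  simp only [contract_apply, SetLike.val_smul, PiLp.smul_apply, smul_eq_mul, Finset.mul_sum,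
    Matrix.smul_apply, Matrix.transpose_apply]
  refine Finset.sum_congr rfl fun i _ => Finset.sum_congr rfl fun j _ => by ring

lemma restContraction_surjective (a b : ℕ) : Function.Surjective (restContraction a b) := by
  intro v
  -- In terms of counts the equation reads `c i j + c (i+1) (j+1) = 2 v i j`. This is a recursion
  -- along diagonals, started with the value zero on the edges `i = 0` and `j = 0`.
  let c : ℕ → ℕ → ℂ := fun i => Nat.rec (fun _ => 0) (fun i ci j => Nat.rec 0
    (fun j _ => 2 * v.1 (onesWord a i, onesWord b j) - ci j) j) i
  have hc : ∀ i j, c (i + 1) (j + 1) = 2 * v.1 (onesWord a i, onesWord b j) - c i j :=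
    fun i j => rfl
  refine ⟨ofCounts c, spinTensor_ext fun I => ?_⟩
  rw [restContraction_apply, ofCounts_apply, ofCounts_apply]
  simp only [ones_cons]
  have e : v.1 (onesWord a (ones I.1), onesWord b (ones I.2)) = v.1 I :=
    apply_eq_of_ones_eq v (ones_onesWord (ones_le _)) (ones_onesWord (ones_le _))
  have h := hc (ones I.1) (ones I.2)
  simp only [Fin.val_zero, Fin.val_one, zero_add, add_comm 1]
  rw [h, e]
  ring

/-! ### Crossing: the kernel of the contraction is the top spin. -/

/-- The identification of slots in `S_-^*` with slots in `S_+^*` under the little group. -/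
def crossing (a b : ℕ) : SpinTensor (a + b) 0 →ₗ[ℂ] SpinTensor a b where
  toFun f := ⟨WithLp.toLp 2 fun I => (-1) ^ ones I.2 *
      f.1 (Fin.append I.1 fun l => (I.2 l).rev, Fin.elim0), fun π τ I => by
    simp only [ones_comp_perm]
    congr 1
    refine apply_eq_of_ones_eq f ?_ rfl
    simp only [ones_append, ones_comp_perm]
    congr 1
    exact ones_comp_perm (fun l => (I.2 l).rev) τ⟩
  map_add' f g := by ext I; simp [mul_add]
  map_smul' c f := by ext I; simp; ring

lemma crossing_apply {a b : ℕ} (f : SpinTensor (a + b) 0) (I : TensorIndex a b) :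
    (crossing a b f).1 I = (-1) ^ ones I.2 *
      f.1 (Fin.append I.1 fun l => (I.2 l).rev, Fin.elim0) := rfl

lemma crossing_injective (a b : ℕ) : Function.Injective (crossing a b) := by
  rw [injective_iff_map_eq_zero]
  intro f hf
  refine spinTensor_ext fun K => ?_
  have h : (crossing a b f).1 (fun i => K.1 (Fin.castAdd b i),
    fun j => (K.1 (Fin.natAdd a j)).rev) = 0 := by rw [hf]; rfl
  rw [crossing_apply] at h
  simp only [Fin.rev_rev, Fin.append_castAdd_natAdd, mul_eq_zero, pow_eq_zero_iff', neg_eq_zero,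
    one_ne_zero, false_and, false_or] at h
  rw [← Subsingleton.elim K.2 Fin.elim0] at h
  exact h

/-- For `A` in `SU(2)` the adjoint is the adjugate. This is the equivalence, through `ε`, of the
conjugate representation with the defining one: letters are reversed and a sign appears. -/
lemma conj_mul_neg_one_pow {A : Matrix (Fin 2) (Fin 2) ℂ} (hA : A.conjTranspose * A = 1)
    (hdet : A.det = 1) (i j : Fin 2) :
    conj (A i j) * (-1) ^ (j : ℕ) = (-1) ^ (i : ℕ) * A i.rev j.rev := by
  have h : A.conjTranspose = A.adjugate := by
    calc A.conjTranspose = A.conjTranspose * (A * A.adjugate) := by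
          rw [Matrix.mul_adjugate, hdet, one_smul, mul_one]
      _ = A.adjugate := by rw [← mul_assoc, hA, one_mul]
  have h' : ∀ i j, conj (A i j) = A.adjugate j i := fun i j => by
    rw [← h, Matrix.conjTranspose_apply]; rfl
  rw [h', Matrix.adjugate_fin_two]
  fin_cases i <;> fin_cases j <;> simp

lemma crossing_equivariant {m : ℝ} (hm : 0 < m) (a b : ℕ) {k : SL2C} (hk : k ∈ littleGroup m) :
    crossing a b ∘ₗ spinRep (a + b) 0 k = spinRep a b k ∘ₗ crossing a b := by
  ext1 f
  refine spinTensor_ext fun I => ?_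
  simp only [LinearMap.comp_apply, spinRep_apply, crossing_apply, tensorLin_apply]
  -- Words of length `a + b` are summed as pairs of words, the second one reversed; each `S_-^*`
  -- slot then uses `conj_mul_neg_one_pow` once, and the signs collect into powers counting ones.
  let e : TensorIndex a b ≃ TensorIndex (a + b) 0 :=
    (((Equiv.refl (Fin a → Fin 2)).prodCongr ((Equiv.refl (Fin b)).arrowCongr Fin.revPerm)).trans
      (Fin.appendEquiv a b)).trans (Equiv.prodUnique _ _).symm
  rw [← e.sum_comp, Finset.mul_sum]
  refine Finset.sum_congr rfl fun J _ => ?_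
  have he : e J = (Fin.append J.1 fun l => (J.2 l).rev, Fin.elim0) :=
    Prod.ext rfl (Subsingleton.elim _ _)
  have hk' := unitary_of_mem_littleGroup hm hk
  have h : (∏ l, conj ((k : Matrix (Fin 2) (Fin 2) ℂ) (I.2 l) (J.2 l))) * (-1) ^ ones J.2
      = (-1) ^ ones I.2 * ∏ l, (k : Matrix (Fin 2) (Fin 2) ℂ) (I.2 l).rev (J.2 l).rev := by
    rw [ones, ones, ← Finset.prod_pow_eq_pow_sum, ← Finset.prod_pow_eq_pow_sum,
      ← Finset.prod_mul_distrib, ← Finset.prod_mul_distrib]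
    exact Finset.prod_congr rfl fun l _ => conj_mul_neg_one_pow hk' k.2 _ _
  rw [he]
  simp only [tensorMatrix, Fin.prod_univ_add, Fin.append_left, Fin.append_right,
    Finset.univ_eq_empty, Finset.prod_empty, mul_one]
  linear_combination (-(∏ x, (k : Matrix (Fin 2) (Fin 2) ℂ) (I.1 x) (J.1 x)) *
    f.1 (Fin.append J.1 fun l => (J.2 l).rev, Fin.elim0)) * h

/-- In counts, a vanishing contraction means `c (i+1) (j+1) = -c i j`. Then `(-1)^j c i j` depends
only on `i - j`, hence only on `i + (b + 1 - j)`, the number of ones after reversing the `S_-^*`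
letters; this is total symmetry after crossing. -/
lemma range_crossing (a b : ℕ) :
    LinearMap.range (crossing (a + 1) (b + 1)) = LinearMap.ker (restContraction a b) := by
  apply le_antisymm
  · rintro _ ⟨f, rfl⟩
    rw [LinearMap.mem_ker]
    refine spinTensor_ext fun I => ?_
    rw [restContraction_apply, crossing_apply, crossing_apply]
    have h := apply_eq_of_ones_eq f
      (I := (Fin.append (Fin.cons 0 I.1 : Fin (a + 1) → Fin 2)
        fun l => ((Fin.cons 0 I.2 : Fin (b + 1) → Fin 2) l).rev, Fin.elim0))
      (I' := (Fin.append (Fin.cons 1 I.1 : Fin (a + 1) → Fin 2)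
        fun l => ((Fin.cons 1 I.2 : Fin (b + 1) → Fin 2) l).rev, Fin.elim0)) (by
        simp only [ones_append]
        have h0 := ones_rev_add (Fin.cons 0 I.2 : Fin (b + 1) → Fin 2)
        have h1 := ones_rev_add (Fin.cons 1 I.2 : Fin (b + 1) → Fin 2)
        rw [ones_cons] at h0 h1 ⊢
        rw [ones_cons]
        simp only [Fin.val_zero, Fin.val_one] at h0 h1 ⊢
        omega) rfl
    simp only [ones_cons, h]
    change _ = (0 : ℂ)
    simp [pow_add]
  · intro w hw
    rw [LinearMap.mem_ker] at hw
    let c : ℕ → ℕ → ℂ := fun i j => w.1 (onesWord (a + 1) i, onesWord (b + 1) j)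
    have hwc : ∀ I, w.1 I = c (ones I.1) (ones I.2) := fun I =>
      apply_eq_of_ones_eq w (ones_onesWord (ones_le _)).symm (ones_onesWord (ones_le _)).symm
    have hc : ∀ i j, i ≤ a → j ≤ b → c (i + 1) (j + 1) = -c i j := by
      intro i j hi hj
      have h : (restContraction a b w).1 (onesWord a i, onesWord b j) = 0 := by rw [hw]; rfl
      rw [restContraction_apply, hwc, hwc] at h
      simp only [ones_cons, ones_onesWord hi, ones_onesWord hj, Fin.val_zero, Fin.val_one,
        zero_add, add_comm 1] at h
      linear_combination 2 * h
    -- The diagonal `i + (b + 1 - j) = s` is evaluated where it meets an edge of the rectangle of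
    -- counts: at `i = 0` if `s ≤ b + 1`, and at `j = 0` otherwise.
    let g : ℕ → ℂ := fun s => if s ≤ b + 1 then (-1) ^ (b + 1 - s) * c 0 (b + 1 - s)
      else c (s - (b + 1)) 0
    have hg : ∀ j i, i ≤ a + 1 → j ≤ b + 1 → (-1) ^ j * g (i + (b + 1 - j)) = c i j := by
      intro j
      induction j with
      | zero =>
        intro i hi _
        simp only [pow_zero, one_mul, tsub_zero, g]
        split_ifs with h
        · obtain rfl : i = 0 := by omega
          simp
        · simp
      | succ j ih =>
        intro i hi hj
        rcases i with _ | i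
        · have e : b + 1 - (0 + (b + 1 - (j + 1))) = j + 1 := by omega
          simp only [g, e]
          rw [if_pos (by omega), ← mul_assoc, ← mul_pow]
          simp
        · rw [hc i j (by omega) (by omega), ← ih i (by omega) (by omega)]
          have e : i + 1 + (b + 1 - (j + 1)) = i + (b + 1 - j) := by omega
          rw [e]
          ring
    refine ⟨ofCounts fun s _ => g s, spinTensor_ext fun I => ?_⟩
    rw [crossing_apply, ofCounts_apply, hwc, ← hg _ _ (ones_le _) (ones_le _), ones_append]
    have := ones_rev_add I.2
    congr 3
    omega

/-! ### Irreducibility of `F_σ` under the little group. -/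

lemma prod_word {n : ℕ} (d : Fin 2 → ℂ) (I : Fin n → Fin 2) :
    ∏ k, d (I k) = d 0 ^ (n - ones I) * d 1 ^ ones I := by
  have h : ∀ k, d (I k) = d 0 ^ ((I k).rev : ℕ) * d 1 ^ (I k : ℕ) := by
    intro k
    generalize I k = i
    fin_cases i <;> simp
  rw [Finset.prod_congr rfl fun k _ => h k, Finset.prod_mul_distrib, Finset.prod_pow_eq_pow_sum,
    Finset.prod_pow_eq_pow_sum]
  congr 2
  have := ones_rev_add I
  simp only [ones] at this ⊢
  omega

/-- The weight vectors of the spin `n / 2` representation. -/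
def weightVector (n i : ℕ) : SpinTensor n 0 := ofCounts fun j _ => if j = i then 1 else 0

lemma weightVector_apply {n i : ℕ} (I : TensorIndex n 0) :
    (weightVector n i).1 I = if ones I.1 = i then 1 else 0 := rfl

/-- The torus element `diag (exp (i t), exp (-i t))`. -/
noncomputable def torus (t : ℝ) : SL2C :=
  ⟨!![Complex.exp (t * Complex.I), 0; 0, Complex.exp (-(t * Complex.I))], by
    rw [Matrix.det_fin_two_of, ← Complex.exp_add]; simp⟩

lemma torus_mem (m t : ℝ) : torus t ∈ littleGroup m := by
  refine mem_littleGroup_of_unitary m ?_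
  have h : ∀ z : ℂ, conj (Complex.exp z) = Complex.exp (conj z) := fun z =>
    (Complex.exp_conj z).symm
  ext i j
  fin_cases i <;> fin_cases j <;>
    simp [torus, Matrix.mul_apply, Fin.sum_univ_two, h, ← Complex.exp_add]

lemma spinRep_torus {n : ℕ} (t : ℝ) (w : SpinTensor n 0) (I : TensorIndex n 0) :
    (spinRep n 0 (torus t) w).1 I
      = Complex.exp (((n - 2 * ones I.1 : ℝ) * t : ℝ) * Complex.I) * w.1 I := by
  rw [spinRep_apply, tensorLin_apply]
  have hd : ∀ J, tensorMatrix n 0 (torus t : Matrix (Fin 2) (Fin 2) ℂ) I J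
      = if J = I then Complex.exp (((n - 2 * ones I.1 : ℝ) * t : ℝ) * Complex.I) else 0 := by
    intro J
    split_ifs with hJ
    · subst hJ
      have h1 := prod_word (fun i => (torus t : Matrix (Fin 2) (Fin 2) ℂ) i i) J.1
      have hle := ones_le J.1
      simp only [tensorMatrix, Finset.univ_eq_empty, Finset.prod_empty, mul_one]
      rw [h1]
      simp only [torus, Matrix.of_apply, Matrix.cons_val', Matrix.cons_val_zero,
        Matrix.cons_val_fin_one, Matrix.cons_val_one]
      rw [← Complex.exp_nat_mul, ← Complex.exp_nat_mul, ← Complex.exp_add]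
      congr 1
      push_cast [hle]
      ring
    · have : ∃ k, I.1 k ≠ J.1 k := by
        by_contra! hcon
        exact hJ (Prod.ext (funext fun k => (hcon k).symm) (Subsingleton.elim _ _))
      obtain ⟨k, hk⟩ := this
      have : (torus t : Matrix (Fin 2) (Fin 2) ℂ) (I.1 k) (J.1 k) = 0 := by
        generalize I.1 k = x at hk ⊢
        generalize J.1 k = y at hk ⊢
        fin_cases x <;> fin_cases y <;> simp_all [torus]
      simp only [tensorMatrix]
      rw [Finset.prod_eq_zero (Finset.mem_univ k) this, zero_mul]
  simp [hd]

/-- With the parameter `1 / (n + 1)` all angles lie in `[-1, 1]`, where the exponential is injective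
on the imaginary axis. A single torus element therefore separates all weights. -/
lemma weight_injOn (n : ℕ) {i j : ℕ} (hi : i ≤ n) (hj : j ≤ n)
    (h : Complex.exp (((n - 2 * i : ℝ) * (1 / (n + 1)) : ℝ) * Complex.I)
      = Complex.exp (((n - 2 * j : ℝ) * (1 / (n + 1)) : ℝ) * Complex.I)) : i = j := by
  have hb : ∀ l : ℕ, l ≤ n → |(n - 2 * l : ℝ) * (1 / (n + 1))| ≤ 1 := by
    intro l hl
    have hl' : (l : ℝ) ≤ n := by exact_mod_cast hl
    have hl0 : (0 : ℝ) ≤ l := Nat.cast_nonneg l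
    rw [abs_mul, abs_of_pos (by positivity : (0 : ℝ) < 1 / (n + 1)), mul_one_div,
      div_le_one (by positivity), abs_le]
    constructor <;> linarith
  have hpi := Real.pi_gt_three
  have hi' := abs_le.1 (hb i hi)
  have hj' := abs_le.1 (hb j hj)
  have him : ∀ r : ℝ, ((r : ℂ) * Complex.I).im = r := by simp
  have h' := Complex.exp_inj_of_neg_pi_lt_of_le_pi (by rw [him]; linarith) (by rw [him]; linarith)
    (by rw [him]; linarith) (by rw [him]; linarith) h
  have h'' := congrArg Complex.im h'
  rw [him, him] at h''
  have hn : (0 : ℝ) < 1 / (n + 1) := by positivity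
  have h3 := mul_right_cancel₀ hn.ne' h''
  exact_mod_cast (by linarith : (i : ℝ) = j)

section irreducible

variable {m : ℝ} {n : ℕ} {U : Submodule ℂ (SpinTensor n 0)}

/-- The product of `torus - c i` over all other weights `i` kills every other component of `w` and
leaves a nonzero multiple of the desired weight vector. -/
lemma weightVector_mem (hU : ∀ k ∈ littleGroup m, ∀ w ∈ U, spinRep n 0 k w ∈ U)
    {w : SpinTensor n 0} (hw : w ∈ U) {I : TensorIndex n 0} (hI : w.1 I ≠ 0) :
    weightVector n (ones I.1) ∈ U := by
  let c : ℕ → ℂ := fun i => Complex.exp (((n - 2 * i : ℝ) * (1 / (n + 1)) : ℝ) * Complex.I)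
  have key : ∀ s : Finset ℕ, ∃ v ∈ U, ∀ J, v.1 J = (∏ i ∈ s, (c (ones J.1) - c i)) * w.1 J := by
    intro s
    induction s using Finset.induction_on with
    | empty => exact ⟨w, hw, by simp⟩
    | insert i s hi ih =>
      obtain ⟨v, hv, h⟩ := ih
      refine ⟨spinRep n 0 (torus (1 / (n + 1))) v - c i • v,
        U.sub_mem (hU _ (torus_mem m _) _ hv) (U.smul_mem _ hv), fun J => ?_⟩
      have := spinRep_torus (1 / (n + 1)) v J
      rw [Finset.prod_insert hi, mul_assoc, ← h J, sub_mul]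
      simp only [Submodule.coe_sub, SetLike.val_smul, PiLp.sub_apply, PiLp.smul_apply,
        smul_eq_mul]
      rw [this]
  obtain ⟨v, hv, h⟩ := key ((Finset.range (n + 1)).erase (ones I.1))
  have hne : v.1 I ≠ 0 := by
    rw [h]
    refine mul_ne_zero (Finset.prod_ne_zero_iff.2 fun i hi => ?_) hI
    rw [Finset.mem_erase, Finset.mem_range] at hi
    exact sub_ne_zero.2 fun hc => hi.1 (weight_injOn n (ones_le _) (by omega) hc).symm
  have e : v = v.1 I • weightVector n (ones I.1) := by
    refine spinTensor_ext fun J => ?_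
    simp only [SetLike.val_smul, PiLp.smul_apply, smul_eq_mul, weightVector_apply]
    split_ifs with hJ
    · rw [mul_one, apply_eq_of_ones_eq v hJ (congrArg ones (Subsingleton.elim J.2 I.2))]
    · rw [mul_zero, h, Finset.prod_eq_zero (i := ones J.1), zero_mul]
      · have := ones_le J.1
        exact Finset.mem_erase.2 ⟨hJ, Finset.mem_range.2 (by omega)⟩
      · exact sub_self _
  rw [← inv_smul_smul₀ hne (weightVector n (ones I.1)), ← e]
  exact U.smul_mem _ hv

/-- A rotation all of whose matrix entries are nonzero. -/
noncomputable def rotation : SL2C :=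
  ⟨!![3 / 5, -(4 / 5); 4 / 5, 3 / 5], by rw [Matrix.det_fin_two_of]; norm_num⟩

lemma rotation_mem (m : ℝ) : rotation ∈ littleGroup m := by
  refine mem_littleGroup_of_unitary m ?_
  ext i j
  fin_cases i <;> fin_cases j <;>
    simp [rotation, Matrix.mul_apply, Fin.sum_univ_two, map_ofNat] <;> norm_num

lemma rotation_ne_zero (i j : Fin 2) : (rotation : Matrix (Fin 2) (Fin 2) ℂ) i j ≠ 0 := by
  fin_cases i <;> fin_cases j <;> simp [rotation]

/-- If the matrix entries of row `I` agree on all words with `i` ones, the component is their common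
value times the number of those words, so nothing can cancel. -/
lemma spinRep_weightVector_ne_zero {i : ℕ} (hi : i ≤ n) {I : TensorIndex n 0} {c : ℂ}
    (hc : c ≠ 0) (h : ∀ J : TensorIndex n 0, ones J.1 = i →
      tensorMatrix n 0 (rotation : Matrix (Fin 2) (Fin 2) ℂ) I J = c) :
    (spinRep n 0 rotation (weightVector n i)).1 I ≠ 0 := by
  rw [spinRep_apply, tensorLin_apply]
  simp only [weightVector_apply, mul_ite, mul_one, mul_zero]
  rw [← Finset.sum_filter, Finset.sum_congr rfl fun J hJ => h J (Finset.mem_filter.1 hJ).2,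
    Finset.sum_const, nsmul_eq_mul]
  refine mul_ne_zero (Nat.cast_ne_zero.2 (Finset.card_pos.2 ⟨(onesWord n i, Fin.elim0), ?_⟩).ne') hc
  simp [ones_onesWord hi]

/-- An invariant subspace contains some weight vector. A rotation without zero entries leads from it
to the extreme weight, and from the extreme weight to all others. -/
lemma eq_top_of_invariant (hU : ∀ k ∈ littleGroup m, ∀ w ∈ U, spinRep n 0 k w ∈ U)
    (hne : U ≠ ⊥) : U = ⊤ := by
  obtain ⟨w, hw, hw0⟩ := (Submodule.ne_bot_iff _).1 hne
  have : ∃ I, w.1 I ≠ 0 := by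
    by_contra! hcon
    exact hw0 (spinTensor_ext hcon)
  obtain ⟨I, hI⟩ := this
  have h1 := weightVector_mem hU hw hI
  have hp : ∀ I J : TensorIndex n 0, tensorMatrix n 0 (rotation : Matrix (Fin 2) (Fin 2) ℂ) I J
      = ∏ k, (rotation : Matrix (Fin 2) (Fin 2) ℂ) (I.1 k) (J.1 k) := by
    intro I J; simp [tensorMatrix]
  -- In the row of the word without ones, a matrix entry depends on `J` only through its number of
  -- ones.
  have h2 : weightVector n 0 ∈ U := by
    have := weightVector_mem hU (hU _ (rotation_mem m) _ h1) (I := (onesWord n 0, Fin.elim0))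
      (spinRep_weightVector_ne_zero (ones_le I.1)
        (c := rotation 0 0 ^ (n - ones I.1) * rotation 0 1 ^ ones I.1)
        (mul_ne_zero (pow_ne_zero _ (rotation_ne_zero _ _)) (pow_ne_zero _ (rotation_ne_zero _ _)))
        fun J hJ => by
          rw [hp]
          simp only [onesWord, not_lt_zero, if_false]
          rw [prod_word (fun j => (rotation : Matrix (Fin 2) (Fin 2) ℂ) 0 j), hJ])
    rwa [ones_onesWord (Nat.zero_le n)] at this
  -- The extreme weight vector is supported on a single word, so the entries to be compared
  -- trivially agree.
  have h3 : ∀ i ≤ n, weightVector n i ∈ U := by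
    intro i hi
    have := weightVector_mem hU (hU _ (rotation_mem m) _ h2) (I := (onesWord n i, Fin.elim0))
      (spinRep_weightVector_ne_zero (Nat.zero_le n)
        (c := ∏ k, (rotation : Matrix (Fin 2) (Fin 2) ℂ) (onesWord n i k) 0)
        (Finset.prod_ne_zero_iff.2 fun k _ => rotation_ne_zero _ _)
        fun J hJ => by
          rw [hp]
          refine Finset.prod_congr rfl fun k _ => ?_
          have : J.1 k = 0 := by
            have := (Finset.sum_eq_zero_iff.1 hJ) k (Finset.mem_univ k)
            exact Fin.ext this
          rw [this])
    rwa [ones_onesWord hi] at this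
  rw [eq_top_iff]
  rintro v -
  have e : v = ∑ i ∈ Finset.range (n + 1), v.1 (onesWord n i, Fin.elim0) • weightVector n i := by
    refine spinTensor_ext fun J => ?_
    have hc : ∀ s : Finset ℕ, (∑ i ∈ s, v.1 (onesWord n i, Fin.elim0) • weightVector n i).1 J
        = ∑ i ∈ s, v.1 (onesWord n i, Fin.elim0) * if ones J.1 = i then 1 else 0 := by
      intro s
      induction s using Finset.induction_on with
      | empty => rfl
      | insert i s hi ih =>
        rw [Finset.sum_insert hi, Finset.sum_insert hi, ← ih]
        rfl
    rw [hc]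
    simp only [mul_ite, mul_one, mul_zero, Finset.sum_ite_eq, Finset.mem_range]
    have := ones_le J.1
    rw [if_pos (by omega)]
    exact apply_eq_of_ones_eq v (ones_onesWord this).symm (congrArg ones (Subsingleton.elim _ _))
  rw [e]
  exact U.sum_mem fun i hi => U.smul_mem _ (h3 i (by have := Finset.mem_range.1 hi; omega))

end irreducible

/-! ### Schur's lemma and the Clebsch–Gordan rule. -/

lemma weightVector_zero_ne_zero (n : ℕ) : weightVector n 0 ≠ 0 := by
  intro h
  have h1 : (weightVector n 0).1 (onesWord n 0, Fin.elim0) = 0 := by rw [h]; rfl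
  rw [weightVector_apply, if_pos (ones_onesWord (Nat.zero_le n))] at h1
  exact one_ne_zero h1

instance (n : ℕ) : Nontrivial (SpinTensor n 0) := ⟨⟨_, _, weightVector_zero_ne_zero n⟩⟩

/-- Schur's lemma: over `ℂ` there is an eigenvalue, and its eigenspace is invariant and nonzero. -/
lemma exists_eq_smul_one_of_commute {m : ℝ} {n : ℕ} {A : SpinTensor n 0 →ₗ[ℂ] SpinTensor n 0}
    (hA : ∀ k ∈ littleGroup m, A ∘ₗ spinRep n 0 k = spinRep n 0 k ∘ₗ A) : ∃ c : ℂ, A = c • 1 := by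
  obtain ⟨c, hc⟩ := Module.End.exists_eigenvalue A
  refine ⟨c, ?_⟩
  have htop : Module.End.eigenspace A c = ⊤ := by
    refine eq_top_of_invariant (m := m) (fun k hk w hw => ?_) hc
    rw [Module.End.mem_eigenspace_iff] at hw ⊢
    have := LinearMap.congr_fun (hA k hk) w
    simp only [LinearMap.comp_apply] at this
    rw [this, hw, map_smul]
  ext1 w
  exact Module.End.mem_eigenspace_iff.1 (htop ▸ Submodule.mem_top : w ∈ Module.End.eigenspace A c)

lemma inner_spinRep {m : ℝ} (hm : 0 < m) {a b : ℕ} {k : SL2C} (hk : k ∈ littleGroup m)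
    (v w : SpinTensor a b) : inner ℂ (spinRep a b k v) (spinRep a b k w) = inner ℂ v w :=
  inner_tensorLin (unitary_of_mem_littleGroup hm hk) v w

lemma inner_spinRep_left {m : ℝ} (hm : 0 < m) {a b : ℕ} {k : SL2C} (hk : k ∈ littleGroup m)
    (v w : SpinTensor a b) : inner ℂ (spinRep a b k v) w = inner ℂ v (spinRep a b k⁻¹ w) := by
  rw [← inner_spinRep hm hk v, ← Module.End.mul_apply (spinRep a b k), ← map_mul, mul_inv_cancel,
    map_one, Module.End.one_apply]

lemma adjoint_equivariant {m : ℝ} (hm : 0 < m) {a b a' b' : ℕ}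
    {J : SpinTensor a b →ₗ[ℂ] SpinTensor a' b'}
    (hJ : ∀ k ∈ littleGroup m, J ∘ₗ spinRep a b k = spinRep a' b' k ∘ₗ J) :
    ∀ k ∈ littleGroup m, LinearMap.adjoint J ∘ₗ spinRep a' b' k
      = spinRep a b k ∘ₗ LinearMap.adjoint J := by
  intro k hk
  ext1 w
  refine ext_inner_right ℂ fun v => ?_
  simp only [LinearMap.comp_apply]
  rw [LinearMap.adjoint_inner_left, inner_spinRep_left hm hk, inner_spinRep_left hm hk,
    LinearMap.adjoint_inner_left]
  have := LinearMap.congr_fun (hJ k⁻¹ (inv_mem hk)) v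
  simp only [LinearMap.comp_apply] at this
  rw [this]

/-- By Schur's lemma `J* J` is a scalar, which a nonzero vector `v` evaluates to `‖J v‖² / ‖v‖²`.
Multiplying `J` by `‖v‖ / ‖J v‖` makes it isometric without changing its range. -/
lemma exists_isometric_equivariant {m : ℝ} (hm : 0 < m) {n a b : ℕ}
    {J : SpinTensor n 0 →ₗ[ℂ] SpinTensor a b} (hinj : Function.Injective J)
    (hJ : ∀ k ∈ littleGroup m, J ∘ₗ spinRep n 0 k = spinRep a b k ∘ₗ J) :
    ∃ J' : SpinTensor n 0 →ₗ[ℂ] SpinTensor a b, LinearMap.range J' = LinearMap.range J ∧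
      (∀ k ∈ littleGroup m, J' ∘ₗ spinRep n 0 k = spinRep a b k ∘ₗ J') ∧
      LinearMap.adjoint J' ∘ₗ J' = 1 := by
  obtain ⟨c, hc⟩ := exists_eq_smul_one_of_commute (m := m) (A := LinearMap.adjoint J ∘ₗ J)
    fun k hk => by
      rw [LinearMap.comp_assoc, hJ k hk, ← LinearMap.comp_assoc, adjoint_equivariant hm hJ k hk,
        LinearMap.comp_assoc]
  obtain ⟨v, hv⟩ := exists_ne (0 : SpinTensor n 0)
  have h1 : (‖J v‖ ^ 2 : ℂ) = c * ‖v‖ ^ 2 := by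
    have h2 := inner_self_eq_norm_sq_to_K (𝕜 := ℂ) (J v)
    have h3 := inner_self_eq_norm_sq_to_K (𝕜 := ℂ) v
    rw [← LinearMap.adjoint_inner_right, ← LinearMap.comp_apply, hc, LinearMap.smul_apply,
      Module.End.one_apply, inner_smul_right, h3] at h2
    exact h2.symm
  have hv' : 0 < ‖v‖ := norm_pos_iff.2 hv
  have hJv : 0 < ‖J v‖ := norm_pos_iff.2 ((map_ne_zero_iff J hinj).2 hv)
  set r : ℝ := ‖v‖ / ‖J v‖ with hr
  have hr0 : (r : ℂ) ≠ 0 := by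
    rw [hr]; exact_mod_cast (div_pos hv' hJv).ne'
  have hrc : (r : ℂ) * r * c = 1 := by
    have h2 : (‖v‖ : ℂ) ≠ 0 := by exact_mod_cast hv'.ne'
    have h3 : (‖J v‖ : ℂ) ≠ 0 := by exact_mod_cast hJv.ne'
    rw [hr]
    push_cast
    field_simp
    linear_combination -h1
  refine ⟨(r : ℂ) • J, LinearMap.range_smul _ _ hr0, fun k hk => ?_, ?_⟩
  · rw [LinearMap.smul_comp, LinearMap.comp_smul, hJ k hk]
  · have hadj : LinearMap.adjoint ((r : ℂ) • J) = (r : ℂ) • LinearMap.adjoint J := by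
      rw [map_smulₛₗ, Complex.conj_ofReal]
    rw [hadj, LinearMap.smul_comp, LinearMap.comp_smul, hc, smul_smul, smul_smul, hrc, one_smul]

/-- Every spin occurring in the restriction to the little group is the kernel of an equivariant
endomorphism, namely the complementary orthogonal projection. -/
lemma OccursIn.exists_kernelIsSpin {m : ℝ} (hm : 0 < m) {n a b : ℕ} (h : OccursIn m n a b) :
    ∃ u : SpinTensor a b →ₗ[ℂ] SpinTensor a b,
      IsLittleGroupEquivariant m (spinRep a b) u ∧ KernelIsSpin m n u := by
  obtain ⟨J₀, hinj₀, hJ₀⟩ := h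
  obtain ⟨J, -, hJ, hiso⟩ := exists_isometric_equivariant hm hinj₀ hJ₀
  have hiso' : ∀ w, LinearMap.adjoint J (J w) = w := LinearMap.congr_fun hiso
  refine ⟨LinearMap.id - J ∘ₗ LinearMap.adjoint J, fun k hk => ?_, J,
    Function.LeftInverse.injective hiso', hJ, ?_⟩
  · rw [LinearMap.sub_comp, LinearMap.comp_sub, LinearMap.comp_assoc,
      adjoint_equivariant hm hJ k hk, ← LinearMap.comp_assoc, hJ k hk, LinearMap.comp_assoc,
      LinearMap.id_comp, LinearMap.comp_id]
  · ext w
    rw [LinearMap.mem_ker, LinearMap.sub_apply, LinearMap.id_apply, sub_eq_zero, LinearMap.mem_range]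
    refine ⟨?_, fun h => ⟨_, h.symm⟩⟩
    rintro ⟨v, rfl⟩
    rw [LinearMap.comp_apply, hiso']

lemma finrank_spinTensor (n : ℕ) : Module.finrank ℂ (SpinTensor n 0) = n + 1 := by
  let e : SpinTensor n 0 ≃ₗ[ℂ] (Fin (n + 1) → ℂ) :=
    { toFun := fun w i => w.1 (onesWord n i, Fin.elim0)
      map_add' := fun v w => rfl
      map_smul' := fun c w => rfl
      invFun := fun c => ofCounts fun i _ => if h : i < n + 1 then c ⟨i, h⟩ else 0
      left_inv := fun w => spinTensor_ext fun I => by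
        have := ones_le I.1
        rw [ofCounts_apply, dif_pos (by omega)]
        exact apply_eq_of_ones_eq w (ones_onesWord this) (congrArg ones (Subsingleton.elim _ _))
      right_inv := fun c => funext fun i => by
        have hi : (i : ℕ) ≤ n := by omega
        change (if h : ones (onesWord n i) < n + 1 then c ⟨_, h⟩ else 0) = c i
        simp only [ones_onesWord hi, i.2, dite_true, Fin.eta] }
  rw [e.finrank_eq, Module.finrank_fin_fun]

/-- The preimage under `J'` of the range of `J` is invariant and nonzero, hence everything. The
ranges coincide, and the dimension `n + 1` tells the spins apart. -/
lemma eq_of_range_le {m : ℝ} {n n' a b : ℕ} {J : SpinTensor n 0 →ₗ[ℂ] SpinTensor a b}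
    {J' : SpinTensor n' 0 →ₗ[ℂ] SpinTensor a b}
    (hinj : Function.Injective J)
    (hJ : ∀ k ∈ littleGroup m, J ∘ₗ spinRep n 0 k = spinRep a b k ∘ₗ J)
    (hinj' : Function.Injective J')
    (hJ' : ∀ k ∈ littleGroup m, J' ∘ₗ spinRep n' 0 k = spinRep a b k ∘ₗ J')
    (hle : LinearMap.range J ≤ LinearMap.range J') : n = n' := by
  have htop : (LinearMap.range J).comap J' = ⊤ := by
    refine eq_top_of_invariant (m := m) ?_ ?_
    · rintro k hk w ⟨v, hv⟩
      refine ⟨spinRep n 0 k v, ?_⟩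
      have h1 := LinearMap.congr_fun (hJ k hk) v
      have h2 := LinearMap.congr_fun (hJ' k hk) w
      simp only [LinearMap.comp_apply] at h1 h2
      rw [h1, h2, hv]
    · obtain ⟨v, hv⟩ := exists_ne (0 : SpinTensor n 0)
      obtain ⟨w, hw⟩ := hle ⟨v, rfl⟩
      refine (Submodule.ne_bot_iff _).2 ⟨w, ⟨v, hw.symm⟩, ?_⟩
      rintro rfl
      rw [map_zero] at hw
      exact (map_ne_zero_iff J hinj).2 hv hw.symm
  have heq : LinearMap.range J = LinearMap.range J' := by
    refine le_antisymm hle ?_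
    rintro _ ⟨w, rfl⟩
    have hw : w ∈ (LinearMap.range J).comap J' := htop ▸ Submodule.mem_top
    exact hw
  have h1 := LinearMap.finrank_range_of_inj hinj
  have h2 := LinearMap.finrank_range_of_inj hinj'
  rw [finrank_spinTensor] at h1 h2
  rw [heq] at h1
  omega

/-- Without `S_+^*` slots there is nothing to contract, and the restriction to `K` is a single
irreducible. This anchors the induction on the number of `S_+^*` slots. -/
lemma crossing_zero_surjective (b : ℕ) : Function.Surjective (crossing 0 b) := by
  intro w
  refine ⟨ofCounts fun s _ => (-1) ^ (b - s) * w.1 (Fin.elim0, onesWord b (b - s)),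
    spinTensor_ext fun I => ?_⟩
  rw [crossing_apply, ofCounts_apply, ones_append]
  have h := ones_rev_add I.2
  have h0 : ones I.1 = 0 := Nat.le_zero.1 (ones_le I.1)
  have e : b - (ones I.1 + ones fun l => (I.2 l).rev) = ones I.2 := by omega
  simp only [e]
  rw [← mul_assoc, ← mul_pow]
  simp only [neg_mul_neg, one_mul, one_pow]
  exact apply_eq_of_ones_eq w h0.symm (ones_onesWord (ones_le _))

lemma kernelIsSpin_restContraction {m : ℝ} (hm : 0 < m) (a b : ℕ) :
    KernelIsSpin m (a + b + 2) (restContraction a b) := by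
  have e : a + b + 2 = (a + 1) + (b + 1) := by ring
  rw [e]
  exact ⟨crossing (a + 1) (b + 1), crossing_injective _ _, fun k hk => crossing_equivariant hm _ _ hk,
    range_crossing a b⟩

lemma occursIn_add {m : ℝ} (hm : 0 < m) (a b : ℕ) : OccursIn m (a + b) a b :=
  ⟨crossing a b, crossing_injective _ _, fun _ hk => crossing_equivariant hm _ _ hk⟩

/-- By irreducibility, the contraction is injective on a copy of `F_n` or kills it. In the first
case `F_n` occurs with one slot fewer of each kind; in the second it lies in the kernel and has the
top spin. -/
lemma OccursIn.bounds {m : ℝ} (hm : 0 < m) {a b n : ℕ} (h : OccursIn m n a b) :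
    n ≤ a + b ∧ a ≤ b + n ∧ b ≤ a + n ∧ Even (a + b + n) := by
  induction a generalizing b with
  | zero =>
    obtain ⟨J, hinj, hJ⟩ := h
    have := eq_of_range_le hinj hJ (crossing_injective 0 b)
      (fun k hk => crossing_equivariant hm _ _ hk)
      (by rw [LinearMap.range_eq_top.2 (crossing_zero_surjective b)]; exact le_top)
    exact ⟨by omega, by omega, by omega, by rw [Nat.even_iff]; omega⟩
  | succ a ih =>
    obtain ⟨J, hinj, hJ⟩ := h
    rcases b with _ | b
    -- Without `S_-^*` slots the tensors already form one irreducible representation.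
    · have := eq_of_range_le (J' := LinearMap.id) hinj hJ Function.injective_id (fun k hk => rfl)
        (by rw [LinearMap.range_id]; exact le_top)
      exact ⟨by omega, by omega, by omega, by rw [Nat.even_iff]; omega⟩
    · have hCJ : ∀ k ∈ littleGroup m, (restContraction a b ∘ₗ J) ∘ₗ spinRep n 0 k
          = spinRep a b k ∘ₗ (restContraction a b ∘ₗ J) := fun k hk => by
        rw [LinearMap.comp_assoc, hJ k hk, ← LinearMap.comp_assoc,
          restContraction_equivariant hm a b k hk, LinearMap.comp_assoc]
      by_cases hker : LinearMap.ker (restContraction a b ∘ₗ J) = ⊥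
      · obtain ⟨h1, h2, h3, h4⟩ := ih ⟨_, LinearMap.ker_eq_bot.1 hker, hCJ⟩
        rw [Nat.even_iff] at h4 ⊢
        exact ⟨by omega, by omega, by omega, by omega⟩
      · have htop := eq_top_of_invariant (m := m) (fun k hk w hw => by
          rw [LinearMap.mem_ker] at hw ⊢
          have := LinearMap.congr_fun (hCJ k hk) w
          rw [LinearMap.comp_apply, LinearMap.comp_apply (spinRep a b k), hw, map_zero] at this
          exact this) hker
        have := eq_of_range_le hinj hJ (crossing_injective (a + 1) (b + 1))
          (fun k hk => crossing_equivariant hm _ _ hk) (by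
            rw [range_crossing]
            rintro _ ⟨v, rfl⟩
            exact LinearMap.mem_ker.1 (htop ▸ Submodule.mem_top : v ∈ LinearMap.ker _))
        exact ⟨by omega, by omega, by omega, by rw [Nat.even_iff]; omega⟩

/-- The top spin is supplied by crossing. Lower spins occur with one slot fewer of each kind, and
the adjoint of the surjective contraction embeds those tensors equivariantly. -/
lemma occursIn_of_bounds {m : ℝ} (hm : 0 < m) {a b n : ℕ} (h1 : n ≤ a + b) (h2 : a ≤ b + n)
    (h3 : b ≤ a + n) (h4 : Even (a + b + n)) : OccursIn m n a b := by
  induction a generalizing b with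
  | zero =>
    obtain rfl : n = 0 + b := by omega
    exact occursIn_add hm 0 b
  | succ a ih =>
    by_cases hn : n = a + 1 + b
    · subst hn
      exact occursIn_add hm (a + 1) b
    · rcases b with _ | b
      · omega
      -- Parity excludes the value just below the top spin, so the bound drops by two, as the
      -- induction hypothesis requires.
      · rw [Nat.even_iff] at h4
        obtain ⟨J, hinj, hJ⟩ := ih (b := b) (by omega) (by omega) (by omega)
          (by rw [Nat.even_iff]; omega)
        refine ⟨LinearMap.adjoint (restContraction a b) ∘ₗ J, ?_, fun k hk => ?_⟩
        · have : Function.Injective (LinearMap.adjoint (restContraction a b)) := by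
            rw [injective_iff_map_eq_zero]
            intro w hw
            obtain ⟨v, rfl⟩ := restContraction_surjective a b w
            rw [← inner_self_eq_zero (𝕜 := ℂ), ← LinearMap.adjoint_inner_left, hw, inner_zero_left]
          exact this.comp hinj
        · rw [LinearMap.comp_assoc, hJ k hk, ← LinearMap.comp_assoc,
            adjoint_equivariant hm (restContraction_equivariant hm a b) k hk, LinearMap.comp_assoc]

/-! ### Covariance of symbols and the realization in momentum space. -/

/-- One has `h h_p = h_{hp} k` with `k` in the little group, and `k` passes through `u` and cancels
against `k⁻¹`. -/
lemma symbol_colorentz {m : ℝ} (hm : 0 < m) {a b : ℕ} {E : Type*} [AddCommGroup E] [Module ℂ E]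
    {ρE : Representation ℂ SL2C E} {u : SpinTensor a b →ₗ[ℂ] E}
    (hu : IsLittleGroupEquivariant m ρE u) (h : SL2C) {p : Momentum} (hp : p ∈ massShell m) :
    symbol m ρE u (colorentz h p) = ρE h ∘ₗ symbol m ρE u p ∘ₗ spinRep a b h⁻¹ := by
  have hk := wigner_mem_littleGroup hm h hp
  set k := (boost m (colorentz h p))⁻¹ * h * boost m p with hkdef
  have e1 : h * boost m p = boost m (colorentz h p) * k := by rw [hkdef]; group
  have e2 : (boost m p)⁻¹ * h⁻¹ = k⁻¹ * (boost m (colorentz h p))⁻¹ := by rw [hkdef]; group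
  clear_value k
  ext1 w
  simp only [symbol, LinearMap.comp_apply]
  rw [← Module.End.mul_apply (ρE h), ← map_mul, e1, ← Module.End.mul_apply (spinRep a b _),
    ← map_mul, e2, map_mul, map_mul, Module.End.mul_apply, Module.End.mul_apply]
  have h1 := LinearMap.congr_fun (hu k hk)
    (spinRep a b k⁻¹ (spinRep a b (boost m (colorentz h p))⁻¹ w))
  simp only [LinearMap.comp_apply] at h1
  rw [← h1, ← Module.End.mul_apply (spinRep a b k), ← map_mul, mul_inv_cancel, map_one,
    Module.End.one_apply]

lemma coe_boost {m : ℝ} (hm : 0 < m) {p : Momentum} (hp : p ∈ massShell m) :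
    ((boost m p : SL2C) : Matrix (Fin 2) (Fin 2) ℂ) = (boostInvMatrix m p).adjugate := by
  rw [← coe_boost_inv hm hp, ← Matrix.SpecialLinearGroup.coe_inv, inv_inv]

/-- The boost enters through its matrix, whose entries are measurable in `p` on the shell, and
`tensorLin` is jointly continuous in matrix and tensor. -/
lemma aestronglyMeasurable_boost_inv {m : ℝ} (hm : 0 < m) {a b : ℕ} {ψ : Momentum → SpinTensor a b}
    (hψ : AEStronglyMeasurable ψ (shellMeasure m)) :
    AEStronglyMeasurable (fun p => spinRep a b (boost m p)⁻¹ (ψ p)) (shellMeasure m) := by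
  have hM : Measurable fun p : Momentum => fun i j => boostInvMatrix m p i j :=
    measurable_pi_iff.2 fun i => measurable_pi_iff.2 fun j => measurable_boostInvMatrix m i j
  refine ((continuous_tensorLin a b).comp_aestronglyMeasurable
    (hM.aestronglyMeasurable.prodMk hψ)).congr ?_
  filter_upwards [ae_mem_massShell hm] with p hp
  rw [spinRep_apply, coe_boost_inv hm hp]
  rfl

lemma aestronglyMeasurable_boost {m : ℝ} (hm : 0 < m) {a b : ℕ} {ψ : Momentum → SpinTensor a b}
    (hψ : AEStronglyMeasurable ψ (shellMeasure m)) :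
    AEStronglyMeasurable (fun p => spinRep a b (boost m p) (ψ p)) (shellMeasure m) := by
  have hM : Measurable fun p : Momentum => fun i j => (boostInvMatrix m p).adjugate i j := by
    refine measurable_pi_iff.2 fun i => measurable_pi_iff.2 fun j => ?_
    have hb := fun i j => measurable_boostInvMatrix m i j
    simp only [Matrix.adjugate_fin_two]
    fin_cases i <;> fin_cases j <;> simp <;> fun_prop
  refine ((continuous_tensorLin a b).comp_aestronglyMeasurable
    (hM.aestronglyMeasurable.prodMk hψ)).congr ?_
  filter_upwards [ae_mem_massShell hm] with p hp
  rw [spinRep_apply, coe_boost hm hp]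
  rfl

lemma continuous_linearMap_spinTensor {a b a' b' : ℕ} (L : SpinTensor a b →ₗ[ℂ] SpinTensor a' b') :
    Continuous L := L.continuous_of_finiteDimensional

/-- The trivialization of `H_(m,σ)` by `p ↦ h_p`. -/
noncomputable def particleToL2 (m : ℝ) (n : ℕ) :
    ParticleSpace m n →ₗᵢ[ℂ] Lp (SpinTensor n 0) 2 (shellMeasure m) where
  toLinearMap :=
    let S : InducedSection m n →ₗᵢ[ℂ] Lp (SpinTensor n 0) 2 (shellMeasure m) :=
      ⟨sectionToL2 m n, fun _ => rfl⟩
    (SeparationQuotient.liftCLM S.toContinuousLinearMap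
      (fun _ _ h => (h.map S.continuous).eq)).toLinearMap
  norm_map' := by
    rintro ⟨f⟩
    rfl

lemma particleToL2_mk {m : ℝ} {n : ℕ} (f : InducedSection m n) :
    particleToL2 m n (SeparationQuotient.mk f) = sectionToL2 m n f := rfl

lemma particleToL2_surjective {m : ℝ} (hm : 0 < m) (n : ℕ) :
    Function.Surjective (particleToL2 m n) := fun ψ =>
  let ⟨f, hf⟩ := sectionToL2_surjective hm n ψ
  ⟨SeparationQuotient.mk f, hf⟩

lemma coeFn_sectionToL2 {m : ℝ} {n : ℕ} (f : InducedSection m n) :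
    sectionToL2 m n f =ᵐ[shellMeasure m] fun p => f.1 (boost m p) := MemLp.coeFn_toLp f.2.2

/-- The amplitudes `p ↦ h_p (J (f p))`, for `J : F_σ → W`. -/
noncomputable def amplitude {m : ℝ} (hm : 0 < m) {n a b : ℕ}
    (J : SpinTensor n 0 →ₗ[ℂ] SpinTensor a b) :
    Lp (SpinTensor n 0) 2 (shellMeasure m) →ₗ[ℂ] (Momentum →ₘ[shellMeasure m] SpinTensor a b) where
  toFun f := AEEqFun.mk (fun p => spinRep a b (boost m p) (J (f p)))
    (aestronglyMeasurable_boost hm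
      ((continuous_linearMap_spinTensor J).comp_aestronglyMeasurable (Lp.aestronglyMeasurable f)))
  map_add' f g := by
    rw [AEEqFun.mk_add_mk, AEEqFun.mk_eq_mk]
    filter_upwards [Lp.coeFn_add f g] with p hp
    rw [hp, Pi.add_apply, map_add, map_add]
    rfl
  map_smul' c f := by
    rw [RingHom.id_apply, AEEqFun.smul_mk, AEEqFun.mk_eq_mk]
    filter_upwards [Lp.coeFn_smul c f] with p hp
    rw [hp, Pi.smul_apply, map_smul, map_smul]
    rfl

lemma coeFn_amplitude {m : ℝ} (hm : 0 < m) {n a b : ℕ} (J : SpinTensor n 0 →ₗ[ℂ] SpinTensor a b)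
    (f : Lp (SpinTensor n 0) 2 (shellMeasure m)) :
    amplitude hm J f =ᵐ[shellMeasure m] fun p => spinRep a b (boost m p) (J (f p)) :=
  AEEqFun.coeFn_mk _ _

/-- The momentum space realization of `H_(m,σ)` attached to `J : F_σ → W`. -/
noncomputable def momentumMap {m : ℝ} (hm : 0 < m) {n a b : ℕ}
    (J : SpinTensor n 0 →ₗ[ℂ] SpinTensor a b) :
    ParticleSpace m n →ₗ[ℂ] (Momentum →ₘ[shellMeasure m] SpinTensor a b) :=
  amplitude hm J ∘ₗ (particleToL2 m n).toLinearMap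

lemma coeFn_momentumMap {m : ℝ} (hm : 0 < m) {n a b : ℕ} (J : SpinTensor n 0 →ₗ[ℂ] SpinTensor a b)
    (ξ : ParticleSpace m n) : momentumMap hm J ξ =ᵐ[shellMeasure m]
      fun p => spinRep a b (boost m p) (J (particleToL2 m n ξ p)) :=
  coeFn_amplitude hm J _

lemma spinRep_inv_apply_self {a b : ℕ} (h : SL2C) (w : SpinTensor a b) :
    spinRep a b h⁻¹ (spinRep a b h w) = w := by
  rw [← Module.End.mul_apply, ← map_mul, inv_mul_cancel, map_one, Module.End.one_apply]

lemma spinRep_apply_inv_self {a b : ℕ} (h : SL2C) (w : SpinTensor a b) :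
    spinRep a b h (spinRep a b h⁻¹ w) = w := by
  rw [← Module.End.mul_apply, ← map_mul, mul_inv_cancel, map_one, Module.End.one_apply]

lemma norm_of_adjoint_comp_self {n a b : ℕ} {J : SpinTensor n 0 →ₗ[ℂ] SpinTensor a b}
    (hJ : LinearMap.adjoint J ∘ₗ J = 1) (v : SpinTensor n 0) : ‖J v‖ = ‖v‖ := by
  have h : inner ℂ (J v) (J v) = inner ℂ v v := by
    rw [← LinearMap.adjoint_inner_left, ← LinearMap.comp_apply, hJ, Module.End.one_apply]
  rw [inner_self_eq_norm_sq_to_K, inner_self_eq_norm_sq_to_K] at h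
  have h' : ‖J v‖ ^ 2 = ‖v‖ ^ 2 := by exact_mod_cast h
  exact (pow_left_inj₀ (norm_nonneg _) (norm_nonneg _) two_ne_zero).1 h'

lemma particleRep_mk {m : ℝ} (hm : 0 < m) {n : ℕ} (g : Poincare) (f : InducedSection m n) :
    particleRep hm n g (SeparationQuotient.mk f) = SeparationQuotient.mk (sectionAct hm n g f) :=
  rfl

/-- With `q = h⁻¹ p` one has `h⁻¹ h_p = h_q k`. The section contributes `k⁻¹`, which `J`
intertwines, and `h_p k⁻¹ = h h_q` gives the action on amplitudes. -/
lemma momentumMap_equivariant {m : ℝ} (hm : 0 < m) {n a b : ℕ}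
    {J : SpinTensor n 0 →ₗ[ℂ] SpinTensor a b}
    (hJ : ∀ k ∈ littleGroup m, J ∘ₗ spinRep n 0 k = spinRep a b k ∘ₗ J)
    (g : Poincare) (ξ : ParticleSpace m n) : ∀ᵐ p ∂shellMeasure m,
      momentumMap hm J (particleRep hm n g ξ) p = translationPhase g.trans p •
        spinRep a b g.lin (momentumMap hm J ξ (colorentz g.lin⁻¹ p)) := by
  obtain ⟨f, rfl⟩ := SeparationQuotient.surjective_mk ξ
  -- Some of the almost everywhere identities are needed at `h⁻¹ p`; invariance of the measure
  -- transfers them.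
  have hq := (measurePreserving_colorentz hm g.lin⁻¹).quasiMeasurePreserving
  filter_upwards [ae_mem_massShell hm, coeFn_momentumMap hm J (particleRep hm n g (SeparationQuotient.mk f)),
    coeFn_sectionToL2 (sectionAct hm n g f),
    hq.ae (coeFn_momentumMap hm J (SeparationQuotient.mk f)), hq.ae (coeFn_sectionToL2 f)]
    with p hp h1 h2 h3 h4
  rw [h1, h3, particleRep_mk, particleToL2_mk, particleToL2_mk, h2, h4]
  have hk := wigner_mem_littleGroup hm g.lin⁻¹ hp
  set q := colorentz g.lin⁻¹ p
  set k := (boost m q)⁻¹ * g.lin⁻¹ * boost m p with hkdef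
  have e1 : g.lin⁻¹ * boost m p = boost m q * k := by rw [hkdef]; group
  have e2 : boost m p * k⁻¹ = g.lin * boost m q := by rw [hkdef]; group
  change spinRep a b (boost m p) (J (translationPhase g.trans (colorentz (boost m p) (restMomentum m)) •
    f.1 (g.lin⁻¹ * boost m p))) = _
  have h5 := LinearMap.congr_fun (hJ k⁻¹ (inv_mem hk)) (f.1 (boost m q))
  simp only [LinearMap.comp_apply] at h5
  rw [colorentz_boost hm hp, e1, f.2.1 _ k hk, map_smul, map_smul, h5,
    ← Module.End.mul_apply (spinRep a b _), ← map_mul, e2, map_mul, Module.End.mul_apply]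

lemma symbol_boost_apply {m : ℝ} {a b : ℕ} {E : Type*} [AddCommGroup E] [Module ℂ E]
    {ρE : Representation ℂ SL2C E} {u : SpinTensor a b →ₗ[ℂ] E} (p : Momentum)
    (w : SpinTensor a b) :
    symbol m ρE u p w = 0 ↔ u (spinRep a b (boost m p)⁻¹ w) = 0 := by
  simp only [symbol, LinearMap.comp_apply]
  refine ⟨fun h => ?_, fun h => by rw [h, map_zero]⟩
  have := congrArg (ρE (boost m p)⁻¹) h
  rwa [map_zero, ← Module.End.mul_apply, ← map_mul, inv_mul_cancel, map_one,
    Module.End.one_apply] at this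

/-- In the fibre product, `h_p⁻¹` undoes the boost in the amplitude and leaves the isometry `J`.
Conversely `J*` inverts `J` on `ker u`, so `Ψ` comes from `J* (h_p⁻¹ Ψ)`, which is square integrable
by hypothesis. -/
theorem isMomentumRealization_momentumMap {m : ℝ} (hm : 0 < m) {n a b : ℕ} {E : Type*}
    [AddCommGroup E] [Module ℂ E] (ρE : Representation ℂ SL2C E) {u : SpinTensor a b →ₗ[ℂ] E}
    {J : SpinTensor n 0 →ₗ[ℂ] SpinTensor a b}
    (hJ : ∀ k ∈ littleGroup m, J ∘ₗ spinRep n 0 k = spinRep a b k ∘ₗ J)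
    (hiso : LinearMap.adjoint J ∘ₗ J = 1) (hrange : LinearMap.range J = LinearMap.ker u) :
    IsMomentumRealization hm n (symbol m ρE u) (momentumMap hm J) where
  inner_eq ξ η := by
    rw [← (particleToL2 m n).inner_map_map, L2.inner_def]
    refine integral_congr_ae ?_
    filter_upwards [coeFn_momentumMap hm J ξ, coeFn_momentumMap hm J η] with p h1 h2
    rw [h1, h2, spinRep_inv_apply_self, spinRep_inv_apply_self, ← LinearMap.adjoint_inner_left,
      ← LinearMap.comp_apply, hiso, Module.End.one_apply]
  mem_range_iff Ψ := by
    constructor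
    · rintro ⟨ξ, rfl⟩
      constructor
      · have h1 := (Lp.memLp (particleToL2 m n ξ)).2
        rw [eLpNorm_lt_top_iff_lintegral_rpow_enorm_lt_top two_ne_zero ENNReal.ofNat_ne_top] at h1
        refine lt_of_eq_of_lt (lintegral_congr_ae ?_) h1
        filter_upwards [coeFn_momentumMap hm J ξ] with p h
        rw [h, spinRep_inv_apply_self, ← ofReal_norm, norm_of_adjoint_comp_self hiso, ofReal_norm]
        simp
      · filter_upwards [coeFn_momentumMap hm J ξ] with p h
        rw [h, symbol_boost_apply, spinRep_inv_apply_self]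
        exact LinearMap.mem_ker.1 (hrange ▸ LinearMap.mem_range_self J _)
    · rintro ⟨h1, h2⟩
      have hm' : MemLp (fun p => LinearMap.adjoint J (spinRep a b (boost m p)⁻¹ (Ψ p))) 2
          (shellMeasure m) := by
        have h3 : MemLp (fun p => spinRep a b (boost m p)⁻¹ (Ψ p)) 2 (shellMeasure m) := by
          refine ⟨aestronglyMeasurable_boost_inv hm Ψ.aestronglyMeasurable, ?_⟩
          rw [eLpNorm_lt_top_iff_lintegral_rpow_enorm_lt_top two_ne_zero ENNReal.ofNat_ne_top]
          simpa using h1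
        exact (LinearMap.adjoint J).toContinuousLinearMap.comp_memLp' h3
      obtain ⟨ξ, hξ⟩ := particleToL2_surjective hm n (MemLp.toLp _ hm')
      refine ⟨ξ, AEEqFun.ext ?_⟩
      filter_upwards [coeFn_momentumMap hm J ξ, h2, MemLp.coeFn_toLp hm'] with p h4 h5 h6
      rw [h4, hξ, h6]
      rw [symbol_boost_apply, ← LinearMap.mem_ker, ← hrange] at h5
      obtain ⟨v, hv⟩ := h5
      have : LinearMap.adjoint J (J v) = v := LinearMap.congr_fun hiso v
      rw [← hv, this, hv, spinRep_apply_inv_self]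
  equivariant := momentumMap_equivariant hm hJ

theorem exists_isMomentumRealization {m : ℝ} (hm : 0 < m) {n a b : ℕ} {E : Type*}
    [AddCommGroup E] [Module ℂ E] (ρE : Representation ℂ SL2C E) {u : SpinTensor a b →ₗ[ℂ] E}
    (hu : KernelIsSpin m n u) : ∃ T, IsMomentumRealization hm n (symbol m ρE u) T := by
  obtain ⟨J₀, hinj, hJ₀, hrange₀⟩ := hu
  obtain ⟨J, hrange, hJ, hiso⟩ := exists_isometric_equivariant hm hinj hJ₀
  exact ⟨_, isMomentumRealization_momentumMap hm ρE hJ hiso (hrange.trans hrange₀)⟩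

/-! ### Fourier transform and plane wave integrals. -/

/-- The homothety `p ↦ p / 2π` relating the two normalizations of the Fourier transform. -/
noncomputable def momentumScale : Momentum ≃L[ℝ] Momentum :=
  (LinearEquiv.smulOfNeZero ℝ Momentum (2 * Real.pi)⁻¹
    (inv_ne_zero (by positivity))).toContinuousLinearEquiv

lemma momentumScale_apply (p : Momentum) : momentumScale p = (2 * Real.pi)⁻¹ • p := rfl

/-- `fieldFourier` as a continuous linear map on Schwartz functions. -/
noncomputable def fieldFourierCLM : 𝓢(Spacetime, ℂ) →L[ℂ] 𝓢(Momentum, ℂ) :=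
  (SchwartzMap.compCLMOfContinuousLinearEquiv ℂ momentumScale).comp
    (FourierTransform.fourierCLM ℂ 𝓢(Spacetime, ℂ))

lemma fieldFourierCLM_apply' (f : 𝓢(Spacetime, ℂ)) (p : Momentum) :
    fieldFourierCLM f p = FourierTransform.fourier f (momentumScale p) := rfl

lemma inner_eq_pairing (x : Spacetime) (p : Momentum) : inner ℝ x p = pairing p x := by
  simp [pairing, PiLp.inner_apply]

lemma fieldFourierCLM_apply (f : 𝓢(Spacetime, ℂ)) (p : Momentum) :
    fieldFourierCLM f p = fieldFourier f p := by
  rw [fieldFourierCLM_apply', SchwartzMap.fourier_coe, Real.fourier_eq', fieldFourier]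
  refine integral_congr_ae (Filter.Eventually.of_forall fun x => ?_)
  change Complex.exp _ • f x = Complex.exp _ * f x
  rw [smul_eq_mul, momentumScale_apply, inner_smul_right, inner_eq_pairing]
  congr 2
  have : (Real.pi : ℂ) ≠ 0 := by exact_mod_cast Real.pi_ne_zero
  push_cast
  field_simp

/-- Fourier inversion makes every Schwartz function of momentum available as a test function; this
is what allows an amplitude to be recovered from its field. -/
lemma exists_fieldFourier_eq (g : 𝓢(Momentum, ℂ)) :
    ∃ f : 𝓢(Spacetime, ℂ), ∀ p, fieldFourier f p = g p := by
  refine ⟨FourierTransformInv.fourierInv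
    (SchwartzMap.compCLMOfContinuousLinearEquiv ℂ momentumScale.symm g), fun p => ?_⟩
  rw [← fieldFourierCLM_apply, fieldFourierCLM_apply', FourierTransform.fourier_fourierInv_eq]
  exact congrArg g (momentumScale.symm_apply_apply p)

lemma fieldFourier_lineDeriv (f : 𝓢(Spacetime, ℂ)) (μ : Fin 4) (p : Momentum) :
    fieldFourier (∂_{unitVec μ} f : 𝓢(Spacetime, ℂ)) p = (Complex.I * p μ) * fieldFourier f p := by
  rw [← fieldFourierCLM_apply, ← fieldFourierCLM_apply, fieldFourierCLM_apply',
    fieldFourierCLM_apply', SchwartzMap.fourier_lineDerivOp_eq]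
  have h : (inner ℝ · (unitVec μ) : Momentum → ℝ).HasTemperateGrowth := by fun_prop
  rw [smul_apply, SchwartzMap.smulLeftCLM_apply_apply h, momentumScale_apply,
    inner_smul_left]
  have h2 : inner ℝ p (unitVec μ) = p μ := by
    rw [unitVec, EuclideanSpace.inner_single_right]; simp
  have : (Real.pi : ℂ) ≠ 0 := by exact_mod_cast Real.pi_ne_zero
  rw [h2]
  simp only [smul_eq_mul, Complex.real_smul]
  simp
  field_simp

lemma fieldFourier_neg (f : 𝓢(Spacetime, ℂ)) (p : Momentum) :
    fieldFourier (-f) p = -fieldFourier f p := by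
  rw [← fieldFourierCLM_apply, ← fieldFourierCLM_apply, map_neg]; rfl

namespace IsPlaneWaveIntegral

variable {a b : ℕ} {ν : Measure Momentum} {ψ ψ' : Momentum → SpinTensor a b} {φ φ' : TensorField a b}

lemma congr_ae (h : IsPlaneWaveIntegral ν ψ φ) (hψ : ψ =ᵐ[ν] ψ') : IsPlaneWaveIntegral ν ψ' φ := by
  intro f
  have e : (fun p => fieldFourier f p • ψ p) =ᵐ[ν] fun p => fieldFourier f p • ψ' p := by
    filter_upwards [hψ] with p hp
    rw [hp]
  exact ⟨(h f).1.congr e, (h f).2.trans (integral_congr_ae e)⟩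

lemma add (h : IsPlaneWaveIntegral ν ψ φ) (h' : IsPlaneWaveIntegral ν ψ' φ') :
    IsPlaneWaveIntegral ν (fun p => ψ p + ψ' p) (φ + φ') := by
  intro f
  simp only [smul_add]
  refine ⟨(h f).1.add (h' f).1, ?_⟩
  rw [integral_add (h f).1 (h' f).1, ← (h f).2, ← (h' f).2]
  rfl

lemma const_smul (h : IsPlaneWaveIntegral ν ψ φ) (c : ℂ) :
    IsPlaneWaveIntegral ν (fun p => c • ψ p) (c • φ) := by
  intro f
  simp only [smul_comm _ c]
  refine ⟨(h f).1.smul c, ?_⟩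
  rw [integral_smul, ← (h f).2]
  rfl

lemma sub (h : IsPlaneWaveIntegral ν ψ φ) (h' : IsPlaneWaveIntegral ν ψ' φ') :
    IsPlaneWaveIntegral ν (fun p => ψ p - ψ' p) (φ - φ') := by
  intro f
  simp only [smul_sub]
  refine ⟨(h f).1.sub (h' f).1, ?_⟩
  rw [integral_sub (h f).1 (h' f).1, ← (h f).2, ← (h' f).2]
  rfl

lemma sum {ι : Type*} {s : Finset ι} {ψ : ι → Momentum → SpinTensor a b} {φ : ι → TensorField a b}
    (h : ∀ i, IsPlaneWaveIntegral ν (ψ i) (φ i)) :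
    IsPlaneWaveIntegral ν (fun p => ∑ i ∈ s, ψ i p) (∑ i ∈ s, φ i) := by
  classical
  induction s using Finset.induction_on with
  | empty =>
    simp only [Finset.sum_empty]
    intro f
    simp only [smul_zero, integral_zero]
    exact ⟨integrable_zero _ _ _, rfl⟩
  | insert i s hi ih =>
    simp only [Finset.sum_insert hi]
    exact (h i).add ih

lemma mapValues {a' b' : ℕ} (h : IsPlaneWaveIntegral ν ψ φ)
    (L : SpinTensor a b →ₗ[ℂ] SpinTensor a' b') :
    IsPlaneWaveIntegral ν (fun p => L (ψ p)) (mapValues L φ) := by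
  intro f
  have e : (fun p => fieldFourier f p • L (ψ p))
      = fun p => L.toContinuousLinearMap (fieldFourier f p • ψ p) := by
    funext p
    rw [map_smul]
    rfl
  rw [e]
  refine ⟨L.toContinuousLinearMap.integrable_comp (h f).1, ?_⟩
  rw [L.toContinuousLinearMap.integral_comp_comm (h f).1, ← (h f).2]
  rfl

/-- A distributional derivative is tested against `-∂_μ f`, and this sign turns the factor `i p_μ`
of the transform into `-i p_μ`. -/
lemma lineDeriv (h : IsPlaneWaveIntegral ν ψ φ) (μ : Fin 4) :
    IsPlaneWaveIntegral ν (fun p => (-(Complex.I * p μ)) • ψ p) (∂_{unitVec μ} φ) := by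
  intro f
  have e : (fun p => fieldFourier f p • (-(Complex.I * p μ)) • ψ p)
      = fun p => fieldFourier (-∂_{unitVec μ} f) p • ψ p := by
    funext p
    rw [fieldFourier_neg, fieldFourier_lineDeriv, smul_smul]
    congr 1
    ring
  rw [e]
  exact ⟨(h _).1, (h _).2⟩

lemma kleinGordon (h : IsPlaneWaveIntegral ν ψ φ) (m : ℝ) :
    IsPlaneWaveIntegral ν (fun p => ((m ^ 2 - minkSq p : ℝ) : ℂ) • ψ p) (kleinGordon m φ) := by
  have h1 := (((((h.lineDeriv 0).lineDeriv 0).sub ((h.lineDeriv 1).lineDeriv 1)).sub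
    ((h.lineDeriv 2).lineDeriv 2)).sub ((h.lineDeriv 3).lineDeriv 3)).add
    (h.const_smul ((m : ℂ) ^ 2))
  refine h1.congr_ae (Filter.Eventually.of_forall fun p => ?_)
  simp only [smul_smul, ← sub_smul, ← add_smul, minkSq]
  congr 1
  push_cast
  linear_combination ((p 0 : ℂ) ^ 2 - (p 1) ^ 2 - (p 2) ^ 2 - (p 3) ^ 2) * Complex.I_sq

end IsPlaneWaveIntegral

lemma contract_add {a b : ℕ} (M N : Matrix (Fin 2) (Fin 2) ℂ) :
    (contract (M + N) : SpinTensor (a + 1) (b + 1) →ₗ[ℂ] SpinTensor a b)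
      = contract M + contract N := by
  ext1 w
  refine spinTensor_ext fun I => ?_
  rw [LinearMap.add_apply]
  change _ = (contract M w).1 I + (contract N w).1 I
  simp only [contract_apply, Matrix.add_apply, add_mul, Finset.sum_add_distrib]

lemma contract_smul {a b : ℕ} (c : ℂ) (M : Matrix (Fin 2) (Fin 2) ℂ) :
    (contract (c • M) : SpinTensor (a + 1) (b + 1) →ₗ[ℂ] SpinTensor a b) = c • contract M := by
  ext1 w
  refine spinTensor_ext fun I => ?_
  rw [LinearMap.smul_apply]
  change _ = c * (contract M w).1 I
  simp only [contract_apply, Matrix.smul_apply, smul_eq_mul, mul_assoc, Finset.mul_sum]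

lemma contract_covectorGamma {a b : ℕ} (p : Momentum) :
    (contract (covectorGamma p) : SpinTensor (a + 1) (b + 1) →ₗ[ℂ] SpinTensor a b)
      = ∑ μ, (p μ : ℂ) • contract (covectorGamma (unitVec μ)) := by
  have h : covectorGamma p = ∑ μ, (p μ : ℂ) • covectorGamma (unitVec μ) := by
    ext i j
    simp [covectorGamma, unitVec, Fin.sum_univ_four, Matrix.sum_apply]
  rw [h]
  simp only [Fin.sum_univ_four, contract_add, contract_smul]

/-- The minus sign is `(-i)(-i p_μ) = -p_μ`; it does not affect the kernel. -/
lemma IsPlaneWaveIntegral.divergence {a b : ℕ} {ν : Measure Momentum}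
    {ψ : Momentum → SpinTensor (a + 1) (b + 1)} {φ : TensorField (a + 1) (b + 1)}
    (h : IsPlaneWaveIntegral ν ψ φ) :
    IsPlaneWaveIntegral ν (fun p => -contract (covectorGamma p) (ψ p)) (divergence φ) := by
  have h1 := IsPlaneWaveIntegral.sum (s := Finset.univ) fun μ =>
    ((h.lineDeriv μ).const_smul (-Complex.I)).mapValues (contract (covectorGamma (unitVec μ)))
  refine h1.congr_ae (Filter.Eventually.of_forall fun p => ?_)
  simp only
  rw [contract_covectorGamma, LinearMap.sum_apply, ← Finset.sum_neg_distrib]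
  refine Finset.sum_congr rfl fun μ _ => ?_
  rw [smul_smul, map_smul, LinearMap.smul_apply, ← neg_smul]
  congr 1
  linear_combination (p μ : ℂ) * Complex.I_sq

/-- A plane wave integral determines its amplitude. -/
theorem IsPlaneWaveIntegral.eq_zero_iff {a b : ℕ} {ν : Measure Momentum}
    {ψ : Momentum → SpinTensor a b} {φ : TensorField a b} (h : IsPlaneWaveIntegral ν ψ φ) :
    φ = 0 ↔ ∀ᵐ p ∂ν, ψ p = 0 := by
  -- Testing over all `f` amounts to testing the amplitude against all Schwartz functions of
  -- momentum, so that the fundamental lemma of the calculus of variations applies.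
  have hsch : ∀ g : 𝓢(Momentum, ℂ), Integrable (fun p => g p • ψ p) ν ∧
      (φ = 0 → ∫ p, g p • ψ p ∂ν = 0) := by
    intro g
    obtain ⟨f, hf⟩ := exists_fieldFourier_eq g
    have := h f
    simp only [hf] at this
    exact ⟨this.1, fun h0 => by rw [← this.2, h0]; rfl⟩
  have htest : ∀ g : Momentum → ℝ, ContDiff ℝ ∞ g → HasCompactSupport g →
      Integrable (fun p => g p • ψ p) ν ∧ (φ = 0 → ∫ p, g p • ψ p ∂ν = 0) := by
    intro g hg hgc
    have hc : HasCompactSupport fun p => (g p : ℂ) := hgc.comp_left Complex.ofReal_zero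
    have hs : ContDiff ℝ ∞ fun p => (g p : ℂ) := Complex.ofRealCLM.contDiff.comp hg
    have := hsch (hc.toSchwartzMap hs)
    simpa only [HasCompactSupport.toSchwartzMap_toFun, Complex.coe_smul] using this
  constructor
  · intro h0
    refine ae_eq_zero_of_integral_contDiff_smul_eq_zero ?_ fun g hg hgc => (htest g hg hgc).2 h0
    intro p₀
    -- Local integrability of `ψ` is not assumed; it follows from integrability of `g • ψ` for a
    -- bump `g` equal to `1` near `p₀`.
    obtain ⟨g, hg⟩ : ∃ g : ContDiffBump p₀, g = ⟨1, 2, one_pos, one_lt_two⟩ := ⟨_, rfl⟩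
    refine ⟨Metric.closedBall p₀ 1, Metric.closedBall_mem_nhds _ one_pos, ?_⟩
    refine IntegrableOn.congr_fun (htest g g.contDiff g.hasCompactSupport).1.integrableOn
      (fun p hp => ?_) measurableSet_closedBall
    have h1 : g p = 1 := g.one_of_mem_closedBall (by rw [hg]; exact hp)
    simp only [h1, one_smul]
  · intro h0
    refine DFunLike.ext _ _ fun f => (h f).2.trans ?_
    refine integral_eq_zero_of_ae ?_
    filter_upwards [h0] with p hp
    simp [hp]

/-! ### Growth of boosts and existence of the fields. -/

/-- The density of `β_m` is at most `1 / (2m)`, and `(1 + ‖k‖²)⁻²` decays with exponent `4 > 3`, so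
it is integrable in three dimensions. -/
lemma memLp_two_inv_one_add_norm_sq {m : ℝ} (hm : 0 < m) :
    MemLp (fun p : Momentum => (1 + ‖p‖ ^ 2)⁻¹) 2 (shellMeasure m) := by
  have hmeas : Measurable fun p : Momentum => (1 + ‖p‖ ^ 2)⁻¹ := by fun_prop
  refine ⟨hmeas.aestronglyMeasurable, ?_⟩
  rw [eLpNorm_lt_top_iff_lintegral_rpow_enorm_lt_top two_ne_zero ENNReal.ofNat_ne_top,
    lintegral_shellMeasure _ (by fun_prop)]
  have hint : Integrable (fun k : EuclideanSpace ℝ (Fin 3) =>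
      (1 / (2 * m)) * (1 + ‖k‖ ^ 2) ^ (-(4 : ℝ) / 2)) :=
    (integrable_rpow_neg_one_add_norm_sq (by simp; norm_num)).const_mul _
  refine lt_of_le_of_lt (lintegral_mono fun k => ?_) hint.lintegral_lt_top
  have h1 : ‖k‖ ^ 2 ≤ ‖shellPoint m k‖ ^ 2 := by
    rw [EuclideanSpace.norm_sq_eq, EuclideanSpace.norm_sq_eq, Fin.sum_univ_three,
      Fin.sum_univ_four]
    simp [shellPoint]
  have h2 : m ≤ √(m ^ 2 + ‖k‖ ^ 2) := Real.le_sqrt_of_sq_le (by nlinarith [sq_nonneg ‖k‖])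
  have h3 : (1 + ‖k‖ ^ 2 : ℝ) ^ (-(4 : ℝ) / 2) = ((1 + ‖k‖ ^ 2)⁻¹) ^ 2 := by
    rw [show (-(4 : ℝ) / 2) = -((2 : ℕ) : ℝ) by norm_num, Real.rpow_neg (by positivity),
      Real.rpow_natCast, inv_pow]
  have h4 : ‖(1 + ‖shellPoint m k‖ ^ 2)⁻¹‖ₑ ^ (2 : ENNReal).toReal
      = ENNReal.ofReal (((1 + ‖shellPoint m k‖ ^ 2)⁻¹) ^ 2) := by
    rw [Real.enorm_eq_ofReal (by positivity), ENNReal.toReal_ofNat, ENNReal.ofReal_pow (by positivity)]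
    norm_num
  rw [h4, ← ENNReal.ofReal_mul (by positivity), h3]
  refine ENNReal.ofReal_le_ofReal ?_
  gcongr

/-- On a bounded set the square integrable weight of the previous lemma is bounded below. -/
lemma isFiniteMeasureOnCompacts_shellMeasure {m : ℝ} (hm : 0 < m) :
    IsFiniteMeasureOnCompacts (shellMeasure m) where
  lt_top_of_isCompact K hK := by
    obtain ⟨R, hR⟩ := hK.isBounded.exists_norm_le
    have hint := (memLp_two_inv_one_add_norm_sq hm).integrable_sq
    have hpos : 0 < ((1 + R ^ 2)⁻¹) ^ 2 := by positivity
    refine lt_of_le_of_lt (measure_mono fun p hp => ?_) (hint.measure_ge_lt_top hpos)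
    have := hR p hp
    change ((1 + R ^ 2)⁻¹) ^ 2 ≤ ((1 + ‖p‖ ^ 2)⁻¹) ^ 2
    gcongr

lemma norm_tensorLin_le {a b : ℕ} {A : Matrix (Fin 2) (Fin 2) ℂ} {c : ℝ}
    (hA : ∀ i j, ‖A i j‖ ≤ c) (w : SpinTensor a b) :
    ‖tensorLin a b A w‖ ≤ Fintype.card (TensorIndex a b) ^ 2 * c ^ (a + b) * ‖w‖ := by
  have hc : 0 ≤ c := (norm_nonneg _).trans (hA 0 0)
  have hentry : ∀ I, ‖(tensorLin a b A w).1 I‖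
      ≤ Fintype.card (TensorIndex a b) * (c ^ (a + b) * ‖w‖) := by
    intro I
    rw [tensorLin_apply]
    calc ‖∑ J, tensorMatrix a b A I J * w.1 J‖ ≤ ∑ _J : TensorIndex a b, c ^ (a + b) * ‖w‖ := by
          refine norm_sum_le_of_le _ fun J _ => ?_
          rw [norm_mul]
          refine mul_le_mul ?_ (PiLp.norm_apply_le w.1 J) (norm_nonneg _) (by positivity)
          rw [tensorMatrix, norm_mul, norm_prod, norm_prod, pow_add]
          refine mul_le_mul ?_ ?_ (Finset.prod_nonneg fun _ _ => norm_nonneg _) (by positivity)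
          · calc _ ≤ ∏ _k : Fin a, c := Finset.prod_le_prod (fun _ _ => norm_nonneg _) fun k _ => hA _ _
              _ = c ^ a := by simp
          · calc _ ≤ ∏ _k : Fin b, c := Finset.prod_le_prod (fun _ _ => norm_nonneg _) fun k _ => by
                  rw [RCLike.norm_conj]; exact hA _ _
              _ = c ^ b := by simp
      _ = _ := by simp
  have hsum : ∀ v : EuclideanSpace ℂ (TensorIndex a b), ‖v‖ ≤ ∑ I, ‖v I‖ := by
    intro v
    conv_lhs => rw [← (EuclideanSpace.basisFun (TensorIndex a b) ℂ).sum_repr v]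
    refine norm_sum_le_of_le _ fun I _ => ?_
    simp [norm_smul]
  calc ‖tensorLin a b A w‖ ≤ ∑ I, ‖(tensorLin a b A w).1 I‖ := hsum _
    _ ≤ ∑ _I : TensorIndex a b, Fintype.card (TensorIndex a b) * (c ^ (a + b) * ‖w‖) :=
        Finset.sum_le_sum fun I _ => hentry I
    _ = _ := by
        rw [Finset.sum_const, Finset.card_univ, nsmul_eq_mul]
        ring

/-- The normalizing factor is at most `1 / m`, because `2 m (p₀ + m) ≥ m²`; the entries of the
matrix of `p` are at most `2 ‖p‖ ≤ 1 + ‖p‖²`. -/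
lemma norm_boostInvMatrix_le {m : ℝ} (hm : 0 < m) {p : Momentum} (hp : p ∈ massShell m)
    (i j : Fin 2) : ‖boostInvMatrix m p i j‖ ≤ (1 / m + 1) * (1 + ‖p‖ ^ 2) := by
  have hp0 := hp.2
  have hx : ∀ μ, ‖(p μ : ℂ)‖ ≤ ‖p‖ := fun μ => by
    rw [Complex.norm_real]; exact PiLp.norm_apply_le p μ
  have h1 : ‖(((√(2 * m * (p 0 + m)))⁻¹ : ℝ) : ℂ)‖ ≤ 1 / m := by
    rw [Complex.norm_real, Real.norm_of_nonneg (by positivity), ← one_div]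
    refine one_div_le_one_div_of_le hm (Real.le_sqrt_of_sq_le ?_)
    nlinarith [mul_pos hm hp0]
  have h2 : ‖(herm p + (m : ℂ) • 1) i j‖ ≤ 2 * ‖p‖ + m := by
    have hmn : ‖(m : ℂ)‖ = m := by rw [Complex.norm_real, Real.norm_of_nonneg hm.le]
    have e2 : ‖(p 2 : ℂ) * Complex.I‖ ≤ ‖p‖ := by
      rw [norm_mul, Complex.norm_I, mul_one]; exact hx 2
    rw [herm_eq]
    fin_cases i <;> fin_cases j <;> simp only [Matrix.add_apply, Matrix.smul_apply, Fin.zero_eta,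
      Fin.mk_one, Matrix.of_apply, Matrix.cons_val', Matrix.cons_val_zero, Matrix.cons_val_fin_one,
      Matrix.cons_val_one, Matrix.one_apply_eq, smul_eq_mul, mul_one, ne_eq, zero_ne_one,
      one_ne_zero, not_false_eq_true, Matrix.one_apply_ne, mul_zero, add_zero]
    · have := norm_add₃_le (a := (p 0 : ℂ)) (b := (p 3 : ℂ)) (c := (m : ℂ))
      linarith [hx 0, hx 3]
    · have := norm_sub_le (p 1 : ℂ) ((p 2 : ℂ) * Complex.I)
      linarith [hx 1]
    · have := norm_add_le (p 1 : ℂ) ((p 2 : ℂ) * Complex.I)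
      linarith [hx 1]
    · have := norm_add_le ((p 0 : ℂ) - p 3) (m : ℂ)
      have := norm_sub_le (p 0 : ℂ) (p 3 : ℂ)
      linarith [hx 0, hx 3]
  rw [boostInvMatrix, Matrix.smul_apply, smul_eq_mul, norm_mul]
  calc _ ≤ 1 / m * (2 * ‖p‖ + m) := mul_le_mul h1 h2 (norm_nonneg _) (by positivity)
    _ = 1 / m * (2 * ‖p‖) + 1 := by field_simp
    _ ≤ 1 / m * (1 + ‖p‖ ^ 2) + (1 + ‖p‖ ^ 2) := by
        gcongr
        · nlinarith [sq_nonneg (‖p‖ - 1)]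
        · nlinarith [sq_nonneg ‖p‖]
    _ = _ := by ring

/-- A two by two adjugate only permutes entries and changes signs, so the boost obeys the same
entrywise bound as its inverse. -/
lemma norm_spinRep_boost_le {m : ℝ} (hm : 0 < m) (a b : ℕ) : ∃ C : ℝ, 0 ≤ C ∧
    ∀ p ∈ massShell m, ∀ w : SpinTensor a b,
      ‖spinRep a b (boost m p) w‖ ≤ C * (1 + ‖p‖ ^ 2) ^ (a + b) * ‖w‖ := by
  refine ⟨Fintype.card (TensorIndex a b) ^ 2 * (1 / m + 1) ^ (a + b), by positivity,
    fun p hp w => ?_⟩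
  have h := norm_tensorLin_le (A := (boost m p : Matrix (Fin 2) (Fin 2) ℂ))
    (c := (1 / m + 1) * (1 + ‖p‖ ^ 2)) (fun i j => by
      have hb := norm_boostInvMatrix_le hm hp
      rw [coe_boost hm hp, Matrix.adjugate_fin_two]
      fin_cases i <;> fin_cases j <;> simp [-one_div, hb]) w
  rw [mul_pow, ← mul_assoc] at h
  exact h

/-- Of the `a + b + 1` powers of the weight, `a + b` absorb the growth of the boost. The last one is
square integrable, and its product with an `L²` section is integrable. -/
lemma integrable_momentumMap {m : ℝ} (hm : 0 < m) {n a b : ℕ}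
    (J : SpinTensor n 0 →ₗ[ℂ] SpinTensor a b) (ξ : ParticleSpace m n) :
    Integrable (fun p => (((1 + ‖p‖ ^ 2) ^ (a + b + 1))⁻¹ : ℝ) • momentumMap hm J ξ p)
      (shellMeasure m) := by
  obtain ⟨C, hC, hb⟩ := norm_spinRep_boost_le hm a b
  have h1 : MemLp (fun p => J (particleToL2 m n ξ p)) 2 (shellMeasure m) :=
    J.toContinuousLinearMap.comp_memLp' (Lp.memLp _)
  have h2 : Integrable (fun p : Momentum => (1 + ‖p‖ ^ 2)⁻¹ * ‖J (particleToL2 m n ξ p)‖)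
      (shellMeasure m) := (memLp_two_inv_one_add_norm_sq hm).integrable_mul h1.norm
  have hmeas : Measurable fun p : Momentum => (((1 + ‖p‖ ^ 2) ^ (a + b + 1))⁻¹ : ℝ) := by fun_prop
  refine (h2.const_mul C).mono' (hmeas.aestronglyMeasurable.smul
    (momentumMap hm J ξ).aestronglyMeasurable) ?_
  filter_upwards [ae_mem_massShell hm, coeFn_momentumMap hm J ξ] with p hp h
  rw [h, norm_smul, Real.norm_of_nonneg (by positivity)]
  calc _ ≤ ((1 + ‖p‖ ^ 2) ^ (a + b + 1))⁻¹ * (C * (1 + ‖p‖ ^ 2) ^ (a + b) *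
        ‖J (particleToL2 m n ξ p)‖) := by
        gcongr
        exact hb p hp _
    _ = _ := by
        have : (0 : ℝ) < 1 + ‖p‖ ^ 2 := by positivity
        rw [pow_succ (1 + ‖p‖ ^ 2)]
        field_simp

/-- The tempered distribution `f ↦ ∫ f h dν`, for `h` integrable. -/
noncomputable def integralAgainst {E : Type*} [NormedAddCommGroup E] [NormedSpace ℂ E]
    {ν : Measure Momentum} {h : Momentum → E} (hh : Integrable h ν) : 𝓢(Momentum, ℂ) →L[ℂ] E :=
  SchwartzMap.mkCLMtoNormedSpace (fun g => ∫ p, g p • h p ∂ν)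
    (fun f g => by
      have hi : ∀ g : 𝓢(Momentum, ℂ), Integrable (fun p => g p • h p) ν := fun g =>
        hh.bdd_smul (φ := g) (SchwartzMap.seminorm ℂ 0 0 g)
        g.continuous.aestronglyMeasurable (Filter.Eventually.of_forall (g.norm_le_seminorm ℂ))
      rw [← integral_add (hi f) (hi g)]
      refine integral_congr_ae (Filter.Eventually.of_forall fun p => ?_)
      exact add_smul _ _ _)
    (fun c g => by
      rw [← integral_smul]
      refine integral_congr_ae (Filter.Eventually.of_forall fun p => ?_)
      exact smul_assoc c (g p) (h p))
    ⟨{(0, 0)}, ∫ p, ‖h p‖ ∂ν, integral_nonneg fun _ => norm_nonneg _, fun g => by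
      rw [Finset.sup_singleton, mul_comm, ← integral_const_mul]
      refine norm_integral_le_of_norm_le (hh.norm.const_mul _)
        (Filter.Eventually.of_forall fun p => ?_)
      rw [norm_smul]
      gcongr
      exact g.norm_le_seminorm ℂ p⟩

/-- The weight `(1 + ‖p‖²)^N` has temperate growth, so it may be moved onto the test function; what
remains is integration of a Schwartz function against an integrable one. -/
lemma exists_isPlaneWaveIntegral {a b : ℕ} {ν : Measure Momentum} {ψ : Momentum → SpinTensor a b}
    {N : ℕ} (h : Integrable (fun p => (((1 + ‖p‖ ^ 2) ^ N)⁻¹ : ℝ) • ψ p) ν) :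
    ∃ φ : TensorField a b, IsPlaneWaveIntegral ν ψ φ := by
  have hu : (fun p : Momentum => (((1 + ‖p‖ ^ 2) ^ N : ℝ) : ℂ)).HasTemperateGrowth := by
    have h1 : (fun p : Momentum => (1 + ‖p‖ ^ 2 : ℝ)).HasTemperateGrowth := by
      have := Function.hasTemperateGrowth_norm_sq Momentum
      fun_prop
    exact Complex.ofRealCLM.hasTemperateGrowth.comp (h1.pow N)
  have e : ∀ (g : 𝓢(Momentum, ℂ)) (p : Momentum),
      SchwartzMap.smulLeftCLM ℂ (fun p : Momentum => (((1 + ‖p‖ ^ 2) ^ N : ℝ) : ℂ)) g p •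
        ((((1 + ‖p‖ ^ 2) ^ N)⁻¹ : ℝ) • ψ p) = g p • ψ p := by
    intro g p
    have hne : (((1 + ‖p‖ ^ 2) ^ N : ℝ) : ℂ) ≠ 0 := by
      exact_mod_cast (by positivity : (0 : ℝ) < (1 + ‖p‖ ^ 2) ^ N).ne'
    rw [SchwartzMap.smulLeftCLM_apply_apply hu, ← Complex.coe_smul, smul_smul]
    congr 1
    rw [smul_eq_mul, Complex.ofReal_inv]
    field_simp
  refine ⟨ContinuousLinearMap.toPointwiseConvergenceCLM ℂ (RingHom.id ℂ) _ _
    ((integralAgainst h).comp ((SchwartzMap.smulLeftCLM ℂ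
      (fun p : Momentum => (((1 + ‖p‖ ^ 2) ^ N : ℝ) : ℂ))).comp fieldFourierCLM)), fun f => ?_⟩
  have e' : ∀ p, SchwartzMap.smulLeftCLM ℂ (fun p : Momentum => (((1 + ‖p‖ ^ 2) ^ N : ℝ) : ℂ))
      (fieldFourierCLM f) p • ((((1 + ‖p‖ ^ 2) ^ N)⁻¹ : ℝ) • ψ p) = fieldFourier f p • ψ p :=
    fun p => by rw [e, fieldFourierCLM_apply]
  constructor
  · refine (h.bdd_smul (φ := SchwartzMap.smulLeftCLM ℂ
      (fun p : Momentum => (((1 + ‖p‖ ^ 2) ^ N : ℝ) : ℂ)) (fieldFourierCLM f)) _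
      (SchwartzMap.continuous _).aestronglyMeasurable
      (Filter.Eventually.of_forall (SchwartzMap.norm_le_seminorm ℂ _))).congr
      (Filter.Eventually.of_forall e')
  · exact integral_congr_ae (Filter.Eventually.of_forall e')

/-- The field of each `ξ` is chosen separately; linearity is automatic, since a field is determined
by its amplitude. -/
lemma exists_linear_isPlaneWaveIntegral {m : ℝ} (hm : 0 < m) {n a b : ℕ}
    (J : SpinTensor n 0 →ₗ[ℂ] SpinTensor a b) : ∃ S : ParticleSpace m n →ₗ[ℂ] TensorField a b,
      ∀ ξ, IsPlaneWaveIntegral (shellMeasure m) (fun p => momentumMap hm J ξ p) (S ξ) := by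
  choose S hS using fun ξ => exists_isPlaneWaveIntegral (integrable_momentumMap hm J ξ)
  refine ⟨{ toFun := S, map_add' := fun ξ η => ?_, map_smul' := fun c ξ => ?_ }, hS⟩
  · have h := ((hS (ξ + η)).sub ((hS ξ).add (hS η))).eq_zero_iff.2 (by
      rw [map_add]
      filter_upwards [AEEqFun.coeFn_add (momentumMap hm J ξ) (momentumMap hm J η)] with p hp
      rw [hp, Pi.add_apply, sub_self])
    exact sub_eq_zero.1 h
  · have h := ((hS (c • ξ)).sub ((hS ξ).const_smul c)).eq_zero_iff.2 (by
      rw [map_smul]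
      filter_upwards [AEEqFun.coeFn_smul c (momentumMap hm J ξ)] with p hp
      rw [hp, Pi.smul_apply, sub_self])
    exact sub_eq_zero.1 h

/-! ### Poincaré action on plane wave integrals. -/

/-- The vector action of `h` is the dual action of `(h†)⁻¹`, for which invariance of Lebesgue
measure is already known. -/
lemma measurePreserving_lorentz (h : SL2C) :
    MeasurePreserving (lorentz h) (volume : Measure Spacetime) volume := by
  let g : SL2C := ⟨(h : Matrix (Fin 2) (Fin 2) ℂ).conjTranspose, by
    rw [Matrix.det_conjTranspose, h.2, star_one]⟩
  have e : lorentz h = colorentz g⁻¹ := by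
    change hermAct _ = hermAct ((g⁻¹⁻¹ : SL2C) : Matrix (Fin 2) (Fin 2) ℂ).conjTranspose
    rw [inv_inv]
    change _ = hermAct (h : Matrix (Fin 2) (Fin 2) ℂ).conjTranspose.conjTranspose
    rw [Matrix.conjTranspose_conjTranspose]
  rw [e]
  exact measurePreserving_volume_colorentz g⁻¹

lemma pairing_add (p : Momentum) (x y : Spacetime) :
    pairing p (x + y) = pairing p x + pairing p y := by
  simp [pairing, mul_add, Finset.sum_add_distrib]

/-- Substitute `y = h x + v`, which preserves volume, and use `p(x) = (hp)(hx)`; the translation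
leaves the phase. -/
lemma fieldFourier_pullback (g : Poincare) (f : 𝓢(Spacetime, ℂ)) (p : Momentum) :
    fieldFourier (pullback g f) p = translationPhase g.trans (colorentz g.lin p) *
      fieldFourier f (colorentz g.lin p) := by
  set q := colorentz g.lin p with hq
  let F : Spacetime → ℂ := fun y => translationPhase g.trans q *
    (Complex.exp (-(Complex.I * pairing q y)) * f y)
  have hmp := (measurePreserving_add_right (volume : Measure Spacetime) g.trans).comp
    (measurePreserving_lorentz g.lin)
  have hemb : MeasurableEmbedding ((fun x => x + g.trans) ∘ lorentz g.lin) :=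
    (measurableEmbedding_addRight g.trans).comp
      (lorentzEquiv g.lin).toHomeomorph.measurableEmbedding
  have h1 := hmp.integral_comp hemb F
  have h2 : fieldFourier (pullback g f) p = ∫ x, F (lorentz g.lin x + g.trans) := by
    refine integral_congr_ae (Filter.Eventually.of_forall fun x => ?_)
    simp only [F, pullback_apply, pairing_add, translationPhase]
    rw [hq, pairing_colorentz, ← mul_assoc, ← Complex.exp_add]
    congr 2
    push_cast
    ring
  rw [h2]
  refine h1.trans ?_
  rw [fieldFourier, ← integral_const_mul]

lemma colorentz_inv_apply_self (h : SL2C) (p : Momentum) : colorentz h⁻¹ (colorentz h p) = p := by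
  rw [← Module.End.mul_apply, ← map_mul, inv_mul_cancel, map_one, Module.End.one_apply]

lemma measurableEmbedding_colorentz (h : SL2C) : MeasurableEmbedding (colorentz h) :=
  (LinearMap.continuous_of_finiteDimensional (colorentz h)).measurableEmbedding
    (Function.LeftInverse.injective (colorentz_inv_apply_self h))

/-- The substitution `p ↦ hp` preserves `β_m`, so the factors produced by `fieldFourier_pullback`
can be moved to the amplitude. -/
lemma IsPlaneWaveIntegral.fieldAct {m : ℝ} (hm : 0 < m) {a b : ℕ} {ψ : Momentum → SpinTensor a b}
    {φ : TensorField a b} (h : IsPlaneWaveIntegral (shellMeasure m) ψ φ) (g : Poincare) :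
    IsPlaneWaveIntegral (shellMeasure m) (fun p => translationPhase g.trans p •
      spinRep a b g.lin (ψ (colorentz g.lin⁻¹ p))) (fieldAct g φ) := by
  intro f
  let F : Momentum → SpinTensor a b := fun p => fieldFourier f p • translationPhase g.trans p •
    spinRep a b g.lin (ψ (colorentz g.lin⁻¹ p))
  have hmp := measurePreserving_colorentz hm g.lin
  have e : F ∘ colorentz g.lin = fun p => (spinRep a b g.lin).toContinuousLinearMap
      (fieldFourier (pullback g f) p • ψ p) := by
    funext p
    simp only [F, Function.comp_apply, colorentz_inv_apply_self]
    rw [fieldFourier_pullback, LinearMap.coe_toContinuousLinearMap', map_smul, smul_smul, mul_comm]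
  have hi : Integrable (F ∘ colorentz g.lin) (shellMeasure m) := by
    rw [e]
    exact ContinuousLinearMap.integrable_comp _ (h (pullback g f)).1
  refine ⟨(hmp.integrable_comp_emb (measurableEmbedding_colorentz g.lin)).1 hi, ?_⟩
  rw [fieldAct_apply, (h (pullback g f)).2]
  change _ = ∫ p, F p ∂shellMeasure m
  rw [← hmp.integral_comp (measurableEmbedding_colorentz g.lin) F]
  refine (ContinuousLinearMap.integral_comp_comm (spinRep a b g.lin).toContinuousLinearMap
    (h (pullback g f)).1).symm.trans ?_
  rw [← e]
  rfl

/-! ### Superpositions of masses and the image of the field map. -/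

lemma lintegral_spectralMeasure (ρ : Measure ℝ) [SFinite ρ] {F : Momentum → ENNReal}
    (hF : Measurable F) :
    ∫⁻ p, F p ∂spectralMeasure ρ = ∫⁻ μ in Set.Ioi 0, ∫⁻ p, F p ∂shellMeasure μ ∂ρ := by
  have hpt : Measurable fun x : ℝ × EuclideanSpace ℝ (Fin 3) => shellPoint x.1 x.2 := by
    unfold shellPoint
    refine (PiLp.continuous_toLp 2 _).measurable.comp (measurable_pi_iff.2 fun i => ?_)
    fin_cases i <;> simp <;> fun_prop
  have hw : Measurable fun x : ℝ × EuclideanSpace ℝ (Fin 3) =>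
      ENNReal.ofReal (1 / (2 * √(x.1 ^ 2 + ‖x.2‖ ^ 2))) := by fun_prop
  have hg : Measurable fun x : ℝ × EuclideanSpace ℝ (Fin 3) => F (shellPoint x.1 x.2) := hF.comp hpt
  rw [spectralMeasure, lintegral_map hF hpt,
    lintegral_withDensity_eq_lintegral_mul _ hw hg,
    lintegral_prod _ (hw.mul hg).aemeasurable]
  refine lintegral_congr fun μ => ?_
  rw [lintegral_shellMeasure μ hF]
  rfl

/-- Shells of different masses are disjoint, so only an atom of `ρ` at `m` contributes. -/
lemma spectralMeasure_restrict {m : ℝ} (hm : 0 < m) (ρ : Measure ℝ) [SFinite ρ] :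
    (spectralMeasure ρ).restrict (massShell m) = ρ {m} • shellMeasure m := by
  refine Measure.ext_of_lintegral _ fun F hF => ?_
  rw [← lintegral_indicator (measurableSet_massShell m),
    lintegral_spectralMeasure ρ (hF.indicator (measurableSet_massShell m)), lintegral_smul_measure]
  have h : ∀ μ ∈ Set.Ioi (0 : ℝ), ∫⁻ p, (massShell m).indicator F p ∂shellMeasure μ
      = ({m} : Set ℝ).indicator (fun _ => ∫⁻ p, F p ∂shellMeasure m) μ := by
    intro μ hμ
    have hμ' : 0 < μ := hμ
    by_cases e : μ = m
    · subst e
      rw [Set.indicator_of_mem (Set.mem_singleton μ)]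
      refine lintegral_congr_ae ?_
      filter_upwards [ae_mem_massShell hμ'] with p hp
      rw [Set.indicator_of_mem hp]
    · rw [Set.indicator_of_notMem (by simpa using e)]
      rw [← lintegral_zero (μ := shellMeasure μ)]
      refine lintegral_congr_ae ?_
      filter_upwards [ae_mem_massShell hμ'] with p hp
      refine Set.indicator_of_notMem (fun hp' => e ?_) _
      have := hp.1.symm.trans hp'.1
      exact (pow_left_inj₀ hμ'.le hm.le two_ne_zero).1 this
  rw [setLIntegral_congr_fun measurableSet_Ioi h, lintegral_indicator (measurableSet_singleton m),
    Measure.restrict_restrict (measurableSet_singleton m),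
    Set.inter_eq_left.2 (Set.singleton_subset_iff.2 (Set.mem_Ioi.2 hm)), lintegral_const,
    Measure.restrict_apply_univ, mul_comm]
  rfl

lemma ae_spectralMeasure_pos (ρ : Measure ℝ) [SFinite ρ] : ∀ᵐ p ∂spectralMeasure ρ, 0 < p 0 := by
  have hs : MeasurableSet {p : Momentum | ¬ 0 < p 0} :=
    (measurableSet_lt measurable_const (g := fun p : Momentum => p 0) (by fun_prop)).compl
  rw [ae_iff, ← lintegral_indicator_one hs,
    lintegral_spectralMeasure ρ (measurable_one.indicator hs)]
  rw [← lintegral_zero (μ := ρ.restrict (Set.Ioi 0))]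
  refine setLIntegral_congr_fun measurableSet_Ioi fun μ hμ => ?_
  have hμ' : (0 : ℝ) < μ := hμ
  simp only
  rw [← lintegral_zero (μ := shellMeasure μ)]
  refine lintegral_congr_ae ?_
  filter_upwards [ae_mem_massShell hμ'] with p hp
  exact Set.indicator_of_notMem (by simpa using hp.2) _

lemma spectralMeasure_dirac {m : ℝ} (hm : 0 < m) :
    spectralMeasure (Measure.dirac m) = shellMeasure m := by
  refine Measure.ext_of_lintegral _ fun F hF => ?_
  rw [lintegral_spectralMeasure _ hF, restrict_dirac' measurableSet_Ioi,
    if_pos (Set.mem_Ioi.2 hm), lintegral_dirac]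

lemma symbol_restContraction_apply {m : ℝ} (hm : 0 < m) {a b : ℕ} {p : Momentum} (hp : p ∈ massShell m)
    (w : SpinTensor (a + 1) (b + 1)) :
    symbol m (spinRep a b) (restContraction a b) p w = 0 ↔ contract (covectorGamma p) w = 0 := by
  rw [← smul_symbol_restContraction hm a b hp, LinearMap.smul_apply, smul_eq_zero_iff_right]
  exact_mod_cast hm.ne'

lemma isPositiveEnergyField_of_isPlaneWaveIntegral {m : ℝ} (hm : 0 < m) {a b : ℕ}
    {Ψ : Momentum →ₘ[shellMeasure m] SpinTensor a b} {φ : TensorField a b}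
    (hΨ : ∫⁻ p, ‖spinRep a b (boost m p)⁻¹ (Ψ p)‖ₑ ^ 2 ∂shellMeasure m < ⊤)
    (h : IsPlaneWaveIntegral (shellMeasure m) (fun p => Ψ p) φ) : IsPositiveEnergyField φ := by
  refine ⟨Measure.dirac m, inferInstance, fun p => Ψ p, ?_⟩
  rw [spectralMeasure_dirac hm]
  refine ⟨Ψ.aestronglyMeasurable, lt_of_eq_of_lt (lintegral_congr_ae ?_) hΨ, h⟩
  filter_upwards [ae_mem_massShell hm] with p hp
  rw [hp.1, Real.sqrt_sq hm.le]

theorem mem_range_iff_of_isMomentumRealization {m : ℝ} (hm : 0 < m) {a b : ℕ}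
    {T : ParticleSpace m (a + b + 2) →ₗ[ℂ] (Momentum →ₘ[shellMeasure m] SpinTensor (a + 1) (b + 1))}
    (hT : IsMomentumRealization hm (a + b + 2) (symbol m (spinRep a b) (restContraction a b)) T)
    {S : ParticleSpace m (a + b + 2) →ₗ[ℂ] TensorField (a + 1) (b + 1)}
    (hS : ∀ ξ, IsPlaneWaveIntegral (shellMeasure m) (fun p => T ξ p) (S ξ))
    (φ : TensorField (a + 1) (b + 1)) : φ ∈ LinearMap.range S ↔
      IsPositiveEnergyField φ ∧ kleinGordon m φ = 0 ∧ divergence φ = 0 := by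
  constructor
  · rintro ⟨ξ, rfl⟩
    obtain ⟨h1, h2⟩ := (hT.mem_range_iff _).1 ⟨ξ, rfl⟩
    refine ⟨isPositiveEnergyField_of_isPlaneWaveIntegral hm h1 (hS ξ),
      ((hS ξ).kleinGordon m).eq_zero_iff.2 ?_, ((hS ξ).divergence).eq_zero_iff.2 ?_⟩
    · filter_upwards [ae_mem_massShell hm] with p hp
      rw [hp.1, sub_self, Complex.ofReal_zero, zero_smul]
    · filter_upwards [ae_mem_massShell hm, h2] with p hp h
      rw [(symbol_restContraction_apply hm hp _).1 h, neg_zero]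
  · rintro ⟨⟨ρ, hρ, ψ, hψm, hψ, hφ⟩, hkg, hdiv⟩
    have hkg' := (hφ.kleinGordon m).eq_zero_iff.1 hkg
    have hdiv' := hφ.divergence.eq_zero_iff.1 hdiv
    -- The Klein–Gordon equation kills the amplitude where `⟨p,p⟩ ≠ m²`; positivity of the energy
    -- excludes the backward sheet of the hyperboloid.
    have hsupp : ∀ᵐ p ∂spectralMeasure ρ, p ∉ massShell m → ψ p = 0 := by
      filter_upwards [hkg', ae_spectralMeasure_pos ρ] with p h1 h2 h3
      refine (smul_eq_zero.1 h1).resolve_left fun h => h3 ⟨?_, h2⟩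
      have : m ^ 2 - minkSq p = 0 := by exact_mod_cast h
      linarith
    have hval : ∀ f, φ f = (ρ {m}).toReal • ∫ p, fieldFourier f p • ψ p ∂shellMeasure m := by
      intro f
      rw [(hφ f).2, ← integral_smul_measure, ← spectralMeasure_restrict hm,
        setIntegral_eq_integral_of_ae_compl_eq_zero]
      filter_upwards [hsupp] with p h hp
      rw [h hp, smul_zero]
    -- Here the field is zero. Otherwise the atom is nonzero and finite, and statements valid
    -- `ν`-almost everywhere restrict to `β_m`.
    by_cases hc : (ρ {m}).toReal = 0
    · refine ⟨0, ?_⟩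
      rw [map_zero]
      refine DFunLike.ext _ _ fun f => ?_
      rw [hval, hc, zero_smul]
      rfl
    obtain ⟨hc0, hctop⟩ := ENNReal.toReal_ne_zero.1 hc
    have hae : ∀ {P : Momentum → Prop}, (∀ᵐ p ∂spectralMeasure ρ, P p) →
        ∀ᵐ p ∂shellMeasure m, P p := by
      intro P hP
      have := ae_restrict_of_ae (s := massShell m) hP
      rw [spectralMeasure_restrict hm] at this
      exact (Measure.ae_ennreal_smul_measure_iff hc0).1 this
    have hm1 : AEStronglyMeasurable ψ (shellMeasure m) := by
      have := hψm.mono_measure (Measure.restrict_le_self (s := massShell m))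
      rw [spectralMeasure_restrict hm] at this
      exact this.mono_ac (Measure.absolutelyContinuous_smul hc0)
    -- The mass of the atom is absorbed into the amplitude, since `T` refers to `β_m` itself.
    set c : ℂ := ((ρ {m}).toReal : ℂ) with hcdef
    obtain ⟨ξ, hξ⟩ := (hT.mem_range_iff (AEEqFun.mk (fun p => c • ψ p) (hm1.const_smul c))).2 (by
      have hcoe := AEEqFun.coeFn_mk (fun p => c • ψ p) (hm1.const_smul c)
      constructor
      · have h1 : ∫⁻ p, ‖spinRep (a + 1) (b + 1) (boost √(minkSq p) p)⁻¹ (ψ p)‖ₑ ^ 2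
            ∂(spectralMeasure ρ).restrict (massShell m) < ⊤ :=
          lt_of_le_of_lt (lintegral_mono' Measure.restrict_le_self le_rfl) hψ
        rw [spectralMeasure_restrict hm, lintegral_smul_measure] at h1
        have h2 := ENNReal.lt_top_of_mul_ne_top_right h1.ne hc0
        have h3 : ∫⁻ p, ‖spinRep (a + 1) (b + 1) (boost m p)⁻¹
            (AEEqFun.mk (fun p => c • ψ p) (hm1.const_smul c) p)‖ₑ ^ 2 ∂shellMeasure m
            = ‖c‖ₑ ^ 2 * ∫⁻ p, ‖spinRep (a + 1) (b + 1) (boost √(minkSq p) p)⁻¹ (ψ p)‖ₑ ^ 2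
              ∂shellMeasure m := by
          rw [← lintegral_const_mul' _ _ (by simp)]
          refine lintegral_congr_ae ?_
          filter_upwards [hcoe, ae_mem_massShell hm] with p h4 hp
          rw [h4, hp.1, Real.sqrt_sq hm.le, map_smul, enorm_smul, mul_pow]
        rw [h3]
        exact ENNReal.mul_lt_top (by simp) h2
      · filter_upwards [hcoe, ae_mem_massShell hm, hae hdiv'] with p h4 hp h5
        rw [h4, map_smul, (symbol_restContraction_apply hm hp _).2 (neg_eq_zero.1 h5), smul_zero])
    refine ⟨ξ, DFunLike.ext _ _ fun f => ?_⟩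
    have h6 := (hS ξ f).2
    rw [hξ] at h6
    rw [h6, hval, ← Complex.coe_smul, ← integral_smul]
    refine integral_congr_ae ?_
    filter_upwards [AEEqFun.coeFn_mk (fun p => c • ψ p) (hm1.const_smul c)] with p h4
    rw [h4, smul_comm]

/-! ### Smooth fields: distributional and pointwise equations. -/

/-- A tempered distribution vanishing on compactly supported Schwartz functions vanishes. -/
theorem eq_zero_of_forall_hasCompactSupport {F : Type*} [NormedAddCommGroup F] [NormedSpace ℂ F]
    {φ : 𝓢'(Spacetime, F)} (h : ∀ f : 𝓢(Spacetime, ℂ), HasCompactSupport f → φ f = 0) : φ = 0 := by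
  refine DFunLike.ext _ _ fun f => ?_
  obtain ⟨χ, hχ⟩ : ∃ χ : ContDiffBump (0 : Spacetime), χ = ⟨1, 2, one_pos, one_lt_two⟩ := ⟨_, rfl⟩
  -- The cutoffs `χ (r N • x)` equal `1` for `‖x‖ ≤ N + 1`; the products `fN` converge to `f` in
  -- Schwartz space at the rate `r N`.
  let r : ℕ → ℝ := fun N => ((N : ℝ) + 1)⁻¹
  have hr0 : ∀ N, 0 < r N := fun N => by positivity
  have hr1 : ∀ N, r N ≤ 1 := fun N => inv_le_one_of_one_le₀ (by simp)
  have hcd : ∀ N, ContDiff ℝ ∞ fun x : Spacetime => χ (r N • x) := fun N =>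
    χ.contDiff.comp (contDiff_const_smul (r N))
  have hcs : ∀ N, HasCompactSupport fun x : Spacetime => χ (r N • x) • f x := fun N =>
    (χ.hasCompactSupport.comp_homeomorph (Homeomorph.smulOfNeZero (r N) (hr0 N).ne')).smul_right
  let fN : ℕ → 𝓢(Spacetime, ℂ) := fun N => (hcs N).toSchwartzMap ((hcd N).smul (f.smooth ⊤))
  -- Rescaling by `r N ≤ 1` does not increase derivatives, so these bounds for `χ - 1` serve for all
  -- `N` at once.
  have hG : ∀ i : ℕ, ∃ B : ℝ, 0 ≤ B ∧ ∀ y, ‖iteratedFDeriv ℝ i (fun x => χ x - 1) y‖ ≤ B := by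
    intro i
    let χS : 𝓢(Spacetime, ℝ) := χ.hasCompactSupport.toSchwartzMap χ.contDiff
    refine ⟨SchwartzMap.seminorm ℝ 0 i χS + 1, by positivity, fun y => ?_⟩
    have h1 := χS.norm_iteratedFDeriv_le_seminorm ℝ i y
    have h2 : ‖iteratedFDeriv ℝ i (fun _ : Spacetime => (1 : ℝ)) y‖ ≤ 1 := by
      rcases Nat.eq_zero_or_pos i with rfl | hi
      · rw [norm_iteratedFDeriv_zero]; simp
      · rw [iteratedFDeriv_const_of_ne hi.ne']; simp
    have h3 : iteratedFDeriv ℝ i (fun x => χ x - 1) y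
        = iteratedFDeriv ℝ i χ y - iteratedFDeriv ℝ i (fun _ : Spacetime => (1 : ℝ)) y :=
      iteratedFDeriv_sub_apply χ.contDiff.contDiffAt contDiff_const.contDiffAt
    rw [h3]
    exact (norm_sub_le _ _).trans (add_le_add h1 h2)
  choose B hB0 hB using hG
  have hlim : Filter.Tendsto fN Filter.atTop (nhds f) := by
    rw [(schwartz_withSeminorms ℝ Spacetime ℂ).tendsto_nhds]
    rintro ⟨k, n⟩ ε hε
    set C : ℝ := ∑ i ∈ Finset.range (n + 1),
      (n.choose i : ℝ) * B i * SchwartzMap.seminorm ℝ (k + 1) (n - i) f with hC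
    have hC0 : 0 ≤ C := Finset.sum_nonneg fun i _ => by
      have := hB0 i
      positivity
    have hbound : ∀ N, SchwartzMap.seminorm ℝ k n (fN N - f) ≤ r N * C := by
      intro N
      refine SchwartzMap.seminorm_le_bound ℝ k n _ (mul_nonneg (hr0 N).le hC0) fun x => ?_
      have hfun : ((fN N - f : 𝓢(Spacetime, ℂ)) : Spacetime → ℂ)
          = fun x => (χ (r N • x) - 1) • f x := by
        funext x
        change χ (r N • x) • f x - f x = _
        rw [sub_smul, one_smul]
      rw [hfun]
      by_cases hx : ‖x‖ < N + 1
      · have : (fun x : Spacetime => (χ (r N • x) - 1) • f x) =ᶠ[nhds x] fun _ => 0 := by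
          filter_upwards [(isOpen_lt continuous_norm continuous_const).mem_nhds hx] with y hy
          have hy' : ‖y‖ < N + 1 := hy
          have h1 : χ (r N • y) = 1 := χ.one_of_mem_closedBall (by
            rw [hχ, mem_closedBall_zero_iff, norm_smul, Real.norm_of_nonneg (hr0 N).le]
            simp only [r]
            rw [inv_mul_le_iff₀ (by positivity)]
            linarith)
          rw [h1, sub_self, zero_smul]
        rw [(Filter.EventuallyEq.iteratedFDeriv ℝ this n).eq_of_nhds, iteratedFDeriv_fun_zero]
        simp only [Pi.zero_apply, norm_zero, mul_zero]
        exact mul_nonneg (hr0 N).le hC0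
      -- Outside the ball one extra factor `‖x‖` is traded for `r N`; this is why `C` uses the
      -- seminorms of index `k + 1`.
      · have hx' : 1 ≤ r N * ‖x‖ := by
          simp only [r]
          rw [← div_eq_inv_mul, one_le_div (by positivity)]
          linarith
        have hGc : ContDiff ℝ ∞ fun x : Spacetime => χ x - 1 := χ.contDiff.sub contDiff_const
        have h1 := norm_iteratedFDeriv_smul_le (𝕜 := ℝ) ((hcd N).sub (contDiff_const (c := (1 : ℝ))))
          (f.smooth ⊤) x (n := n) (by exact_mod_cast le_top)
        have h2 : ∀ i, ‖iteratedFDeriv ℝ i (fun x : Spacetime => χ (r N • x) - 1) x‖ ≤ B i := by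
          intro i
          have h3 := iteratedFDeriv_comp_const_smul (i := i) (r N)
            (hGc.of_le (by exact_mod_cast le_top))
          rw [h3, norm_smul, norm_pow, Real.norm_of_nonneg (hr0 N).le]
          calc _ ≤ 1 * B i := mul_le_mul (pow_le_one₀ (hr0 N).le (hr1 N)) (hB i _)
                (norm_nonneg _) zero_le_one
            _ = B i := one_mul _
        calc _ ≤ ‖x‖ ^ k * ∑ i ∈ Finset.range (n + 1), (n.choose i : ℝ) *
              ‖iteratedFDeriv ℝ i (fun x : Spacetime => χ (r N • x) - 1) x‖ *
              ‖iteratedFDeriv ℝ (n - i) f x‖ := by gcongr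
          _ ≤ ‖x‖ ^ k * ∑ i ∈ Finset.range (n + 1), (n.choose i : ℝ) * B i *
              ‖iteratedFDeriv ℝ (n - i) f x‖ := by
              gcongr with i hi
              exact h2 i
          _ ≤ (r N * ‖x‖) * (‖x‖ ^ k * ∑ i ∈ Finset.range (n + 1), (n.choose i : ℝ) * B i *
              ‖iteratedFDeriv ℝ (n - i) f x‖) := by
              refine le_mul_of_one_le_left (mul_nonneg (by positivity)
                (Finset.sum_nonneg fun i _ => ?_)) hx'
              have := hB0 i
              positivity
          _ = r N * ∑ i ∈ Finset.range (n + 1), (n.choose i : ℝ) * B i *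
              (‖x‖ ^ (k + 1) * ‖iteratedFDeriv ℝ (n - i) f x‖) := by
              rw [Finset.mul_sum, Finset.mul_sum, Finset.mul_sum]
              refine Finset.sum_congr rfl fun i _ => by ring
          _ ≤ r N * C := by
              refine mul_le_mul_of_nonneg_left (Finset.sum_le_sum fun i _ => ?_) (hr0 N).le
              have := hB0 i
              gcongr
              exact SchwartzMap.le_seminorm ℝ (k + 1) (n - i) f x
    have ht : Filter.Tendsto (fun N => r N * C) Filter.atTop (nhds 0) := by
      have := (tendsto_one_div_add_atTop_nhds_zero_nat (𝕜 := ℝ)).mul_const C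
      simpa only [one_div, zero_mul] using this
    filter_upwards [ht.eventually (gt_mem_nhds hε)] with N hN
    exact (hbound N).trans_lt hN
  have h1 : Filter.Tendsto (fun N => φ (fN N)) Filter.atTop (nhds (φ f)) :=
    ((map_continuous φ).tendsto f).comp hlim
  have h2 : ∀ N, φ (fN N) = 0 := fun N => h _ (hcs N)
  simp only [h2] at h1
  exact (tendsto_nhds_unique h1 tendsto_const_nhds)

/-- The distribution `φ` is given by the function `Φ` on test functions. -/
def RepresentsOnTests {a b : ℕ} (Φ : Spacetime → SpinTensor a b) (φ : TensorField a b) : Prop :=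
  ∀ f : 𝓢(Spacetime, ℂ), HasCompactSupport f → φ f = ∫ x, f x • Φ x

/-- Derivatives of a smooth field may grow too fast to be integrated against Schwartz functions.
Compactly supported tests avoid this, and by `eq_zero_of_forall_hasCompactSupport` they suffice to
detect zero. -/
lemma Represents.onTests {a b : ℕ} {Φ : Spacetime → SpinTensor a b} {φ : TensorField a b}
    (h : Represents Φ φ) : RepresentsOnTests Φ φ := fun f _ => (h f).2

lemma integrable_smul_of_hasCompactSupport {a b : ℕ} {Φ : Spacetime → SpinTensor a b}
    (hΦ : Continuous Φ) {f : Spacetime → ℂ} (hf : Continuous f) (hc : HasCompactSupport f) :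
    Integrable fun x => f x • Φ x :=
  (hf.smul hΦ).integrable_of_hasCompactSupport hc.smul_right

lemma contDiff_partialDeriv {a b : ℕ} {Φ : Spacetime → SpinTensor a b} (hΦ : ContDiff ℝ ∞ Φ)
    (μ : Fin 4) : ContDiff ℝ ∞ (partialDeriv μ Φ) :=
  (hΦ.fderiv_right (m := ∞) (by exact le_rfl)).clm_apply contDiff_const

namespace RepresentsOnTests

variable {a b : ℕ} {Φ Φ' : Spacetime → SpinTensor a b} {φ φ' : TensorField a b}

lemma add (h : RepresentsOnTests Φ φ) (h' : RepresentsOnTests Φ' φ') (hΦ : Continuous Φ)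
    (hΦ' : Continuous Φ') : RepresentsOnTests (fun x => Φ x + Φ' x) (φ + φ') := by
  intro f hf
  simp only [smul_add]
  rw [integral_add (integrable_smul_of_hasCompactSupport hΦ f.continuous hf)
    (integrable_smul_of_hasCompactSupport hΦ' f.continuous hf), ← h f hf, ← h' f hf]
  rfl

lemma sub (h : RepresentsOnTests Φ φ) (h' : RepresentsOnTests Φ' φ') (hΦ : Continuous Φ)
    (hΦ' : Continuous Φ') : RepresentsOnTests (fun x => Φ x - Φ' x) (φ - φ') := by
  intro f hf
  simp only [smul_sub]
  rw [integral_sub (integrable_smul_of_hasCompactSupport hΦ f.continuous hf)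
    (integrable_smul_of_hasCompactSupport hΦ' f.continuous hf), ← h f hf, ← h' f hf]
  rfl

lemma const_smul (h : RepresentsOnTests Φ φ) (c : ℂ) :
    RepresentsOnTests (fun x => c • Φ x) (c • φ) := by
  intro f hf
  simp only [smul_comm _ c]
  rw [integral_smul, ← h f hf]
  rfl

lemma sum {ι : Type*} {s : Finset ι} {Φ : ι → Spacetime → SpinTensor a b} {φ : ι → TensorField a b}
    (h : ∀ i, RepresentsOnTests (Φ i) (φ i)) (hΦ : ∀ i, Continuous (Φ i)) :
    RepresentsOnTests (fun x => ∑ i ∈ s, Φ i x) (∑ i ∈ s, φ i) := by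
  classical
  induction s using Finset.induction_on with
  | empty =>
    intro f _
    simp only [Finset.sum_empty, smul_zero, integral_zero]
    rfl
  | insert i s hi ih =>
    simp only [Finset.sum_insert hi]
    exact (h i).add ih (hΦ i) (continuous_finsetSum _ fun i _ => hΦ i)

lemma mapValues {a' b' : ℕ} (h : RepresentsOnTests Φ φ) (hΦ : Continuous Φ)
    (L : SpinTensor a b →ₗ[ℂ] SpinTensor a' b') :
    RepresentsOnTests (fun x => L (Φ x)) (mapValues L φ) := by
  intro f hf
  have e : (fun x => f x • L (Φ x)) = fun x => L.toContinuousLinearMap (f x • Φ x) := by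
    funext x
    rw [map_smul]
    rfl
  rw [e, L.toContinuousLinearMap.integral_comp_comm
    (integrable_smul_of_hasCompactSupport hΦ f.continuous hf), ← h f hf]
  rfl

/-- Integration by parts, with no boundary terms because the test function has compact support. -/
lemma lineDeriv (h : RepresentsOnTests Φ φ) (hΦ : ContDiff ℝ ∞ Φ) (μ : Fin 4) :
    RepresentsOnTests (partialDeriv μ Φ) (∂_{unitVec μ} φ) := by
  intro f hf
  have hder : ∀ x, (∂_{unitVec μ} f : 𝓢(Spacetime, ℂ)) x = fderiv ℝ f x (unitVec μ) := fun x => rfl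
  have hc : HasCompactSupport fun x => fderiv ℝ f x (unitVec μ) := hf.fderiv_apply ℝ _
  have hcont : Continuous fun x => fderiv ℝ f x (unitVec μ) :=
    (∂_{unitVec μ} f : 𝓢(Spacetime, ℂ)).continuous
  have hneg : HasCompactSupport (-∂_{unitVec μ} f : 𝓢(Spacetime, ℂ)) := by
    have : ((-∂_{unitVec μ} f : 𝓢(Spacetime, ℂ)) : Spacetime → ℂ)
        = -fun x => fderiv ℝ f x (unitVec μ) := rfl
    rw [this]
    exact hc.neg
  have hibp := integral_smul_fderiv_eq_neg_fderiv_smul_of_integrable (μ := volume)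
    (f := f) (g := Φ) (v := unitVec μ)
    (integrable_smul_of_hasCompactSupport hΦ.continuous hcont hc)
    (integrable_smul_of_hasCompactSupport (contDiff_partialDeriv hΦ μ).continuous f.continuous hf)
    (integrable_smul_of_hasCompactSupport hΦ.continuous f.continuous hf)
    (fun x _ => f.differentiableAt)
    (fun x _ => hΦ.differentiable (by simp) x)
  refine (h _ hneg).trans ?_
  refine Eq.trans ?_ hibp.symm
  rw [← integral_neg]
  refine integral_congr_ae (Filter.Eventually.of_forall fun x => ?_)
  change (-(fderiv ℝ f x (unitVec μ))) • Φ x = _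
  rw [neg_smul]

/-- The fundamental lemma gives vanishing almost everywhere, and continuity makes it pointwise. -/
lemma eq_zero_iff (h : RepresentsOnTests Φ φ) (hΦ : Continuous Φ) : φ = 0 ↔ ∀ x, Φ x = 0 := by
  constructor
  · intro h0
    have hae : ∀ᵐ x, Φ x = 0 := by
      refine ae_eq_zero_of_integral_contDiff_smul_eq_zero hΦ.locallyIntegrable fun g hg hgc => ?_
      have hc : HasCompactSupport fun p => (g p : ℂ) := hgc.comp_left Complex.ofReal_zero
      have hs : ContDiff ℝ ∞ fun p => (g p : ℂ) := Complex.ofRealCLM.contDiff.comp hg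
      have h1 := h (hc.toSchwartzMap hs) hc
      rw [h0] at h1
      simp only [HasCompactSupport.toSchwartzMap_toFun, Complex.coe_smul] at h1
      exact h1.symm
    exact fun x => congrFun ((hΦ.ae_eq_iff_eq volume continuous_const).1 hae) x
  · intro h0
    refine eq_zero_of_forall_hasCompactSupport fun f hf => ?_
    rw [h f hf]
    simp [h0]

lemma kleinGordon (h : RepresentsOnTests Φ φ) (hΦ : ContDiff ℝ ∞ Φ) (m : ℝ) :
    RepresentsOnTests (smoothKleinGordon m Φ) (kleinGordon m φ) := by
  have hd := fun μ => (h.lineDeriv hΦ μ).lineDeriv (contDiff_partialDeriv hΦ μ) μ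
  have hc := fun μ => (contDiff_partialDeriv (contDiff_partialDeriv hΦ μ) μ).continuous
  exact ((((hd 0).sub (hd 1) (hc 0) (hc 1)).sub (hd 2) ((hc 0).sub (hc 1)) (hc 2)).sub (hd 3)
    (((hc 0).sub (hc 1)).sub (hc 2)) (hc 3)).add (h.const_smul ((m : ℂ) ^ 2))
    ((((hc 0).sub (hc 1)).sub (hc 2)).sub (hc 3)) (continuous_const.fun_smul hΦ.continuous)

end RepresentsOnTests

lemma continuous_smoothKleinGordon {a b : ℕ} {Φ : Spacetime → SpinTensor a b}
    (hΦ : ContDiff ℝ ∞ Φ) (m : ℝ) : Continuous (smoothKleinGordon m Φ) := by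
  have hc := fun μ => (contDiff_partialDeriv (contDiff_partialDeriv hΦ μ) μ).continuous
  exact ((((hc 0).sub (hc 1)).sub (hc 2)).sub (hc 3)).add (continuous_const.fun_smul hΦ.continuous)

lemma RepresentsOnTests.divergence {a b : ℕ} {Φ : Spacetime → SpinTensor (a + 1) (b + 1)}
    {φ : TensorField (a + 1) (b + 1)} (h : RepresentsOnTests Φ φ) (hΦ : ContDiff ℝ ∞ Φ) :
    RepresentsOnTests (smoothDivergence Φ) (divergence φ) :=
  RepresentsOnTests.sum (fun μ => ((h.lineDeriv hΦ μ).const_smul (-Complex.I)).mapValues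
    (continuous_const.fun_smul (contDiff_partialDeriv hΦ μ).continuous) (contract (covectorGamma (unitVec μ))))
    fun μ => (continuous_linearMap_spinTensor _).comp
      (continuous_const.fun_smul (contDiff_partialDeriv hΦ μ).continuous)

lemma continuous_smoothDivergence {a b : ℕ} {Φ : Spacetime → SpinTensor (a + 1) (b + 1)}
    (hΦ : ContDiff ℝ ∞ Φ) : Continuous (smoothDivergence Φ) :=
  continuous_finsetSum _ fun μ _ => (continuous_linearMap_spinTensor _).comp
    (continuous_const.fun_smul (contDiff_partialDeriv hΦ μ).continuous)

lemma Represents.kleinGordon_and_divergence_eq_zero_iff {a b : ℕ}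
    {Φ : Spacetime → SpinTensor (a + 1) (b + 1)} {φ : TensorField (a + 1) (b + 1)}
    (h : Represents Φ φ) (hΦ : ContDiff ℝ ∞ Φ) (m : ℝ) :
    (kleinGordon m φ = 0 ∧ divergence φ = 0) ↔
      (∀ x, smoothKleinGordon m Φ x = 0) ∧ ∀ x, smoothDivergence Φ x = 0 :=
  and_congr ((h.onTests.kleinGordon hΦ m).eq_zero_iff (continuous_smoothKleinGordon hΦ m))
    ((h.onTests.divergence hΦ).eq_zero_iff (continuous_smoothDivergence hΦ))

/-! ### Smooth fields are dense; injectivity and equivariance. -/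

/-- `(p, x) ↦ p(x) / 2π`, as a continuous bilinear map. -/
noncomputable def scaledPairing : Momentum →L[ℝ] Spacetime →L[ℝ] ℝ :=
  (2 * Real.pi)⁻¹ • innerSL ℝ

lemma scaledPairing_apply (p : Momentum) (x : Spacetime) :
    scaledPairing p x = (2 * Real.pi)⁻¹ * pairing p x := by
  change (2 * Real.pi)⁻¹ * inner ℝ p x = _
  rw [real_inner_comm, inner_eq_pairing]

lemma pairing_comm (p x : EuclideanSpace ℝ (Fin 4)) : pairing p x = pairing x p :=
  Finset.sum_congr rfl fun _ _ => mul_comm _ _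

lemma fourierChar_neg_scaledPairing {p x : EuclideanSpace ℝ (Fin 4)} :
    (Real.fourierChar (-(scaledPairing x p)) : ℂ) = Complex.exp (-(Complex.I * pairing p x)) := by
  rw [Real.fourierChar_apply, scaledPairing_apply, pairing_comm]
  congr 1
  have : (Real.pi : ℂ) ≠ 0 := by exact_mod_cast Real.pi_ne_zero
  push_cast
  field_simp

lemma fieldFourier_eq_fourierIntegral (f : 𝓢(Spacetime, ℂ)) :
    fieldFourier f = VectorFourier.fourierIntegral Real.fourierChar volume
      scaledPairing.toLinearMap₁₂ f := by
  funext p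
  refine integral_congr_ae (Filter.Eventually.of_forall fun x => ?_)
  change _ = (Real.fourierChar (-(scaledPairing x p)) : ℂ) * f x
  rw [fourierChar_neg_scaledPairing]

/-- The function is the Fourier integral of `ψ`, smooth because all moments are finite. The
transform passes from the test function to the amplitude by Fubini, the kernel being symmetric. -/
lemma IsPlaneWaveIntegral.exists_contDiff_represents {a b : ℕ} {ν : Measure Momentum} [SigmaFinite ν]
    {ψ : Momentum → SpinTensor a b} {φ : TensorField a b} (h : IsPlaneWaveIntegral ν ψ φ)
    (hψ : Integrable ψ ν) (hmom : ∀ k : ℕ, Integrable (fun p => ‖p‖ ^ k * ‖ψ p‖) ν) :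
    ∃ Φ : Spacetime → SpinTensor a b, ContDiff ℝ ∞ Φ ∧ Represents Φ φ := by
  have hΦ : ContDiff ℝ ∞ (VectorFourier.fourierIntegral Real.fourierChar ν
      scaledPairing.toLinearMap₁₂ ψ) :=
    VectorFourier.contDiff_fourierIntegral scaledPairing fun k _ => hmom k
  refine ⟨_, hΦ, fun f => ⟨?_, ?_⟩⟩
  · exact f.integrable.smul_bdd (∫ p, ‖ψ p‖ ∂ν) hΦ.continuous.aestronglyMeasurable
      (Filter.Eventually.of_forall
        (VectorFourier.norm_fourierIntegral_le_integral_norm _ _ _ _))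
  · have hflip : scaledPairing.toLinearMap₁₂.flip = scaledPairing.toLinearMap₁₂ := by
      refine LinearMap.ext₂ fun p x => ?_
      change scaledPairing x p = scaledPairing p x
      rw [scaledPairing_apply, scaledPairing_apply, pairing_comm]
    rw [(h f).2, fieldFourier_eq_fourierIntegral]
    refine (VectorFourier.integral_fourierIntegral_smul_eq_flip (L := scaledPairing.toLinearMap₁₂)
      Real.continuous_fourierChar ?_ f.integrable hψ).trans ?_
    · change Continuous fun q : Spacetime × Momentum => scaledPairing q.1 q.2
      fun_prop
    · rw [hflip]

/-- Continuous functions of compact support are dense in `L²(β_m)`, and the amplitude vanishes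
wherever the section does, since it is obtained fibrewise. -/
lemma dense_setOf_momentumMap_ae_eq_zero {m : ℝ} (hm : 0 < m) {n a b : ℕ}
    (J : SpinTensor n 0 →ₗ[ℂ] SpinTensor a b) :
    Dense {ξ : ParticleSpace m n | ∃ R : ℝ,
      ∀ᵐ p ∂shellMeasure m, R < ‖p‖ → momentumMap hm J ξ p = 0} := by
  have := isFiniteMeasureOnCompacts_shellMeasure hm
  rw [Metric.dense_iff]
  intro ξ ε hε
  obtain ⟨g, hgc, hfg, -, hg⟩ := (Lp.memLp (particleToL2 m n ξ)).exists_hasCompactSupport_eLpNorm_sub_le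
    ENNReal.ofNat_ne_top (ε := ENNReal.ofReal (ε / 2)) (by simpa using hε)
  obtain ⟨η, hη⟩ := particleToL2_surjective hm n (hg.toLp g)
  refine ⟨η, ?_, ?_⟩
  · rw [Metric.mem_ball, dist_comm, ← (particleToL2 m n).dist_map, hη, dist_eq_norm,
      ← Lp.toLp_coeFn (particleToL2 m n ξ) (Lp.memLp _), ← MemLp.toLp_sub, Lp.norm_toLp]
    exact (ENNReal.toReal_le_of_le_ofReal (by positivity) hfg).trans_lt (by linarith)
  · obtain ⟨R, hR⟩ := hgc.isCompact.isBounded.exists_norm_le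
    refine ⟨R, ?_⟩
    filter_upwards [coeFn_momentumMap hm J η, hg.coeFn_toLp] with p hp hgp hRp
    have h0 : g p = 0 := by
      by_contra hne
      exact hRp.not_ge (hR p (subset_tsupport g hne))
    rw [hp, hη, hgp, h0, map_zero, map_zero]

/-- On a bounded support all polynomial factors are bounded, so every moment is dominated by the
weighted integrability already known. -/
lemma integrable_moments_momentumMap {m : ℝ} (hm : 0 < m) {n a b : ℕ}
    {J : SpinTensor n 0 →ₗ[ℂ] SpinTensor a b} {ξ : ParticleSpace m n} {R : ℝ}
    (hR : ∀ᵐ p ∂shellMeasure m, R < ‖p‖ → momentumMap hm J ξ p = 0) (k : ℕ) :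
    Integrable (fun p => ‖p‖ ^ k * ‖momentumMap hm J ξ p‖) (shellMeasure m) := by
  refine ((integrable_momentumMap hm J ξ).norm.const_mul
    (|R| ^ k * (1 + |R| ^ 2) ^ (a + b + 1))).mono'
    ((continuous_norm.pow k).aestronglyMeasurable.mul
      (momentumMap hm J ξ).aestronglyMeasurable.norm) ?_
  filter_upwards [hR] with p hp
  rw [Real.norm_of_nonneg (by positivity)]
  by_cases h : R < ‖p‖
  · rw [hp h]
    simp
  · have h' : ‖p‖ ≤ |R| := (not_lt.1 h).trans (le_abs_self R)
    rw [norm_smul, Real.norm_of_nonneg (by positivity)]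
    calc ‖p‖ ^ k * ‖momentumMap hm J ξ p‖
        = ‖p‖ ^ k * (1 + ‖p‖ ^ 2) ^ (a + b + 1) *
          (((1 + ‖p‖ ^ 2) ^ (a + b + 1))⁻¹ * ‖momentumMap hm J ξ p‖) := by
          have : (0 : ℝ) < 1 + ‖p‖ ^ 2 := by positivity
          field_simp
      _ ≤ _ := by gcongr

theorem dense_setOf_exists_contDiff_represents {m : ℝ} (hm : 0 < m) {n a b : ℕ}
    {J : SpinTensor n 0 →ₗ[ℂ] SpinTensor a b} {S : ParticleSpace m n →ₗ[ℂ] TensorField a b}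
    (hS : ∀ ξ, IsPlaneWaveIntegral (shellMeasure m) (fun p => momentumMap hm J ξ p) (S ξ)) :
    Dense {ξ : ParticleSpace m n | ∃ Φ : Spacetime → SpinTensor a b,
      ContDiff ℝ ∞ Φ ∧ Represents Φ (S ξ)} := by
  have := isFiniteMeasureOnCompacts_shellMeasure hm
  refine (dense_setOf_momentumMap_ae_eq_zero hm J).mono ?_
  rintro ξ ⟨R, hR⟩
  have hmom := integrable_moments_momentumMap hm hR
  refine (hS ξ).exists_contDiff_represents ?_ hmom
  refine (integrable_norm_iff (momentumMap hm J ξ).aestronglyMeasurable).1 ?_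
  simpa using hmom 0

lemma injective_of_isPlaneWaveIntegral {m : ℝ} {hm : 0 < m} {n a b : ℕ} {E : Type*}
    [AddCommGroup E] [Module ℂ E] {Z : Momentum → SpinTensor a b →ₗ[ℂ] E}
    {T : ParticleSpace m n →ₗ[ℂ] (Momentum →ₘ[shellMeasure m] SpinTensor a b)}
    (hT : IsMomentumRealization hm n Z T) {S : ParticleSpace m n →ₗ[ℂ] TensorField a b}
    (hS : ∀ ξ, IsPlaneWaveIntegral (shellMeasure m) (fun p => T ξ p) (S ξ)) :
    Function.Injective S := by
  have := isFiniteMeasureOnCompacts_shellMeasure hm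
  refine (injective_iff_map_eq_zero S).2 fun ξ h => ?_
  have h0 := (hS ξ).eq_zero_iff.1 h
  rw [← inner_self_eq_zero (𝕜 := ℂ), hT.inner_eq]
  refine integral_eq_zero_of_ae ?_
  filter_upwards [h0] with p hp
  rw [hp, map_zero, inner_zero_left, Pi.zero_apply]

lemma equivariant_of_isPlaneWaveIntegral {m : ℝ} {hm : 0 < m} {n a b : ℕ} {E : Type*}
    [AddCommGroup E] [Module ℂ E] {Z : Momentum → SpinTensor a b →ₗ[ℂ] E}
    {T : ParticleSpace m n →ₗ[ℂ] (Momentum →ₘ[shellMeasure m] SpinTensor a b)}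
    (hT : IsMomentumRealization hm n Z T) {S : ParticleSpace m n →ₗ[ℂ] TensorField a b}
    (hS : ∀ ξ, IsPlaneWaveIntegral (shellMeasure m) (fun p => T ξ p) (S ξ)) (g : Poincare)
    (ξ : ParticleSpace m n) : S (particleRep hm n g ξ) = fieldAct g (S ξ) := by
  have := isFiniteMeasureOnCompacts_shellMeasure hm
  refine sub_eq_zero.1 (((hS _).sub ((hS ξ).fieldAct hm g)).eq_zero_iff.2 ?_)
  filter_upwards [hT.equivariant g ξ] with p hp
  rw [hp, sub_self]

end SpinField

/-! ### Assembly of the theorem. -/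

/-- The parameters are `a = 2α - 1`, `b = 2β - 1` and `n = 2σ`, so that both kinds of slots are
present; in the triangle inequalities the common extra slot of each kind has been cancelled. -/
theorem theorem4 (m : ℝ) (hm : 0 < m) (a b : ℕ) :
    -- which spins `σ = n / 2` occur in `W` under the little group
    (∀ n : ℕ, OccursIn m n (a + 1) (b + 1) ↔
      n ≤ a + b + 2 ∧ a ≤ b + n ∧ b ≤ a + n ∧ Even (a + b + n)) ∧
    -- every such spin is the kernel of some equivariant map
    (∀ n : ℕ, OccursIn m n (a + 1) (b + 1) →
      ∃ u : SpinTensor (a + 1) (b + 1) →ₗ[ℂ] SpinTensor (a + 1) (b + 1),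
        IsLittleGroupEquivariant m (spinRep (a + 1) (b + 1)) u ∧ KernelIsSpin m n u) ∧
    -- selection in momentum space by the symbol of any such map
    (∀ (n : ℕ) (E : Type*) [AddCommGroup E] [Module ℂ E] (ρE : Representation ℂ SL2C E)
      (u : SpinTensor (a + 1) (b + 1) →ₗ[ℂ] E),
      IsLittleGroupEquivariant m ρE u → KernelIsSpin m n u →
      (∀ h : SL2C, ∀ p ∈ massShell m, symbol m ρE u (colorentz h p) =
        ρE h ∘ₗ symbol m ρE u p ∘ₗ spinRep (a + 1) (b + 1) h⁻¹) ∧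
      ∃ T, IsMomentumRealization hm n (symbol m ρE u) T) ∧
    -- the explicit map in the minimal case `α + β = σ`, and its symbol
    (IsLittleGroupEquivariant m (spinRep a b) (restContraction a b) ∧
      KernelIsSpin m (a + b + 2) (restContraction a b) ∧
      ∀ p ∈ massShell m, (m : ℂ) • symbol m (spinRep a b) (restContraction a b) p =
        contract (covectorGamma p)) ∧
    -- selection in momentum space and in spacetime in the minimal case
    ∃ (T : ParticleSpace m (a + b + 2) →ₗ[ℂ]
          (Momentum →ₘ[shellMeasure m] SpinTensor (a + 1) (b + 1)))
      (J : ParticleSpace m (a + b + 2) →ₗ[ℂ] TensorField (a + 1) (b + 1)),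
      IsMomentumRealization hm (a + b + 2) (symbol m (spinRep a b) (restContraction a b)) T ∧
      (∀ ξ : ParticleSpace m (a + b + 2),
        IsPlaneWaveIntegral (shellMeasure m) (fun p => T ξ p) (J ξ)) ∧
      Function.Injective J ∧
      (∀ (g : Poincare) (ξ : ParticleSpace m (a + b + 2)),
        J (particleRep hm (a + b + 2) g ξ) = fieldAct g (J ξ)) ∧
      (∀ φ : TensorField (a + 1) (b + 1), φ ∈ LinearMap.range J ↔
        IsPositiveEnergyField φ ∧ kleinGordon m φ = 0 ∧ divergence φ = 0) ∧
      (∀ (Φ : Spacetime → SpinTensor (a + 1) (b + 1)) (φ : TensorField (a + 1) (b + 1)),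
        ContDiff ℝ ∞ Φ → Represents Φ φ → IsPositiveEnergyField φ →
        (φ ∈ LinearMap.range J ↔
          (∀ x, smoothKleinGordon m Φ x = 0) ∧ ∀ x, smoothDivergence Φ x = 0)) ∧
      Dense {ξ : ParticleSpace m (a + b + 2) |
        ∃ Φ : Spacetime → SpinTensor (a + 1) (b + 1), ContDiff ℝ ∞ Φ ∧ Represents Φ (J ξ)} := by
  have hocc : ∀ n : ℕ, OccursIn m n (a + 1) (b + 1) ↔
      n ≤ a + b + 2 ∧ a ≤ b + n ∧ b ≤ a + n ∧ Even (a + b + n) := by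
    intro n
    constructor
    · intro h
      obtain ⟨h1, h2, h3, h4⟩ := h.bounds hm
      rw [Nat.even_iff] at *
      exact ⟨by omega, by omega, by omega, by omega⟩
    · rintro ⟨h1, h2, h3, h4⟩
      rw [Nat.even_iff] at *
      exact occursIn_of_bounds hm (by omega) (by omega) (by omega)
        (by rw [Nat.even_iff]; omega)
  -- One isometry serves both for the momentum realization and for the fields, so that each field is
  -- the plane wave integral of precisely the amplitude given by the realization.
  obtain ⟨J₀, hinj, hJ₀, hrange₀⟩ := kernelIsSpin_restContraction hm a b
  obtain ⟨J, hrange, hJ, hiso⟩ := exists_isometric_equivariant hm hinj hJ₀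
  have hT := isMomentumRealization_momentumMap hm (spinRep a b) hJ hiso (hrange.trans hrange₀)
  obtain ⟨S, hS⟩ := exists_linear_isPlaneWaveIntegral hm J
  have hmem := mem_range_iff_of_isMomentumRealization hm hT hS
  refine ⟨hocc, fun n h => h.exists_kernelIsSpin hm, fun n E _ _ ρE u hu hk =>
    ⟨fun h p hp => symbol_colorentz hm hu h hp, exists_isMomentumRealization hm ρE hk⟩,
    ⟨restContraction_equivariant hm a b, kernelIsSpin_restContraction hm a b, fun p hp => smul_symbol_restContraction hm a b hp⟩,
    momentumMap hm J, S, hT, hS, injective_of_isPlaneWaveIntegral hT hS,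
    equivariant_of_isPlaneWaveIntegral hT hS, hmem, fun Φ φ hΦ hrep hpos => ?_,
    dense_setOf_exists_contDiff_represents hm hS⟩
  rw [hmem, ← hrep.kleinGordon_and_divergence_eq_zero_iff hΦ m]
  exact and_iff_right hpos
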